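/- **Calculus.** Fix a set $S$ of sorts of names, with infinitely many name constants of each sort. Types are $\tau ::= \diamond \mid (\tau_1,\dots,\tau_n)\to\tau \mid (s_1,\dots,s_n)\to\tau$ with $n\ge 1$ and $s_i\in S$ (processes, abstractions on agents, abstractions on names), and a sorting $\mathrm{ob}$ assigns to every sort $s$ the type $\mathrm{ob}(s)$ of the agents carried by names of sort $s$. The terms of $\Pi^{D,d}$ are the well-typed terms of the grammar $$T ::= 0 \mid X \mid u(X).T \mid \overline{u}[T'].T \mid T\,|\,T' \mid (c)T \mid\, !u(X).T \mid\, !\overline{u}[T'].T \mid \langle\tilde X\rangle T \mid \langle\tilde x\rangle T \mid T\langle\tilde T'\rangle \mid T\langle\tilde u\rangle ,$$ where prefixes, $|$ and restriction apply to terms of type $\diamond$ (so only processes may follow a prefix), an agent sent or received on $u$ of sort $s$ has type $\mathrm{ob}(s)$, and applications match the parameters in number and type. Terms are identified up to $\alpha$-conversion. Structural congruence $\equiv$ is the least congruence with the commutative monoid laws for $|$ and $0$, $(c)(d)T\equiv(d)(c)T$, $(c)(T\,|\,T')\equiv (c)T\,|\,T'$ if $c\notin fn(T')$, and $(\langle\tilde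 U\rangle T)\langle\tilde K\rangle\equiv T\{\tilde K/\tilde U\}$. Transitions of closed processes are labelled by $\tau$, $a(A)$ (early input of a closed agent) and $(\tilde c)\overline{a}A$ (output of $A$ extruding $\tilde c$), with the usual rules for prefixes, replicated prefixes, parallel composition, restriction, scope opening and communication, and are closed under $\equiv$. **Context bisimilarity.** A symmetric relation $\mathcal R$ on closed processes is a context bisimulation if $P\,\mathcal R\,Q$ implies: (1) if $P\xrightarrow{\alpha}P'$ with $\alpha=\tau$ or $\alpha=a(A)$, then $Q\stackrel{\hat\alpha}{\Longrightarrow}Q'$ with $P'\,\mathcal R\,Q'$ for some $Q'$; (2) if $P\xrightarrow{(\tilde c)\overline aA}P'$, then $Q\stackrel{(\tilde d)\overline aB}{\Longrightarrow}Q'$ for some $\tilde d$, $Q'$ and $B$ of the same type as $A$ such that $(\tilde c)(E[A]\,|\,P')\ \mathcal R\ (\tilde d)(E[B]\,|\,Q')$ for every process $E[X]$ with no free variable but $X$ and with $\{\tilde c,\tilde d\}\cap fn(E)=\emptyset$. On closed processes $\approx_{ct}$ is the largest context bisimulation; closed abstractions $F,G$ of the same type satisfy $F\approx_{ct}G$ iff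 $F\langle\tilde K\rangle\approx_{ct}G\langle\tilde K\rangle$ for all closed instances $\tilde K$ of the parameter types. **Theorem (Factorization).** Let $E[X]$ be a term whose only free variable is $X$, let $A$ be a closed agent of the type of $X$, and let $m$ be a name constant with $m\notin fn(E)\cup fn(A)$ which carries agents of type $\diamond$ in clauses (i), of type $\tau$ in clauses (ii), and of type $((t)\to\diamond)\to\diamond$ in clauses (iii). (1) If $E[X]$ is a process, then * (i) if $A$ is a process, $E[A]\approx_{ct}(m)(E[\overline m.0]\,|\,!m.A)$, where $\overline m.0$ stands for $\overline m[0].0$ and $m.A$ for $m(Z).A$ with $Z$ not free in $A$; * (ii) if $A$ is a process abstraction, of type $(\tau)\to\diamond$, then $E[A]\approx_{ct}(m)(E[\langle Z\rangle\overline m[Z].0]\,|\,!m(Z).A\langle Z\rangle)$; * (iii) if $A$ is a name abstraction, of type $(t)\to\diamond$, then $E[A]\approx_{ct}(m)(E[\langle z\rangle\overline m[\langle Y\rangle(Y\langle z\rangle)].0]\,|\,!m(Z).Z\langle A\rangle)$. (2) If $E[X]\equiv\langle\tilde U_1\rangle\cdots\langle\tilde U_k\rangle E'$ with $E'$ a process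 (each $\tilde U_j$ a tuple of process variables or a tuple of name variables), then * (i) if $A$ is a process, $E[A]\approx_{ct}\langle\tilde U_1\rangle\cdots\langle\tilde U_k\rangle\big((m)(E'[\overline m.0]\,|\,!m.A)\big)$; * (ii) if $A$ is of type $(\tau)\to\diamond$, then $E[A]\approx_{ct}\langle\tilde U_1\rangle\cdots\langle\tilde U_k\rangle\big((m)(E'[\langle Z\rangle\overline m[Z].0]\,|\,!m(Z).A\langle Z\rangle)\big)$; * (iii) if $A$ is of type $(t)\to\diamond$, then $E[A]\approx_{ct}\langle\tilde U_1\rangle\cdots\langle\tilde U_k\rangle\big((m)(E'[\langle z\rangle\overline m[\langle Y\rangle(Y\langle z\rangle)].0]\,|\,!m(Z).Z\langle A\rangle)\big)$. -/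

import Mathlib

/-! The higher-order process calculus with parameterization on processes and on names,
in its sorted (typed) form.  Bound variables and bound names are de Bruijn indices, so
alpha-convertible terms are equal; free names are constants. -/

noncomputable section

namespace HO

universe u

/-- Types of agents over a set `S` of sorts of names: processes, abstractions
`⟨X₁,…,Xₙ⟩T` on agents and abstractions `⟨x₁,…,xₙ⟩T` on names (`n ≥ 1`, the body may be
an abstraction again).  The parameter types are given as a head and a tail. -/
inductive Ty (S : Type u) : Type u
  | proc : Ty S
  | pabs (d : Ty S) (ds : List (Ty S)) (cod : Ty S) : Ty S
  | nabs (t : S) (ts : List S) (cod : Ty S) : Ty S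

/-- Positions in a list holding a given entry. -/
inductive Pos {α : Type u} : List α → α → Type u
  | zero {a : α} {l : List α} : Pos (a :: l) a
  | succ {a b : α} {l : List α} : Pos l a → Pos (b :: l) a

/-- Variables in a context.  A context is a list of blocks, one for each binder in scope
(innermost first); a block lists the variables which that binder binds simultaneously. -/
inductive Var {α : Type u} : List (List α) → α → Type u
  | here {a : α} {d : List α} {Γ : List (List α)} : Pos d a → Var (d :: Γ) a
  | there {a : α} {d : List α} {Γ : List (List α)} : Var Γ a → Var (d :: Γ) a

/-- Name constants: infinitely many of each sort. -/
structure NameConst (S : Type u) : Type u where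
  sort : S
  idx : ℕ

/-- Names of sort `s`: constants, and bound names (bound by a restriction or by a name
abstraction). -/
inductive Nm {S : Type u} (Δ : List (List S)) (s : S) : Type u
  | const (n : ℕ) : Nm Δ s
  | var (x : Var Δ s) : Nm Δ s

/-- Terms.  `ob s` is the type of the agents carried by names of sort `s`.
`Tm ob Δ Γ τ` are the terms of type `τ` whose bound names are listed in `Δ` and whose
process variables are listed in `Γ`. -/
inductive Tm {S : Type u} (ob : S → Ty S) :
    List (List S) → List (List (Ty S)) → Ty S → Type u
  /-- `0` -/
  | nil {Δ Γ} : Tm ob Δ Γ .proc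
  /-- `X` -/
  | var {Δ Γ τ} (x : Var Γ τ) : Tm ob Δ Γ τ
  /-- `u(X).T` -/
  | inp {Δ Γ s τ} (h : ob s = τ) (a : Nm Δ s) (T : Tm ob Δ ([τ] :: Γ) .proc) :
      Tm ob Δ Γ .proc
  /-- `ū[A].T` -/
  | out {Δ Γ s τ} (h : ob s = τ) (a : Nm Δ s) (A : Tm ob Δ Γ τ) (T : Tm ob Δ Γ .proc) :
      Tm ob Δ Γ .proc
  /-- `T | T'` -/
  | par {Δ Γ} (T T' : Tm ob Δ Γ .proc) : Tm ob Δ Γ .proc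
  /-- `(c)T`, with `c` of sort `s` -/
  | nu {Δ Γ} (s : S) (T : Tm ob ([s] :: Δ) Γ .proc) : Tm ob Δ Γ .proc
  /-- `!u(X).T` -/
  | rinp {Δ Γ s τ} (h : ob s = τ) (a : Nm Δ s) (T : Tm ob Δ ([τ] :: Γ) .proc) :
      Tm ob Δ Γ .proc
  /-- `!ū[A].T` -/
  | rout {Δ Γ s τ} (h : ob s = τ) (a : Nm Δ s) (A : Tm ob Δ Γ τ) (T : Tm ob Δ Γ .proc) :
      Tm ob Δ Γ .proc
  /-- `⟨X₁,…,Xₙ⟩T` -/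
  | pabs {Δ Γ d ds ρ} (T : Tm ob Δ ((d :: ds) :: Γ) ρ) : Tm ob Δ Γ (.pabs d ds ρ)
  /-- `⟨x₁,…,xₙ⟩T` -/
  | nabs {Δ Γ t ts ρ} (T : Tm ob ((t :: ts) :: Δ) Γ ρ) : Tm ob Δ Γ (.nabs t ts ρ)
  /-- `F⟨K₁,…,Kₙ⟩`, instances being agents -/
  | papp {Δ Γ d ds ρ} (F : Tm ob Δ Γ (.pabs d ds ρ))
      (K : ∀ τ, Pos (d :: ds) τ → Tm ob Δ Γ τ) : Tm ob Δ Γ ρ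
  /-- `F⟨u₁,…,uₙ⟩`, instances being names -/
  | napp {Δ Γ t ts ρ} (F : Tm ob Δ Γ (.nabs t ts ρ))
      (K : ∀ s, Pos (t :: ts) s → Nm Δ s) : Tm ob Δ Γ ρ

variable {S : Type u} {ob : S → Ty S}

/-- Closed agents of type `τ`. -/
abbrev Closed (ob : S → Ty S) (τ : Ty S) : Type u := Tm ob [] [] τ

/-- Closed processes. -/
abbrev Proc (ob : S → Ty S) : Type u := Closed ob .proc

/-- Terms `E[X]` of type `σ` with no free variable other than `X`, which has type `τ`. -/
abbrev Ctx (ob : S → Ty S) (τ σ : Ty S) : Type u := Tm ob [] [[τ]] σ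

/-! ### Free names -/

/-- The constants occurring in a name. -/
def Nm.fn {Δ : List (List S)} {s : S} : Nm Δ s → Set (NameConst S)
  | .const n => {⟨s, n⟩}
  | .var _ => ∅

/-- Free name constants of a term. -/
def Tm.fn {Δ : List (List S)} {Γ : List (List (Ty S))} {τ : Ty S} :
    Tm ob Δ Γ τ → Set (NameConst S)
  | .nil => ∅
  | .var _ => ∅
  | .inp _ a T => a.fn ∪ T.fn
  | .out _ a A T => a.fn ∪ A.fn ∪ T.fn
  | .par T T' => T.fn ∪ T'.fn
  | .nu _ T => T.fn
  | .rinp _ a T => a.fn ∪ T.fn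
  | .rout _ a A T => a.fn ∪ A.fn ∪ T.fn
  | .pabs T => T.fn
  | .nabs T => T.fn
  | .papp F K => F.fn ∪ ⋃ τ, ⋃ x, (K τ x).fn
  | .napp F K => F.fn ∪ ⋃ s, ⋃ x, (K s x).fn

/-! ### Renaming and substitution -/

/-- Sort-respecting maps on names (constants included). -/
abbrev NMap (Δ Δ' : List (List S)) : Type u := ∀ s : S, Nm Δ s → Nm Δ' s

/-- Renamings of process variables. -/
abbrev VMap (Γ Γ' : List (List (Ty S))) : Type u := ∀ τ : Ty S, Var Γ τ → Var Γ' τ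

/-- Substitutions of terms for process variables. -/
abbrev Sub (ob : S → Ty S) (Δ : List (List S)) (Γ Γ' : List (List (Ty S))) : Type u :=
  ∀ τ : Ty S, Var Γ τ → Tm ob Δ Γ' τ

/-- Weakening of names by one block. -/
def NMap.wk {Δ : List (List S)} (d : List S) : NMap Δ (d :: Δ)
  | _, .const n => .const n
  | _, .var x => .var (.there x)

/-- Lifting of a map on names under a binder of names. -/
def NMap.up {Δ Δ' : List (List S)} (f : NMap Δ Δ') (d : List S) : NMap (d :: Δ) (d :: Δ')
  | s, .const n => NMap.wk d s (f s (.const n))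
  | _, .var (.here x) => .var (.here x)
  | s, .var (.there x) => NMap.wk d s (f s (.var x))

/-- Lifting of a renaming of variables under a binder of variables. -/
def VMap.up {Γ Γ' : List (List (Ty S))} (f : VMap Γ Γ') (d : List (Ty S)) :
    VMap (d :: Γ) (d :: Γ')
  | _, .here x => .here x
  | τ, .there x => .there (f τ x)

/-- Capture-avoiding replacement of names by names and of variables by variables. -/
def Tm.ren {Δ : List (List S)} {Γ : List (List (Ty S))} {τ : Ty S} :
    Tm ob Δ Γ τ → ∀ {Δ' : List (List S)} {Γ' : List (List (Ty S))},
      NMap Δ Δ' → VMap Γ Γ' → Tm ob Δ' Γ' τ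
  | .nil, _, _, _, _ => .nil
  | .var x, _, _, _, g => .var (g _ x)
  | .inp h a T, _, _, f, g => .inp h (f _ a) (T.ren f (g.up _))
  | .out h a A T, _, _, f, g => .out h (f _ a) (A.ren f g) (T.ren f g)
  | .par T T', _, _, f, g => .par (T.ren f g) (T'.ren f g)
  | .nu s T, _, _, f, g => .nu s (T.ren (f.up _) g)
  | .rinp h a T, _, _, f, g => .rinp h (f _ a) (T.ren f (g.up _))
  | .rout h a A T, _, _, f, g => .rout h (f _ a) (A.ren f g) (T.ren f g)
  | .pabs T, _, _, f, g => .pabs (T.ren f (g.up _))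
  | .nabs T, _, _, f, g => .nabs (T.ren (f.up _) g)
  | .papp F K, _, _, f, g => .papp (F.ren f g) (fun τ x => (K τ x).ren f g)
  | .napp F K, _, _, f, g => .napp (F.ren f g) (fun s x => f s (K s x))

/-- Weakening by a block of names. -/
def Tm.wkN {Δ : List (List S)} {Γ : List (List (Ty S))} {τ : Ty S} (d : List S)
    (T : Tm ob Δ Γ τ) : Tm ob (d :: Δ) Γ τ :=
  T.ren (NMap.wk d) (fun _ x => x)

/-- Weakening by a block of variables. -/
def Tm.wkV {Δ : List (List S)} {Γ : List (List (Ty S))} {τ : Ty S} (d : List (Ty S))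
    (T : Tm ob Δ Γ τ) : Tm ob Δ (d :: Γ) τ :=
  T.ren (fun _ a => a) (fun _ x => .there x)

/-- Lifting of a substitution under a binder of variables. -/
def Sub.upV {Δ : List (List S)} {Γ Γ' : List (List (Ty S))} (f : Sub ob Δ Γ Γ')
    (d : List (Ty S)) : Sub ob Δ (d :: Γ) (d :: Γ')
  | _, .here x => .var (.here x)
  | τ, .there x => (f τ x).wkV d

/-- Lifting of a substitution under a binder of names. -/
def Sub.upN {Δ : List (List S)} {Γ Γ' : List (List (Ty S))} (f : Sub ob Δ Γ Γ')
    (d : List S) : Sub ob (d :: Δ) Γ Γ' :=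
  fun τ x => (f τ x).wkN d

/-- Capture-avoiding simultaneous substitution of terms for process variables. -/
def Tm.sub {Δ : List (List S)} {Γ : List (List (Ty S))} {τ : Ty S} :
    Tm ob Δ Γ τ → ∀ {Γ' : List (List (Ty S))}, Sub ob Δ Γ Γ' → Tm ob Δ Γ' τ
  | .nil, _, _ => .nil
  | .var x, _, f => f _ x
  | .inp h a T, _, f => .inp h a (T.sub (f.upV _))
  | .out h a A T, _, f => .out h a (A.sub f) (T.sub f)
  | .par T T', _, f => .par (T.sub f) (T'.sub f)
  | .nu s T, _, f => .nu s (T.sub (f.upN _))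
  | .rinp h a T, _, f => .rinp h a (T.sub (f.upV _))
  | .rout h a A T, _, f => .rout h a (A.sub f) (T.sub f)
  | .pabs T, _, f => .pabs (T.sub (f.upV _))
  | .nabs T, _, f => .nabs (T.sub (f.upN _))
  | .papp F K, _, f => .papp (F.sub f) (fun τ x => (K τ x).sub f)
  | .napp F K, _, f => .napp (F.sub f) K

/-- `{K̃/X̃}` for the innermost block of variables. -/
def Sub.inst {Δ : List (List S)} {Γ : List (List (Ty S))} {d : List (Ty S)}
    (K : ∀ τ, Pos d τ → Tm ob Δ Γ τ) : Sub ob Δ (d :: Γ) Γ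
  | τ, .here x => K τ x
  | _, .there x => .var x

/-- `{ũ/x̃}` for the innermost block of names. -/
def NMap.inst {Δ : List (List S)} {d : List S} (K : ∀ s, Pos d s → Nm Δ s) :
    NMap (d :: Δ) Δ
  | _, .const n => .const n
  | s, .var (.here x) => K s x
  | _, .var (.there x) => .var x

/-- The one-element tuple of agents. -/
def one {Δ : List (List S)} {Γ : List (List (Ty S))} {τ : Ty S} (A : Tm ob Δ Γ τ) :
    ∀ τ', Pos [τ] τ' → Tm ob Δ Γ τ'
  | _, .zero => A

/-- The one-element tuple of names. -/
def oneN {Δ : List (List S)} {t : S} (a : Nm Δ t) : ∀ s, Pos [t] s → Nm Δ s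
  | _, .zero => a

/-- `E[A]`, that is, `E{A/X}`. -/
def Tm.fill {Δ : List (List S)} {Γ : List (List (Ty S))} {τ σ : Ty S}
    (E : Tm ob Δ ([τ] :: Γ) σ) (A : Tm ob Δ Γ τ) : Tm ob Δ Γ σ :=
  E.sub (Sub.inst (one A))

/-- A closed agent, regarded as a term over any variables and bound names. -/
def Tm.lift {τ : Ty S} (A : Closed ob τ) (Δ : List (List S)) (Γ : List (List (Ty S))) :
    Tm ob Δ Γ τ :=
  A.ren (fun _ a => match a with | .const n => .const n) (fun _ x => nomatch x)

open Classical in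
/-- Turn the constant `c` into the innermost bound name. -/
def NMap.bind {Δ : List (List S)} (c : NameConst S) : NMap Δ ([c.sort] :: Δ)
  | s, .const n => if h : c.sort = s ∧ c.idx = n then .var (.here (h.1 ▸ .zero)) else .const n
  | _, .var x => .var (.there x)

/-- `(c)T` for a name constant `c`. -/
def res {Δ : List (List S)} {Γ : List (List (Ty S))} (c : NameConst S)
    (T : Tm ob Δ Γ .proc) : Tm ob Δ Γ .proc :=
  .nu c.sort (T.ren (NMap.bind c) (fun _ x => x))

/-- `(c₁)⋯(cₖ)T`. -/
def resList (cs : List (NameConst S)) (T : Proc ob) : Proc ob := cs.foldr res T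

/-! ### Structural congruence -/

/-- Structural congruence `≡`: the least congruence with the monoid laws for parallel
composition, commutation of restrictions, scope extension, and application of abstractions.
Scope extension and commutation are given on bound names: `T.wkN [s]` is the general
form of a term in which the restricted name does not occur. -/
inductive Cong : ∀ {Δ : List (List S)} {Γ : List (List (Ty S))} {τ : Ty S},
    Tm ob Δ Γ τ → Tm ob Δ Γ τ → Prop
  | refl {Δ Γ τ} (T : Tm ob Δ Γ τ) : Cong T T
  | symm {Δ Γ τ} {T T' : Tm ob Δ Γ τ} : Cong T T' → Cong T' T
  | trans {Δ Γ τ} {T T' T'' : Tm ob Δ Γ τ} : Cong T T' → Cong T' T'' → Cong T T''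
  | parNil {Δ Γ} (T : Tm ob Δ Γ .proc) : Cong (.par T .nil) T
  | parComm {Δ Γ} (T T' : Tm ob Δ Γ .proc) : Cong (.par T T') (.par T' T)
  | parAssoc {Δ Γ} (T T' T'' : Tm ob Δ Γ .proc) :
      Cong (.par (.par T T') T'') (.par T (.par T' T''))
  | nuComm {Δ Γ} (s t : S) (T : Tm ob ([t] :: [s] :: Δ) Γ .proc) :
      Cong (.nu s (.nu t T))
        (.nu t (.nu s (T.ren (fun _ a => match a with
          | .const n => .const n
          | .var (.here x) => .var (.there (.here x))
          | .var (.there (.here x)) => .var (.here x)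
          | .var (.there (.there x)) => .var (.there (.there x))) (fun _ x => x))))
  | nuPar {Δ Γ} (s : S) (T : Tm ob ([s] :: Δ) Γ .proc) (T' : Tm ob Δ Γ .proc) :
      Cong (.nu s (.par T (T'.wkN [s]))) (.par (.nu s T) T')
  | pbeta {Δ Γ d ds ρ} (T : Tm ob Δ ((d :: ds) :: Γ) ρ)
      (K : ∀ τ, Pos (d :: ds) τ → Tm ob Δ Γ τ) :
      Cong (.papp (.pabs T) K) (T.sub (Sub.inst K))
  | nbeta {Δ Γ t ts ρ} (T : Tm ob ((t :: ts) :: Δ) Γ ρ)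
      (K : ∀ s, Pos (t :: ts) s → Nm Δ s) :
      Cong (.napp (.nabs T) K) (T.ren (NMap.inst K) (fun _ x => x))
  | inp {Δ Γ s τ} (h : ob s = τ) (a : Nm Δ s) {T T' : Tm ob Δ ([τ] :: Γ) .proc} :
      Cong T T' → Cong (.inp h a T) (.inp h a T')
  | out {Δ Γ s τ} (h : ob s = τ) (a : Nm Δ s) {A A' : Tm ob Δ Γ τ}
      {T T' : Tm ob Δ Γ .proc} :
      Cong A A' → Cong T T' → Cong (.out h a A T) (.out h a A' T')
  | par {Δ Γ} {T T' V V' : Tm ob Δ Γ .proc} :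
      Cong T T' → Cong V V' → Cong (.par T V) (.par T' V')
  | nu {Δ Γ} (s : S) {T T' : Tm ob ([s] :: Δ) Γ .proc} :
      Cong T T' → Cong (.nu s T) (.nu s T')
  | rinp {Δ Γ s τ} (h : ob s = τ) (a : Nm Δ s) {T T' : Tm ob Δ ([τ] :: Γ) .proc} :
      Cong T T' → Cong (.rinp h a T) (.rinp h a T')
  | rout {Δ Γ s τ} (h : ob s = τ) (a : Nm Δ s) {A A' : Tm ob Δ Γ τ}
      {T T' : Tm ob Δ Γ .proc} :
      Cong A A' → Cong T T' → Cong (.rout h a A T) (.rout h a A' T')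
  | pabs {Δ Γ d ds ρ} {T T' : Tm ob Δ ((d :: ds) :: Γ) ρ} :
      Cong T T' → Cong (.pabs T) (.pabs T')
  | nabs {Δ Γ t ts ρ} {T T' : Tm ob ((t :: ts) :: Δ) Γ ρ} :
      Cong T T' → Cong (.nabs T) (.nabs T')
  | papp {Δ Γ d ds ρ} {F F' : Tm ob Δ Γ (.pabs d ds ρ)}
      {K K' : ∀ τ, Pos (d :: ds) τ → Tm ob Δ Γ τ} :
      Cong F F' → (∀ τ x, Cong (K τ x) (K' τ x)) → Cong (.papp F K) (.papp F' K')
  | napp {Δ Γ t ts ρ} {F F' : Tm ob Δ Γ (.nabs t ts ρ)}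
      (K : ∀ s, Pos (t :: ts) s → Nm Δ s) :
      Cong F F' → Cong (.napp F K) (.napp F' K)

/-! ### Labelled transitions -/

/-- Actions: `τ`, input `a(A)` and output `(c̃)āA`. -/
inductive Act (ob : S → Ty S) : Type u
  | tau : Act ob
  | inp (a : NameConst S) {τ : Ty S} (A : Closed ob τ) : Act ob
  | out (cs : List (NameConst S)) (a : NameConst S) {τ : Ty S} (A : Closed ob τ) : Act ob

/-- Names of an action. -/
def Act.names : Act ob → Set (NameConst S)
  | .tau => ∅
  | .inp a A => {a} ∪ A.fn
  | .out cs a A => {c | c ∈ cs} ∪ {a} ∪ A.fn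

/-- Bound names of an action. -/
def Act.bn : Act ob → Set (NameConst S)
  | .tau => ∅
  | .inp _ _ => ∅
  | .out cs _ _ => {c | c ∈ cs}

/-- The labelled transition system on closed processes. -/
inductive Step : Proc ob → Act ob → Proc ob → Prop
  | inp (a : NameConst S) {τ} (h : ob a.sort = τ) (T : Tm ob [] [[τ]] .proc)
      (A : Closed ob τ) : Step (.inp h (.const a.idx) T) (.inp a A) (T.fill A)
  | out (a : NameConst S) {τ} (h : ob a.sort = τ) (A : Closed ob τ) (T : Proc ob) :
      Step (.out h (.const a.idx) A T) (.out [] a A) T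
  | rinp (a : NameConst S) {τ} (h : ob a.sort = τ) (T : Tm ob [] [[τ]] .proc)
      (A : Closed ob τ) :
      Step (.rinp h (.const a.idx) T) (.inp a A)
        (.par (T.fill A) (.rinp h (.const a.idx) T))
  | rout (a : NameConst S) {τ} (h : ob a.sort = τ) (A : Closed ob τ) (T : Proc ob) :
      Step (.rout h (.const a.idx) A T) (.out [] a A)
        (.par T (.rout h (.const a.idx) A T))
  | res {T T' : Proc ob} {l : Act ob} (c : NameConst S) :
      Step T l T' → c ∉ l.names → Step (res c T) l (res c T')
  | opn {T T' : Proc ob} {cs : List (NameConst S)} {a : NameConst S} {τ}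
      {A : Closed ob τ} (d : NameConst S) :
      Step T (.out cs a A) T' → d ∈ A.fn → d ∉ cs → d ≠ a →
      Step (res d T) (.out (d :: cs) a A) T'
  | par {T T' : Proc ob} {l : Act ob} (V : Proc ob) :
      Step T l T' → Disjoint l.bn V.fn → Step (.par T V) l (.par T' V)
  | comm {T T' V V' : Proc ob} {cs : List (NameConst S)} {a : NameConst S} {τ}
      {A : Closed ob τ} :
      Step T (.inp a A) T' → Step V (.out cs a A) V' → Disjoint {c | c ∈ cs} T.fn →
      Step (.par T V) .tau (resList cs (.par T' V'))
  | cong {T T' V V' : Proc ob} {l : Act ob} :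
      Cong V T → Step T l T' → Cong T' V' → Step V l V'

/-- `⟹`: finitely many internal moves. -/
def Taus : Proc ob → Proc ob → Prop := Relation.ReflTransGen (fun P Q => Step P .tau Q)

/-- `⟹ l ⟹`. -/
def Weak (P : Proc ob) (l : Act ob) (Q : Proc ob) : Prop :=
  ∃ P' Q', Taus P P' ∧ Step P' l Q' ∧ Taus Q' Q

/-! ### Context bisimilarity -/

/-- Context bisimulations.  In the output clause `B` has the type of `A`, so it is an
abstraction on processes, an abstraction on names, or not an abstraction, as `A` is. -/
structure IsContextBisim (R : Proc ob → Proc ob → Prop) : Prop where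
  symm : ∀ P Q, R P Q → R Q P
  tau : ∀ P Q P', R P Q → Step P .tau P' → ∃ Q', Taus Q Q' ∧ R P' Q'
  inp : ∀ P Q P' (a : NameConst S) (τ : Ty S) (A : Closed ob τ), R P Q →
    Step P (.inp a A) P' → ∃ Q', Weak Q (.inp a A) Q' ∧ R P' Q'
  out : ∀ P Q P' (cs : List (NameConst S)) (a : NameConst S) (τ : Ty S) (A : Closed ob τ),
    R P Q → Step P (.out cs a A) P' →
    ∃ (ds : List (NameConst S)) (B : Closed ob τ) (Q' : Proc ob),
      Weak Q (.out ds a B) Q' ∧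
      ∀ E : Ctx ob τ .proc, Disjoint ({c | c ∈ cs} ∪ {d | d ∈ ds}) E.fn →
        R (resList cs (.par (E.fill A) P')) (resList ds (.par (E.fill B) Q'))

/-- Context bisimilarity `≈ct` of closed agents of the same type: the largest context
bisimulation on processes; abstractions are related when all their applications to closed
instances are. -/
def CtBisim : ∀ τ : Ty S, Closed ob τ → Closed ob τ → Prop
  | .proc, P, Q => ∃ R : Proc ob → Proc ob → Prop, IsContextBisim R ∧ R P Q
  | .pabs d ds ρ, F, G => ∀ K : ∀ τ, Pos (d :: ds) τ → Closed ob τ,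
      CtBisim ρ (.papp F K) (.papp G K)
  | .nabs t ts ρ, F, G => ∀ K : ∀ s, Pos (t :: ts) s → Nm [] s,
      CtBisim ρ (.napp F K) (.napp G K)

/-! ### Abstractions prefixing a process -/

/-- Bound names in scope below all the abstractions of a term of type `σ`. -/
def underN : Ty S → List (List S) → List (List S)
  | .proc, Δ => Δ
  | .pabs _ _ ρ, Δ => underN ρ Δ
  | .nabs t ts ρ, Δ => underN ρ ((t :: ts) :: Δ)

/-- Variables in scope below all the abstractions of a term of type `σ`. -/
def underV : Ty S → List (List (Ty S)) → List (List (Ty S))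
  | .proc, Γ => Γ
  | .pabs d ds ρ, Γ => underV ρ ((d :: ds) :: Γ)
  | .nabs _ _ ρ, Γ => underV ρ Γ

/-- `⟨Ũ₁⟩⋯⟨Ũₖ⟩T` of type `σ`, where `T` is a process. -/
def absAll : ∀ (σ : Ty S) {Δ : List (List S)} {Γ : List (List (Ty S))},
    Tm ob (underN σ Δ) (underV σ Γ) .proc → Tm ob Δ Γ σ
  | .proc, _, _, T => T
  | .pabs _ _ ρ, _, _, T => .pabs (absAll ρ T)
  | .nabs _ _ ρ, _, _, T => .nabs (absAll ρ T)

/-- Lifting of a substitution below all the abstractions of a term of type `σ`. -/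
def Sub.under : ∀ (σ : Ty S) {Δ : List (List S)} {Γ Γ' : List (List (Ty S))},
    Sub ob Δ Γ Γ' → Sub ob (underN σ Δ) (underV σ Γ) (underV σ Γ')
  | .proc, _, _, _, f => f
  | .pabs d ds ρ, _, _, _, f => Sub.under ρ (f.upV (d :: ds))
  | .nabs t ts ρ, _, _, _, f => Sub.under ρ (f.upN (t :: ts))

/-- `E'[A]`, where `E'` has the free variable `X` and those bound by the abstractions of
a term of type `σ`, and `A` is closed. -/
def fillUnder {τ : Ty S} (σ : Ty S)
    (E' : Tm ob (underN σ []) (underV σ [[τ]]) .proc) (A : Closed ob τ) :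
    Tm ob (underN σ []) (underV σ []) .proc :=
  E'.sub (Sub.under σ (Sub.inst (one A)))

/-! ### Triggers and handlers -/

/-- `m̄`, that is, `m̄0.0`. -/
def trigger (m : NameConst S) (hm : ob m.sort = .proc) : Proc ob :=
  .out hm (.const m.idx) .nil .nil

/-- `⟨Z⟩m̄Z`. -/
def triggerP {τ : Ty S} (m : NameConst S) (hm : ob m.sort = τ) :
    Closed ob (.pabs τ [] .proc) :=
  .pabs (.out hm (.const m.idx) (.var (.here .zero)) .nil)

/-- `⟨z⟩m̄[⟨Y⟩(Y⟨z⟩)]`. -/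
def triggerN {t : S} (m : NameConst S)
    (hm : ob m.sort = .pabs (.nabs t [] .proc) [] .proc) : Closed ob (.nabs t [] .proc) :=
  .nabs (.out hm (.const m.idx)
    (.pabs (.napp (.var (.here .zero)) (oneN (.var (.here .zero))))) .nil)

/-- `!m.A`, that is, `!m(Z).A` with `Z` not in `A`. -/
def handler (m : NameConst S) (hm : ob m.sort = .proc) (A : Proc ob) : Proc ob :=
  .rinp hm (.const m.idx) (A.lift _ _)

/-- `!m(Z).A⟨Z⟩`. -/
def handlerP {τ : Ty S} (m : NameConst S) (hm : ob m.sort = τ)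
    (A : Closed ob (.pabs τ [] .proc)) : Proc ob :=
  .rinp hm (.const m.idx) (.papp (A.lift _ _) (one (.var (.here .zero))))

/-- `!m(Z).Z⟨A⟩`. -/
def handlerN {t : S} (m : NameConst S)
    (hm : ob m.sort = .pabs (.nabs t [] .proc) [] .proc)
    (A : Closed ob (.nabs t [] .proc)) : Proc ob :=
  .rinp hm (.const m.idx) (.papp (.var (.here .zero)) (one (A.lift _ _)))

end HO

end

/-! Factoring a subagent out of a higher-order process leaves its behaviour unchanged, because a
trigger in place of the agent `A` can always fetch what `A` would have done from the handler: where
`A` is called in `E[A]`, the factored process calls the trigger, which sends the argument of the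
call (or `⟨Y⟩(Y⟨z⟩)` if this argument is a name `z`) along the private name `m`, and the
replicated handler answers with the same call of `A`.  This costs one internal move, and it is the
only difference between both processes.

The three clauses are treated at once.  A `Kind` records what a call of the agent is (`Kind.call`)
and the corresponding trigger and handler (`Kind.trig`, `Kind.hand`).  For a process context `E`,
the bisimulation `FacRel` consists of the pairs of `E[A]` and its factorization, in both orders and
up to structural congruence.  That it is a bisimulation rests on two normal forms of `E`.

* `Kind.exists_canon`: `E` is congruent to a parallel composition, below restrictions, of prefixed
  processes and calls of `X`.  In the factorization these calls become outputs on `m`, so a move is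
  either one of the prefixed processes, which `E[A]` makes as well, or the trigger calling the
  handler, which unfolds the call and leaves `E[A]` unchanged up to congruence (`fac_simulates`).
* `Kind.ready`: finitely many unfoldings of active calls of `X` turn `E` into a parallel composition
  of prefixed processes only.  Each unfolding is an internal move of the factorization
  (`Interp.fac_unfold`) and the identity on `E[A]`; afterwards the moves of `E[A]` are moves of
  `E` itself (`simulates_fac`).

Active components appear only after abstractions have been applied, so both normal forms need an
induction on types, and so does the inversion of `≡`, under which transitions are closed.  One
logical relation serves all three purposes: `Base.L` extends a relation on processes to agents of
all types, and `Base.L.of_cong` says that congruent terms are related as soon as the relation on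
processes respects the constructors, the laws of `|` and restriction, and head expansion.  For the
relation of having the same value under head reduction it gives `rel_of_cl_eq`: parallel
compositions of prefixed processes are congruent only if their components match up to a permutation
of the restrictions.  With `Step.shape`, which describes transitions up to congruence, this yields
the moves of a parallel composition of prefixed processes (`Step.tau_canon`, `Step.inp_canon`,
`Step.out_canon`).

If `E` is congruent to an abstraction `⟨Ũ₁⟩⋯⟨Ũₖ⟩E'`, instantiating the abstractions turns the claim
into the one for processes (`factorization_absAll`).  The name `m` need not be fresh for `E'`, only
for `E`; but `E'` is determined by `E` up to congruence (`Cong.of_absAll`), hence congruent to terms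
in which `m` does not occur (`cl_bind_of_notMem`). -/


noncomputable section

namespace HO

universe u

variable {S : Type u} {ob : S → Ty S}

/-! ### Renaming and substitution -/

section Maps

variable {Δ Δ' Δ'' : List (List S)} {Γ Γ' Γ'' : List (List (Ty S))}

/-- The identity map on names. -/
abbrev NMap.id (Δ : List (List S)) : NMap Δ Δ := fun _ a => a

/-- The identity renaming of variables. -/
abbrev VMap.id (Γ : List (List (Ty S))) : VMap Γ Γ := fun _ x => x

/-- Composition of maps on names, in diagrammatic order. -/
def NMap.comp (f : NMap Δ Δ') (g : NMap Δ' Δ'') : NMap Δ Δ'' := fun s a => g s (f s a)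

/-- Composition of renamings of variables, in diagrammatic order. -/
def VMap.comp (f : VMap Γ Γ') (g : VMap Γ' Γ'') : VMap Γ Γ'' := fun τ x => g τ (f τ x)

@[simp] theorem NMap.comp_apply (f : NMap Δ Δ') (g : NMap Δ' Δ'') (s : S) (a : Nm Δ s) :
    f.comp g s a = g s (f s a) := rfl

@[simp] theorem VMap.comp_apply (f : VMap Γ Γ') (g : VMap Γ' Γ'') (τ : Ty S) (x : Var Γ τ) :
    f.comp g τ x = g τ (f τ x) := rfl

@[simp] theorem VMap.id_comp (g : VMap Γ Γ') : VMap.comp (fun _ x => x) g = g := rfl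

theorem NMap.ext_cases {f g : NMap Δ Δ'} (hc : ∀ s n, f s (.const n) = g s (.const n))
    (hv : ∀ s x, f s (.var x) = g s (.var x)) : f = g := by
  funext s a
  cases a with
  | const n => exact hc s n
  | var x => exact hv s x

@[simp] theorem NMap.up_wk (f : NMap Δ Δ') (d : List S) (s : S) (a : Nm Δ s) :
    f.up d s (NMap.wk d s a) = NMap.wk d s (f s a) := by
  cases a <;> rfl

@[simp] theorem NMap.up_here (f : NMap Δ Δ') (d : List S) (s : S) (x : Pos d s) :
    f.up d s (.var (.here x)) = .var (.here x) := rfl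

@[simp] theorem NMap.up_there (f : NMap Δ Δ') (d : List S) (s : S) (x : Var Δ s) :
    f.up d s (.var (.there x)) = NMap.wk d s (f s (.var x)) := rfl

@[simp] theorem NMap.up_const (f : NMap Δ Δ') (d : List S) (s : S) (n : ℕ) :
    f.up d s (.const n) = NMap.wk d s (f s (.const n)) := rfl

@[simp] theorem NMap.wk_const (d : List S) (s : S) (n : ℕ) :
    NMap.wk (Δ := Δ) d s (.const n) = .const n := rfl

@[simp] theorem NMap.wk_var (d : List S) (s : S) (x : Var Δ s) :
    NMap.wk (Δ := Δ) d s (.var x) = .var (.there x) := rfl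

@[simp] theorem NMap.inst_wk {d : List S} (K : ∀ s, Pos d s → Nm Δ s) (s : S) (a : Nm Δ s) :
    NMap.inst K s (NMap.wk d s a) = a := by
  cases a <;> rfl

@[simp] theorem NMap.inst_here {d : List S} (K : ∀ s, Pos d s → Nm Δ s) (s : S) (x : Pos d s) :
    NMap.inst K s (.var (.here x)) = K s x := rfl

@[simp] theorem NMap.inst_const {d : List S} (K : ∀ s, Pos d s → Nm Δ s) (s : S) (n : ℕ) :
    NMap.inst K s (.const n) = .const n := rfl

@[simp] theorem NMap.inst_there {d : List S} (K : ∀ s, Pos d s → Nm Δ s) (s : S) (x : Var Δ s) :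
    NMap.inst K s (.var (.there x)) = .var x := rfl

@[simp] theorem NMap.up_id (d : List S) : (NMap.id Δ).up d = NMap.id (d :: Δ) := by
  apply NMap.ext_cases
  · intros; rfl
  · intro s x; cases x <;> rfl

theorem NMap.up_comp (f : NMap Δ Δ') (g : NMap Δ' Δ'') (d : List S) :
    (f.comp g).up d = (f.up d).comp (g.up d) := by
  apply NMap.ext_cases
  · intros; simp
  · intro s x; cases x <;> simp

@[simp] theorem VMap.up_id (d : List (Ty S)) : (VMap.id Γ).up d = VMap.id (d :: Γ) := by
  funext τ x; cases x <;> rfl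

@[simp] theorem VMap.up_id' (d : List (Ty S)) :
    VMap.up (fun _ a => a : VMap Γ Γ) d = fun _ a => a := VMap.up_id d

theorem VMap.up_comp (f : VMap Γ Γ') (g : VMap Γ' Γ'') (d : List (Ty S)) :
    (f.comp g).up d = (f.up d).comp (g.up d) := by
  funext τ x; cases x <;> rfl

end Maps

theorem Tm.ren_ren {Δ : List (List S)} {Γ : List (List (Ty S))} {τ : Ty S} (T : Tm ob Δ Γ τ) :
    ∀ {Δ' Δ'' : List (List S)} {Γ' Γ'' : List (List (Ty S))} (f : NMap Δ Δ') (g : VMap Γ Γ')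
      (f' : NMap Δ' Δ'') (g' : VMap Γ' Γ''),
      (T.ren f g).ren f' g' = T.ren (f.comp f') (g.comp g') := by
  induction T <;> intros <;>
    simp_all only [Tm.ren, NMap.up_comp, VMap.up_comp, NMap.comp_apply, VMap.comp_apply]

@[simp] theorem Tm.ren_id {Δ : List (List S)} {Γ : List (List (Ty S))} {τ : Ty S}
    (T : Tm ob Δ Γ τ) : T.ren (fun _ a => a) (fun _ x => x) = T := by
  induction T <;> simp_all [Tm.ren]

theorem Sub.upV_ren {Δ Δ' : List (List S)} {Γ Γ' Γ'' : List (List (Ty S))} (σ : Sub ob Δ Γ Γ')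
    (f : NMap Δ Δ') (g : VMap Γ' Γ'') (d : List (Ty S)) :
    (fun τ x => (σ.upV d τ x).ren f (g.up d)) = Sub.upV (fun τ x => (σ τ x).ren f g) d := by
  funext τ x
  cases x with
  | here x => rfl
  | there x => simp only [Sub.upV, Tm.wkV, Tm.ren_ren]; rfl

theorem Sub.upN_ren {Δ Δ' : List (List S)} {Γ Γ' Γ'' : List (List (Ty S))} (σ : Sub ob Δ Γ Γ')
    (f : NMap Δ Δ') (g : VMap Γ' Γ'') (d : List S) :
    (fun τ x => (σ.upN d τ x).ren (f.up d) g) = Sub.upN (fun τ x => (σ τ x).ren f g) d := by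
  funext τ x
  simp only [Sub.upN, Tm.wkN, Tm.ren_ren]
  congr 1
  funext s a; simp

theorem Tm.sub_ren {Δ : List (List S)} {Γ : List (List (Ty S))} {τ : Ty S} (T : Tm ob Δ Γ τ) :
    ∀ {Δ' : List (List S)} {Γ' Γ'' : List (List (Ty S))} (σ : Sub ob Δ Γ Γ')
      (f : NMap Δ Δ') (g : VMap Γ' Γ''),
      (T.sub σ).ren f g = (T.ren f (fun _ x => x)).sub (fun τ x => (σ τ x).ren f g) := by
  induction T <;> intros <;>
    simp_all only [Tm.ren, Tm.sub, Sub.upV_ren, Sub.upN_ren, VMap.up_id']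

theorem Tm.ren_sub {Δ : List (List S)} {Γ : List (List (Ty S))} {τ : Ty S} (T : Tm ob Δ Γ τ) :
    ∀ {Δ' : List (List S)} {Γ' Γ'' : List (List (Ty S))} (f : NMap Δ Δ') (g : VMap Γ Γ')
      (σ : Sub ob Δ' Γ' Γ''),
      (T.ren f g).sub σ = (T.ren f (fun _ x => x)).sub (fun τ x => σ τ (g τ x)) := by
  have upV : ∀ {Δ : List (List S)} {Γ Γ' Γ'' : List (List (Ty S))} (g : VMap Γ Γ')
      (σ : Sub ob Δ Γ' Γ'') (d : List (Ty S)),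
      (fun τ x => σ.upV d τ (g.up d τ x)) = Sub.upV (fun τ x => σ τ (g τ x)) d := by
    intros; funext τ x; cases x <;> rfl
  induction T with
  | inp h a T ih => intros; simp only [Tm.ren, Tm.sub, VMap.up_id']; rw [ih, upV]
  | rinp h a T ih => intros; simp only [Tm.ren, Tm.sub, VMap.up_id']; rw [ih, upV]
  | pabs T ih => intros; simp only [Tm.ren, Tm.sub, VMap.up_id']; rw [ih, upV]
  | nabs T ih => intros; simp only [Tm.ren, Tm.sub]; rw [ih]; rfl
  | nu s T ih => intros; simp only [Tm.ren, Tm.sub]; rw [ih]; rfl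
  | papp F K ih ih' =>
    intros; simp only [Tm.ren, Tm.sub]; rw [ih]; congr 1; funext τ x; exact ih' _ _ _ _ _
  | out h a A T ih ih' => intros; simp only [Tm.ren, Tm.sub]; rw [ih, ih']
  | rout h a A T ih ih' => intros; simp only [Tm.ren, Tm.sub]; rw [ih, ih']
  | par A T ih ih' => intros; simp only [Tm.ren, Tm.sub]; rw [ih, ih']
  | nil => intros; rfl
  | var x => intros; rfl
  | napp F K ih => intros; simp only [Tm.ren, Tm.sub]; rw [ih]

@[simp] theorem Sub.upV_var {Δ : List (List S)} {Γ : List (List (Ty S))} (d : List (Ty S)) :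
    Sub.upV (fun _ x => .var x : Sub ob Δ Γ Γ) d = fun _ x => .var x := by
  funext τ x; cases x <;> rfl

@[simp] theorem Sub.upN_var {Δ : List (List S)} {Γ : List (List (Ty S))} (d : List S) :
    Sub.upN (fun _ x => .var x : Sub ob Δ Γ Γ) d = fun _ x => .var x := rfl

@[simp] theorem Tm.sub_var {Δ : List (List S)} {Γ : List (List (Ty S))} {τ : Ty S}
    (T : Tm ob Δ Γ τ) : T.sub (fun _ x => .var x) = T := by
  induction T <;> simp_all [Tm.sub]

theorem Sub.upV_sub {Δ : List (List S)} {Γ Γ' Γ'' : List (List (Ty S))} (σ : Sub ob Δ Γ Γ')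
    (σ' : Sub ob Δ Γ' Γ'') (d : List (Ty S)) :
    (fun τ x => (σ.upV d τ x).sub (σ'.upV d)) = Sub.upV (fun τ x => (σ τ x).sub σ') d := by
  funext τ x
  cases x with
  | here x => rfl
  | there x =>
    simp only [Sub.upV, Tm.wkV]
    rw [Tm.sub_ren, Tm.ren_sub]
    rfl

theorem Sub.upN_sub {Δ : List (List S)} {Γ Γ' Γ'' : List (List (Ty S))} (σ : Sub ob Δ Γ Γ')
    (σ' : Sub ob Δ Γ' Γ'') (d : List S) :
    (fun τ x => (σ.upN d τ x).sub (σ'.upN d)) = Sub.upN (fun τ x => (σ τ x).sub σ') d := by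
  funext τ x
  simp only [Sub.upN, Tm.wkN]
  rw [Tm.sub_ren]
  rfl

theorem Tm.sub_sub {Δ : List (List S)} {Γ : List (List (Ty S))} {τ : Ty S} (T : Tm ob Δ Γ τ) :
    ∀ {Γ' Γ'' : List (List (Ty S))} (σ : Sub ob Δ Γ Γ') (σ' : Sub ob Δ Γ' Γ''),
      (T.sub σ).sub σ' = T.sub (fun τ x => (σ τ x).sub σ') := by
  induction T <;> intros <;>
    simp_all only [Tm.sub, Sub.upV_sub, Sub.upN_sub]

/-! ### Structural congruence under renaming and substitution -/

theorem Sub.inst_ren {Δ Δ' : List (List S)} {Γ Γ' : List (List (Ty S))} {d : List (Ty S)}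
    (K : ∀ τ, Pos d τ → Tm ob Δ Γ τ) (f : NMap Δ Δ') (g : VMap Γ Γ') (ρ : Ty S)
    (T : Tm ob Δ (d :: Γ) ρ) :
    (T.sub (Sub.inst K)).ren f g
      = (T.ren f (g.up d)).sub (Sub.inst fun τ x => (K τ x).ren f g) := by
  rw [Tm.sub_ren, Tm.ren_sub (T := T) (f := f) (g := g.up d)]
  congr 1
  funext τ x; cases x <;> rfl

theorem Sub.inst_sub {Δ : List (List S)} {Γ Γ' : List (List (Ty S))} {d : List (Ty S)}
    (K : ∀ τ, Pos d τ → Tm ob Δ Γ τ) (σ : Sub ob Δ Γ Γ') (ρ : Ty S)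
    (T : Tm ob Δ (d :: Γ) ρ) :
    (T.sub (Sub.inst K)).sub σ
      = (T.sub (σ.upV d)).sub (Sub.inst fun τ x => (K τ x).sub σ) := by
  rw [Tm.sub_sub, Tm.sub_sub]
  congr 1
  funext τ x
  cases x with
  | here x => rfl
  | there x =>
    simp only [Sub.inst, Sub.upV, Tm.wkV, Tm.sub]
    rw [Tm.ren_sub]
    simp [Sub.inst]

theorem NMap.inst_ren {Δ Δ' : List (List S)} {Γ Γ' : List (List (Ty S))} {d : List S}
    (K : ∀ s, Pos d s → Nm Δ s) (f : NMap Δ Δ') (g : VMap Γ Γ') (ρ : Ty S)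
    (T : Tm ob (d :: Δ) Γ ρ) :
    (T.ren (NMap.inst K) (fun _ x => x)).ren f g
      = (T.ren (f.up d) g).ren (NMap.inst fun s x => f s (K s x)) (fun _ x => x) := by
  rw [Tm.ren_ren, Tm.ren_ren]
  congr 1
  apply NMap.ext_cases
  · intros; simp
  · intro s x; cases x <;> simp

theorem NMap.inst_sub {Δ : List (List S)} {Γ Γ' : List (List (Ty S))} {d : List S}
    (K : ∀ s, Pos d s → Nm Δ s) (σ : Sub ob Δ Γ Γ') (ρ : Ty S) (T : Tm ob (d :: Δ) Γ ρ) :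
    (T.ren (NMap.inst K) (fun _ x => x)).sub σ
      = (T.sub (σ.upN d)).ren (NMap.inst K) (fun _ x => x) := by
  rw [Tm.sub_ren]
  congr 1
  funext τ x
  simp only [Sub.upN, Tm.wkN, Tm.ren_ren]
  refine ((σ τ x).ren_id.symm).trans ?_
  congr 1
  funext s a
  simp

/-- Exchange of the two innermost bound names. -/
def NMap.swap {Δ : List (List S)} (s t : S) : NMap ([t] :: [s] :: Δ) ([s] :: [t] :: Δ)
  | _, .const n => .const n
  | _, .var (.here x) => .var (.there (.here x))
  | _, .var (.there (.here x)) => .var (.here x)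
  | _, .var (.there (.there x)) => .var (.there (.there x))

theorem Cong.nuComm' {Δ : List (List S)} {Γ : List (List (Ty S))} (s t : S)
    (T : Tm ob ([t] :: [s] :: Δ) Γ .proc) :
    Cong (.nu s (.nu t T)) (.nu t (.nu s (T.ren (NMap.swap s t) (fun _ x => x)))) := by
  have h := Cong.nuComm s t T
  have e : (fun r (a : Nm ([t] :: [s] :: Δ) r) => match a with
          | .const n => (.const n : Nm ([s] :: [t] :: Δ) r)
          | .var (.here x) => .var (.there (.here x))
          | .var (.there (.here x)) => .var (.here x)
          | .var (.there (.there x)) => .var (.there (.there x))) = NMap.swap s t := by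
    apply NMap.ext_cases
    · intros; rfl
    · intro r x
      rcases x with x | x
      · rfl
      · rcases x with x | x <;> rfl
  rw [← e]; exact h

theorem NMap.swap_up {Δ Δ' : List (List S)} (f : NMap Δ Δ') (s t : S) :
    ((f.up [s]).up [t]).comp (NMap.swap s t) = (NMap.swap s t).comp ((f.up [t]).up [s]) := by
  apply NMap.ext_cases
  · intro r n
    simp only [NMap.comp, NMap.up_const, NMap.swap]
    cases f r (.const n) <;> rfl
  · intro r x
    rcases x with x | x
    · rfl
    · rcases x with x | x
      · rfl
      · simp only [NMap.comp, NMap.up_there, NMap.swap]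
        cases f r (.var x) <;> rfl

theorem Cong.ren {Δ : List (List S)} {Γ : List (List (Ty S))} {τ : Ty S} {T T' : Tm ob Δ Γ τ}
    (h : Cong T T') : ∀ {Δ' : List (List S)} {Γ' : List (List (Ty S))} (f : NMap Δ Δ')
      (g : VMap Γ Γ'), Cong (T.ren f g) (T'.ren f g) := by
  induction h with
  | refl T => intros; exact .refl _
  | symm _ ih => intros; exact .symm (ih _ _)
  | trans _ _ ih ih' => intros; exact .trans (ih _ _) (ih' _ _)
  | parNil T => intros; exact .parNil _
  | parComm T T' => intros; exact .parComm _ _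
  | parAssoc T T' T'' => intros; exact .parAssoc _ _ _
  | nuComm s t T =>
    intro _ _ f g
    have := Cong.nuComm' s t (T.ren ((f.up [s]).up [t]) g)
    rw [Tm.ren_ren, NMap.swap_up] at this
    refine this.trans ?_
    simp only [Tm.ren, Tm.ren_ren]
    refine .nu _ (.nu _ ?_)
    convert Cong.refl _ using 2
    · funext r a
      simp only [NMap.comp]
      congr 1
      rcases a with n | x
      · rfl
      · rcases x with x | x
        · rfl
        · rcases x with x | x <;> rfl
    · rfl
  | nuPar s T T' =>
    intro _ _ f g
    have := Cong.nuPar s (T.ren (f.up [s]) g) (T'.ren f g)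
    refine Cong.trans ?_ this
    simp only [Tm.ren, Tm.wkN, Tm.ren_ren]
    convert Cong.refl _ using 4
    · funext r a; simp
    · rfl
  | pbeta T K => intro _ _ f g; rw [Sub.inst_ren]; exact .pbeta _ _
  | nbeta T K => intro _ _ f g; rw [NMap.inst_ren]; exact .nbeta _ _
  | inp h a _ ih => intros; exact .inp _ _ (ih _ _)
  | out h a _ _ ih ih' => intros; exact .out _ _ (ih _ _) (ih' _ _)
  | par _ _ ih ih' => intros; exact .par (ih _ _) (ih' _ _)
  | nu s _ ih => intros; exact .nu _ (ih _ _)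
  | rinp h a _ ih => intros; exact .rinp _ _ (ih _ _)
  | rout h a _ _ ih ih' => intros; exact .rout _ _ (ih _ _) (ih' _ _)
  | pabs _ ih => intros; exact .pabs (ih _ _)
  | nabs _ ih => intros; exact .nabs (ih _ _)
  | papp _ _ ih ih' => intros; exact .papp (ih _ _) (fun _ _ => ih' _ _ _ _)
  | napp K _ ih => intros; exact .napp _ (ih _ _)

theorem Cong.sub_left {Δ : List (List S)} {Γ : List (List (Ty S))} {τ : Ty S}
    {T T' : Tm ob Δ Γ τ} (h : Cong T T') :
    ∀ {Γ' : List (List (Ty S))} (σ : Sub ob Δ Γ Γ'), Cong (T.sub σ) (T'.sub σ) := by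
  induction h with
  | refl T => intros; exact .refl _
  | symm _ ih => intros; exact .symm (ih _)
  | trans _ _ ih ih' => intros; exact .trans (ih _) (ih' _)
  | parNil T => intros; exact .parNil _
  | parComm T T' => intros; exact .parComm _ _
  | parAssoc T T' T'' => intros; exact .parAssoc _ _ _
  | nuComm s t T =>
    intro _ σ
    refine (Cong.nuComm s t _).trans ?_
    simp only [Tm.sub, Tm.sub_ren]
    refine .nu _ (.nu _ ?_)
    convert Cong.refl _ using 2
    funext r x
    simp only [Sub.upN, Tm.wkN, Tm.ren_ren]
    congr 1
    funext r a
    cases a <;> rfl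
  | nuPar s T T' =>
    intro _ σ
    have := Cong.nuPar s (T.sub (σ.upN [s])) (T'.sub σ)
    refine Cong.trans ?_ this
    simp only [Tm.sub, Tm.wkN, Tm.sub_ren]
    exact .refl _
  | pbeta T K => intro _ σ; rw [Sub.inst_sub]; exact .pbeta _ _
  | nbeta T K => intro _ σ; rw [NMap.inst_sub]; exact .nbeta _ _
  | inp h a _ ih => intros; exact .inp _ _ (ih _)
  | out h a _ _ ih ih' => intros; exact .out _ _ (ih _) (ih' _)
  | par _ _ ih ih' => intros; exact .par (ih _) (ih' _)
  | nu s _ ih => intros; exact .nu _ (ih _)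
  | rinp h a _ ih => intros; exact .rinp _ _ (ih _)
  | rout h a _ _ ih ih' => intros; exact .rout _ _ (ih _) (ih' _)
  | pabs _ ih => intros; exact .pabs (ih _)
  | nabs _ ih => intros; exact .nabs (ih _)
  | papp _ _ ih ih' => intros; exact .papp (ih _) (fun _ _ => ih' _ _ _)
  | napp K _ ih => intros; exact .napp _ (ih _)

theorem Cong.sub_right {Δ : List (List S)} {Γ : List (List (Ty S))} {τ : Ty S}
    (T : Tm ob Δ Γ τ) : ∀ {Γ' : List (List (Ty S))} {σ σ' : Sub ob Δ Γ Γ'},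
      (∀ τ x, Cong (σ τ x) (σ' τ x)) → Cong (T.sub σ) (T.sub σ') := by
  have upV : ∀ {Δ : List (List S)} {Γ Γ' : List (List (Ty S))} {σ σ' : Sub ob Δ Γ Γ'}
      (d : List (Ty S)), (∀ τ x, Cong (σ τ x) (σ' τ x)) →
      ∀ τ x, Cong (σ.upV d τ x) (σ'.upV d τ x) := by
    intro _ _ _ σ σ' d h τ x
    cases x with
    | here x => exact .refl _
    | there x => exact (h _ x).ren _ _
  have upN : ∀ {Δ : List (List S)} {Γ Γ' : List (List (Ty S))} {σ σ' : Sub ob Δ Γ Γ'}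
      (d : List S), (∀ τ x, Cong (σ τ x) (σ' τ x)) →
      ∀ τ x, Cong (σ.upN d τ x) (σ'.upN d τ x) := fun d h τ x => (h τ x).ren _ _
  induction T with
  | nil => intros; exact .refl _
  | var x => intro _ _ _ h; exact h _ _
  | inp h a T ih => intro _ _ _ h; exact .inp _ _ (ih (upV _ h))
  | out h a A T ih ih' => intro _ _ _ h; exact .out _ _ (ih h) (ih' h)
  | par A T ih ih' => intro _ _ _ h; exact .par (ih h) (ih' h)
  | nu s T ih => intro _ _ _ h; exact .nu _ (ih (upN _ h))
  | rinp h a T ih => intro _ _ _ h; exact .rinp _ _ (ih (upV _ h))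
  | rout h a A T ih ih' => intro _ _ _ h; exact .rout _ _ (ih h) (ih' h)
  | pabs T ih => intro _ _ _ h; exact .pabs (ih (upV _ h))
  | nabs T ih => intro _ _ _ h; exact .nabs (ih (upN _ h))
  | papp F K ih ih' => intro _ _ _ h; exact .papp (ih h) (fun _ _ => ih' _ _ h)
  | napp F K ih => intro _ _ _ h; exact .napp _ (ih h)

theorem Cong.sub {Δ : List (List S)} {Γ Γ' : List (List (Ty S))} {τ : Ty S}
    {T T' : Tm ob Δ Γ τ} {σ σ' : Sub ob Δ Γ Γ'} (h : Cong T T')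
    (hσ : ∀ τ x, Cong (σ τ x) (σ' τ x)) : Cong (T.sub σ) (T'.sub σ') :=
  (h.sub_left σ).trans (Cong.sub_right T' hσ)

/-! ### Terms up to structural congruence -/

/-- Structural congruence as a setoid. -/
def congSetoid (ob : S → Ty S) (Δ : List (List S)) (Γ : List (List (Ty S))) (τ : Ty S) :
    Setoid (Tm ob Δ Γ τ) :=
  ⟨Cong, .refl, .symm, .trans⟩

/-- Terms up to structural congruence. -/
def Cl (ob : S → Ty S) (Δ : List (List S)) (Γ : List (List (Ty S))) (τ : Ty S) : Type u :=
  Quotient (congSetoid ob Δ Γ τ)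

/-- The class of a term up to structural congruence. -/
def cl {Δ : List (List S)} {Γ : List (List (Ty S))} {τ : Ty S} (T : Tm ob Δ Γ τ) : Cl ob Δ Γ τ :=
  Quotient.mk _ T

section Classes

variable {Δ Δ' : List (List S)} {Γ Γ' : List (List (Ty S))} {τ : Ty S}

theorem cl_eq {T T' : Tm ob Δ Γ τ} : cl T = cl T' ↔ Cong T T' :=
  ⟨fun h => Quotient.exact h, fun h => Quotient.sound h⟩

instance : Zero (Cl ob Δ Γ .proc) := ⟨cl .nil⟩

instance : Add (Cl ob Δ Γ .proc) :=
  ⟨Quotient.map₂ Tm.par fun _ _ h _ _ h' => Cong.par h h'⟩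

/-- Processes up to structural congruence form a commutative monoid under parallel
composition. -/
instance : AddCommMonoid (Cl ob Δ Γ .proc) where
  add_assoc a b c := by
    refine Quotient.inductionOn₃ a b c fun a b c => ?_
    exact cl_eq.2 (.parAssoc a b c)
  add_comm a b := by
    refine Quotient.inductionOn₂ a b fun a b => ?_
    exact cl_eq.2 (.parComm a b)
  add_zero a := by
    refine Quotient.inductionOn a fun a => ?_
    exact cl_eq.2 (.parNil a)
  zero_add a := by
    refine Quotient.inductionOn a fun a => ?_
    exact cl_eq.2 ((Cong.parComm _ _).trans (.parNil a))
  nsmul := nsmulRec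

theorem cl_par (T V : Tm ob Δ Γ .proc) : cl (.par T V) = cl T + cl V := rfl

theorem cl_nil : cl (.nil : Tm ob Δ Γ .proc) = 0 := rfl

theorem cl_ren {T T' : Tm ob Δ Γ τ} (h : cl T = cl T') (f : NMap Δ Δ') (g : VMap Γ Γ') :
    cl (T.ren f g) = cl (T'.ren f g) := cl_eq.2 ((cl_eq.1 h).ren f g)

theorem cl_sub {T T' : Tm ob Δ Γ τ} (h : cl T = cl T') (σ : Sub ob Δ Γ Γ') :
    cl (T.sub σ) = cl (T'.sub σ) := cl_eq.2 ((cl_eq.1 h).sub_left σ)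

/-- Parallel composition of a multiset of processes (in some order). -/
def bigPar (M : Multiset (Tm ob Δ Γ .proc)) : Tm ob Δ Γ .proc := M.toList.foldr .par .nil

theorem cl_bigPar (M : Multiset (Tm ob Δ Γ .proc)) : cl (bigPar M) = (M.map cl).sum := by
  have : ∀ l : List (Tm ob Δ Γ .proc), cl (l.foldr .par .nil) = (l.map cl).sum := by
    intro l
    induction l with
    | nil => rfl
    | cons a l ih => simp [cl_par, ih]
  rw [bigPar, this]
  conv_rhs => rw [← Multiset.coe_toList M]
  simp

/-- Renaming, as a homomorphism on processes up to structural congruence. -/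
def renHom (f : NMap Δ Δ') (g : VMap Γ Γ') : Cl ob Δ Γ .proc →+ Cl ob Δ' Γ' .proc where
  toFun := Quotient.map (fun T => T.ren f g) fun _ _ h => Cong.ren h f g
  map_zero' := rfl
  map_add' a b := by
    refine Quotient.inductionOn₂ a b fun a b => ?_
    rfl

theorem renHom_cl (f : NMap Δ Δ') (g : VMap Γ Γ') (T : Tm ob Δ Γ .proc) :
    renHom f g (cl T) = cl (T.ren f g) := rfl

/-- Substitution, as a homomorphism on processes up to structural congruence. -/
def subHom (σ : Sub ob Δ Γ Γ') : Cl ob Δ Γ .proc →+ Cl ob Δ Γ' .proc where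
  toFun := Quotient.map (fun T => T.sub σ) fun _ _ h => Cong.sub_left h σ
  map_zero' := rfl
  map_add' a b := by
    refine Quotient.inductionOn₂ a b fun a b => ?_
    rfl

theorem subHom_cl (σ : Sub ob Δ Γ Γ') (T : Tm ob Δ Γ .proc) :
    subHom σ (cl T) = cl (T.sub σ) := rfl

theorem cl_bigPar_ren (M : Multiset (Tm ob Δ Γ .proc)) (f : NMap Δ Δ') (g : VMap Γ Γ') :
    cl ((bigPar M).ren f g) = cl (bigPar (M.map fun T => T.ren f g)) := by
  rw [← renHom_cl, cl_bigPar, cl_bigPar, map_multiset_sum, Multiset.map_map, Multiset.map_map]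
  rfl

theorem cl_bigPar_sub (M : Multiset (Tm ob Δ Γ .proc)) (σ : Sub ob Δ Γ Γ') :
    cl ((bigPar M).sub σ) = cl (bigPar (M.map fun T => T.sub σ)) := by
  rw [← subHom_cl, cl_bigPar, cl_bigPar, map_multiset_sum, Multiset.map_map, Multiset.map_map]
  rfl

@[simp] theorem cl_bigPar_zero : cl (bigPar (0 : Multiset (Tm ob Δ Γ .proc))) = 0 := by
  simp [cl_bigPar]

@[simp] theorem cl_bigPar_cons (T : Tm ob Δ Γ .proc) (M : Multiset (Tm ob Δ Γ .proc)) :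
    cl (bigPar (T ::ₘ M)) = cl T + cl (bigPar M) := by
  simp [cl_bigPar]

@[simp] theorem cl_bigPar_add (M N : Multiset (Tm ob Δ Γ .proc)) :
    cl (bigPar (M + N)) = cl (bigPar M) + cl (bigPar N) := by
  simp [cl_bigPar]

@[simp] theorem cl_bigPar_singleton (T : Tm ob Δ Γ .proc) : cl (bigPar {T}) = cl T := by
  simp [cl_bigPar]

end Classes

/-! ### Blocks of restrictions -/

section Blocks

variable {Δ Δ' : List (List S)} {Γ Γ' : List (List (Ty S))}

/-- Removal of an empty block of names. -/
def NMap.drop : NMap ([] :: Δ) Δ := NMap.inst fun _ x => nomatch x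

/-- Splitting the first name off a block. -/
def NMap.split (s : S) (d : List S) : NMap ((s :: d) :: Δ) (d :: [s] :: Δ)
  | _, .const n => .const n
  | _, .var (.here .zero) => .var (.there (.here .zero))
  | _, .var (.here (.succ x)) => .var (.here x)
  | _, .var (.there x) => .var (.there (.there x))

/-- Inverse of `NMap.split`. -/
def NMap.merge (s : S) (d : List S) : NMap (d :: [s] :: Δ) ((s :: d) :: Δ)
  | _, .const n => .const n
  | _, .var (.there (.here .zero)) => .var (.here .zero)
  | _, .var (.here x) => .var (.here (.succ x))
  | _, .var (.there (.there x)) => .var (.there x)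

/-- Restriction of all names of the innermost block. -/
def nuB : ∀ {Δ : List (List S)} (d : List S), Tm ob (d :: Δ) Γ .proc → Tm ob Δ Γ .proc
  | _, [], T => T.ren NMap.drop (fun _ x => x)
  | _, s :: d, T => .nu s (nuB d (T.ren (NMap.split s d) (fun _ x => x)))

/-- A map between two extensions of a name context that fixes the names of that context. -/
def NMap.Over {d e : List S} (f : NMap (d :: Δ) (e :: Δ)) : Prop :=
  ∀ s a, f s (NMap.wk d s a) = NMap.wk e s a

theorem NMap.block_ext {d : List S} {f g : NMap (d :: Δ) Δ'}
    (hw : ∀ s a, f s (NMap.wk d s a) = g s (NMap.wk d s a))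
    (hh : ∀ s x, f s (.var (.here x)) = g s (.var (.here x))) : f = g := by
  apply NMap.ext_cases
  · intro s n; exact hw s (.const n)
  · intro s x
    cases x with
    | here x => exact hh s x
    | there x => exact hw s (.var x)

theorem NMap.singleton_ext {s : S} {f g : NMap ([s] :: Δ) Δ'}
    (hw : ∀ r a, f r (NMap.wk [s] r a) = g r (NMap.wk [s] r a))
    (hh : f s (.var (.here .zero)) = g s (.var (.here .zero))) : f = g := by
  refine NMap.block_ext hw ?_
  intro r x
  rcases x with _ | x
  · exact hh
  · cases x

theorem NMap.cons_ext {s : S} {d : List S} {f g : NMap ((s :: d) :: Δ) Δ'}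
    (hw : ∀ r a, f r (NMap.wk (s :: d) r a) = g r (NMap.wk (s :: d) r a))
    (h0 : f s (.var (.here .zero)) = g s (.var (.here .zero)))
    (hs : ∀ r x, f r (.var (.here (.succ x))) = g r (.var (.here (.succ x)))) : f = g := by
  refine NMap.block_ext hw ?_
  intro r x
  rcases x with _ | x
  · exact h0
  · exact hs r x

@[simp] theorem NMap.drop_wk (s : S) (a : Nm Δ s) : NMap.drop s (NMap.wk [] s a) = a :=
  NMap.inst_wk _ _ _

@[simp] theorem NMap.split_wk (s : S) (d : List S) (r : S) (a : Nm Δ r) :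
    NMap.split s d r (NMap.wk (s :: d) r a) = NMap.wk d r (NMap.wk [s] r a) := by
  cases a <;> rfl

@[simp] theorem NMap.split_zero (s : S) (d : List S) :
    NMap.split (Δ := Δ) s d s (.var (.here .zero)) = .var (.there (.here .zero)) := rfl

@[simp] theorem NMap.split_succ (s : S) (d : List S) (r : S) (x : Pos d r) :
    NMap.split (Δ := Δ) s d r (.var (.here (.succ x))) = .var (.here x) := rfl

@[simp] theorem NMap.split_const (s : S) (d : List S) (r : S) (n : ℕ) :
    NMap.split (Δ := Δ) s d r (.const n) = .const n := rfl

@[simp] theorem NMap.merge_wk_wk (s : S) (d : List S) (r : S) (a : Nm Δ r) :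
    NMap.merge s d r (NMap.wk d r (NMap.wk [s] r a)) = NMap.wk (s :: d) r a := by
  cases a <;> rfl

@[simp] theorem NMap.merge_zero (s : S) (d : List S) :
    NMap.merge (Δ := Δ) s d s (.var (.there (.here .zero))) = .var (.here .zero) := rfl

@[simp] theorem NMap.merge_here (s : S) (d : List S) (r : S) (x : Pos d r) :
    NMap.merge (Δ := Δ) s d r (.var (.here x)) = .var (.here (.succ x)) := rfl

@[simp] theorem NMap.merge_split (s : S) (d : List S) (r : S) (a : Nm ((s :: d) :: Δ) r) :
    NMap.merge s d r (NMap.split s d r a) = a := by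
  have : (NMap.split s d).comp (NMap.merge s d) = NMap.id ((s :: d) :: Δ) := by
    apply NMap.cons_ext <;> intros <;> simp
  exact congrFun (congrFun this r) a

@[simp] theorem NMap.split_merge (s : S) (d : List S) (r : S) (a : Nm (d :: [s] :: Δ) r) :
    NMap.split s d r (NMap.merge s d r a) = a := by
  have : (NMap.merge s d).comp (NMap.split s d) = NMap.id (d :: [s] :: Δ) := by
    apply NMap.block_ext
    · intro r a
      revert a
      have : ((NMap.wk d).comp (NMap.merge s d)).comp (NMap.split s d)
        = (NMap.wk d : NMap ([s] :: Δ) _) := by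
        apply NMap.singleton_ext
        · intros; simp
        · simp
      exact fun a => congrFun (congrFun this r) a
    · intros; simp
  exact congrFun (congrFun this r) a

theorem NMap.drop_up (f : NMap Δ Δ') : (f.up []).comp NMap.drop = NMap.drop.comp f := by
  apply NMap.block_ext
  · intros; simp
  · intro s x; cases x

theorem NMap.split_up (f : NMap Δ Δ') (s : S) (d : List S) :
    (f.up (s :: d)).comp (NMap.split s d) = (NMap.split s d).comp ((f.up [s]).up d) := by
  apply NMap.cons_ext <;> intros <;> simp

theorem nuB_ren (d : List S) : ∀ {Δ Δ' : List (List S)} (T : Tm ob (d :: Δ) Γ .proc)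
    (f : NMap Δ Δ') (g : VMap Γ Γ'), (nuB d T).ren f g = nuB d (T.ren (f.up d) g) := by
  induction d with
  | nil => intros; simp only [nuB, Tm.ren_ren, NMap.drop_up]; rfl
  | cons s d ih => intros; simp only [nuB, Tm.ren, ih, Tm.ren_ren, NMap.split_up]; rfl

theorem nuB_sub (d : List S) : ∀ {Δ : List (List S)} (T : Tm ob (d :: Δ) Γ .proc)
    (σ : Sub ob Δ Γ Γ'), (nuB d T).sub σ = nuB d (T.sub (σ.upN d)) := by
  induction d with
  | nil =>
    intro _ T σ
    simp only [nuB, NMap.drop]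
    rw [NMap.inst_sub]
  | cons s d ih =>
    intro _ T σ
    simp only [nuB, Tm.sub, ih, Tm.sub_ren]
    congr 3
    funext τ x
    simp only [Sub.upN, Tm.wkN, Tm.ren_ren]
    congr 1
    funext r a; simp

theorem nuB_congr (d : List S) : ∀ {Δ : List (List S)} {T T' : Tm ob (d :: Δ) Γ .proc},
    Cong T T' → Cong (nuB d T) (nuB d T') := by
  induction d with
  | nil => intro _ T T' h; exact h.ren _ _
  | cons s d ih => intro _ T T' h; exact .nu _ (ih (h.ren _ _))

/-- Restriction of a block, on processes up to structural congruence. -/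
def Cl.nu (d : List S) : Cl ob (d :: Δ) Γ .proc → Cl ob Δ Γ .proc :=
  Quotient.map (nuB d) fun _ _ h => nuB_congr d h

theorem cl_nuB (d : List S) (T : Tm ob (d :: Δ) Γ .proc) : cl (nuB d T) = Cl.nu d (cl T) := rfl

theorem nuB_eq {d : List S} {T T' : Tm ob (d :: Δ) Γ .proc} (h : cl T = cl T') :
    cl (nuB d T) = cl (nuB d T') := by rw [cl_nuB, h, cl_nuB]

/-- Restriction of one name, on processes up to structural congruence. -/
def Cl.nu1 (s : S) : Cl ob ([s] :: Δ) Γ .proc → Cl ob Δ Γ .proc :=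
  Quotient.map (Tm.nu s) fun _ _ h => Cong.nu s h

theorem cl_nu (s : S) (T : Tm ob ([s] :: Δ) Γ .proc) : cl (.nu s T) = Cl.nu1 s (cl T) := rfl

theorem cl_nu_par (s : S) (T : Tm ob ([s] :: Δ) Γ .proc) (V : Tm ob Δ Γ .proc) :
    cl (.nu s (.par T (V.wkN [s]))) = cl (.nu s T) + cl V := cl_eq.2 (.nuPar s T V)

theorem cl_nuB_par (d : List S) : ∀ {Δ : List (List S)} (T : Tm ob (d :: Δ) Γ .proc)
    (V : Tm ob Δ Γ .proc), cl (nuB d (.par T (V.wkN d))) = cl (nuB d T) + cl V := by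
  induction d with
  | nil =>
    intro _ T V
    simp only [nuB, Tm.ren, cl_par, Tm.wkN, Tm.ren_ren]
    congr 1
    refine congrArg cl (Eq.trans ?_ V.ren_id)
    congr 1
    funext r a; simp
  | cons s d ih =>
    intro _ T V
    change cl (.nu s (nuB d _)) = cl (.nu s (nuB d _)) + cl V
    rw [← cl_nu_par, cl_nu, cl_nu, cl_par, ← ih]
    simp only [Tm.ren, Tm.wkN, Tm.ren_ren]
    congr 5
    funext r a; simp

/-- Splitting a concatenated block in two. -/
def NMap.splitApp : ∀ {Δ : List (List S)} (c d : List S), NMap ((c ++ d) :: Δ) (d :: c :: Δ)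
  | _, [], d => (NMap.wk []).up d
  | _, s :: c, d => (NMap.split s (c ++ d)).comp
      ((NMap.splitApp c d).comp ((NMap.merge s c).up d))

theorem cl_nuB_append (c d : List S) : ∀ {Δ : List (List S)} (T : Tm ob ((c ++ d) :: Δ) Γ .proc),
    cl (nuB (c ++ d) T)
      = cl (nuB c (nuB d (T.ren (NMap.splitApp c d) (fun _ x => x)))) := by
  induction c with
  | nil =>
    intro Δ T
    change cl (nuB d T) = cl ((nuB d _).ren _ _)
    rw [nuB_ren, Tm.ren_ren]
    congr 2
    refine T.ren_id.symm.trans ?_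
    congr 1
    funext r a
    change a = (NMap.drop.up d) r (((NMap.wk []).up d) r a)
    have : ((NMap.wk [] : NMap Δ _).up d).comp (NMap.drop.up d) = NMap.id (d :: Δ) := by
      rw [← NMap.up_comp, ← NMap.up_id]
      congr 1
      funext r a; simp
    exact (congrFun (congrFun this r) a).symm
  | cons s c ih =>
    intro Δ T
    change cl (.nu s (nuB (c ++ d) _)) = cl (.nu s (nuB c _))
    rw [cl_nu, ih, cl_nu, nuB_ren, Tm.ren_ren, Tm.ren_ren]
    congr 5
    funext r a
    simp only [NMap.splitApp, NMap.comp_apply]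
    have : ((NMap.merge s c).up d).comp ((NMap.split s c).up d) = NMap.id (d :: c :: [s] :: Δ) := by
      rw [← NMap.up_comp, ← NMap.up_id]
      congr 1
      funext r a; simp
    exact (congrFun (congrFun this r) _).symm

theorem nuB_nil (T : Tm ob Δ Γ .proc) : nuB [] (T.wkN []) = T := by
  simp only [nuB, Tm.wkN, Tm.ren_ren]
  refine Eq.trans ?_ T.ren_id
  congr 1
  funext r a; simp

theorem nu_nuB (s : S) (d : List S) (T : Tm ob (d :: [s] :: Δ) Γ .proc) :
    .nu s (nuB d T) = nuB (s :: d) (T.ren (NMap.merge s d) (fun _ x => x)) := by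
  simp only [nuB, Tm.ren_ren]
  congr 2
  refine T.ren_id.symm.trans ?_
  congr 1
  funext r a; simp

/-- Left inclusion of a block into a concatenation. -/
def NMap.inl (c d : List S) : NMap (c :: Δ) ((c ++ d) :: Δ)
  | _, .const n => .const n
  | _, .var (.here x) => .var (.here (go c x))
  | _, .var (.there x) => .var (.there x)
where
  go : ∀ (c : List S) {s : S}, Pos c s → Pos (c ++ d) s
    | _ :: _, _, .zero => .zero
    | _ :: c, _, .succ x => .succ (go c x)

/-- Right inclusion of a block into a concatenation. -/
def NMap.inr (c d : List S) : NMap (d :: Δ) ((c ++ d) :: Δ)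
  | _, .const n => .const n
  | _, .var (.here x) => .var (.here (go c x))
  | _, .var (.there x) => .var (.there x)
where
  go : ∀ (c : List S) {s : S}, Pos d s → Pos (c ++ d) s
    | [], _, x => x
    | _ :: c, _, x => .succ (go c x)

@[simp] theorem NMap.inl_wk (c d : List S) (s : S) (a : Nm Δ s) :
    NMap.inl c d s (NMap.wk c s a) = NMap.wk (c ++ d) s a := by cases a <;> rfl

@[simp] theorem NMap.inr_wk (c d : List S) (s : S) (a : Nm Δ s) :
    NMap.inr c d s (NMap.wk d s a) = NMap.wk (c ++ d) s a := by cases a <;> rfl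

theorem NMap.split_inl (s : S) (c d : List S) (r : S) (a : Nm ((s :: c) :: Δ) r) :
    NMap.split s (c ++ d) r (NMap.inl (s :: c) d r a) = NMap.inl c d r (NMap.split s c r a) := by
  have : (NMap.inl (s :: c) d).comp (NMap.split s (c ++ d)) =
      (NMap.split s c).comp (NMap.inl (Δ := [s] :: Δ) c d) := by
    apply NMap.cons_ext
    · intro r a
      simp only [NMap.comp_apply, NMap.inl_wk, NMap.split_wk]
      exact NMap.split_wk s (c ++ d) r a
    · rfl
    · intros; rfl
  exact congrFun (congrFun this r) a

theorem NMap.split_inr (s : S) (c d : List S) (r : S) (a : Nm (d :: Δ) r) :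
    NMap.split s (c ++ d) r (NMap.inr (s :: c) d r a)
      = NMap.inr c d r ((NMap.wk [s]).up d r a) := by
  have : (NMap.inr (s :: c) d).comp (NMap.split s (c ++ d)) =
      ((NMap.wk [s]).up d).comp (NMap.inr (Δ := [s] :: Δ) c d) := by
    apply NMap.block_ext
    · intro r a
      simp only [NMap.comp_apply, NMap.inr_wk, NMap.up_wk]
      exact NMap.split_wk s (c ++ d) r a
    · intros; rfl
  exact congrFun (congrFun this r) a

theorem NMap.splitApp_inl (c d : List S) : ∀ {Δ : List (List S)} (r : S) (a : Nm (c :: Δ) r),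
    NMap.splitApp c d r (NMap.inl c d r a) = NMap.wk d r a := by
  induction c with
  | nil =>
    intro Δ r a
    rcases a with n | x | x
    · rfl
    · cases x
    · rfl
  | cons s c ih =>
    intro Δ r a
    change ((NMap.merge s c).up d) r (NMap.splitApp c d r (NMap.split s (c ++ d) r _)) = _
    rw [NMap.split_inl, ih, NMap.up_wk, NMap.merge_split]

theorem NMap.splitApp_inr (c d : List S) : ∀ {Δ : List (List S)} (r : S) (a : Nm (d :: Δ) r),
    NMap.splitApp c d r (NMap.inr c d r a) = (NMap.wk c).up d r a := by
  induction c with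
  | nil =>
    intro Δ r a
    rcases a with n | x | x
    · rfl
    · rfl
    · rfl
  | cons s c ih =>
    intro Δ r a
    change ((NMap.merge s c).up d) r (NMap.splitApp c d r (NMap.split s (c ++ d) r _)) = _
    rw [NMap.split_inr, ih]
    have : (((NMap.wk [s]).up d).comp ((NMap.wk c).up d)).comp ((NMap.merge s c).up d)
      = (NMap.wk (s :: c) : NMap Δ _).up d := by
      rw [← NMap.up_comp, ← NMap.up_comp]
      congr 1
      funext r a; simp
    exact congrFun (congrFun this r) a

theorem nuB_add (c d : List S) (T : Tm ob (c :: Δ) Γ .proc) (V : Tm ob (d :: Δ) Γ .proc) :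
    cl (nuB (c ++ d) (.par (T.ren (NMap.inl c d) (fun _ x => x))
        (V.ren (NMap.inr c d) (fun _ x => x)))) = cl (nuB c T) + cl (nuB d V) := by
  rw [cl_nuB_append]
  simp only [Tm.ren, Tm.ren_ren]
  have h1 : (NMap.inl c d).comp (NMap.splitApp c d) = (NMap.wk d : NMap (c :: Δ) _) := by
    funext r a; exact NMap.splitApp_inl c d r a
  have h2 : (NMap.inr c d).comp (NMap.splitApp c d) = (NMap.wk c : NMap Δ _).up d := by
    funext r a; exact NMap.splitApp_inr c d r a
  rw [h1, h2]
  rw [← cl_nuB_par c T (nuB d V), Tm.wkN, nuB_ren]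
  apply nuB_eq
  rw [nuB_eq (cl_eq.2 (Cong.parComm _ _)), cl_par, add_comm, VMap.id_comp, ← Tm.wkN, cl_nuB_par]

/-! ### Permuting restrictions -/

/-- The block `d` without the name at a given position. -/
def Pos.del : ∀ {d : List S} {s : S}, Pos d s → List S
  | _ :: d, _, .zero => d
  | t :: _, _, .succ p => t :: p.del

/-- Splitting the name at a given position off a block. -/
def NMap.splitAt : ∀ {Δ : List (List S)} {d : List S} {s : S} (p : Pos d s),
    NMap (d :: Δ) (p.del :: [s] :: Δ)
  | _, s :: d, _, .zero => NMap.split s d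
  | _, t :: d, s, .succ p => (NMap.split t d).comp ((NMap.splitAt p).comp
      (((NMap.swap t s).up p.del).comp (NMap.merge t p.del)))

/-- Inverse of `NMap.splitAt`. -/
def NMap.mergeAt : ∀ {Δ : List (List S)} {d : List S} {s : S} (p : Pos d s),
    NMap (p.del :: [s] :: Δ) (d :: Δ)
  | _, s :: d, _, .zero => NMap.merge s d
  | _, t :: d, s, .succ p => (NMap.split t p.del).comp (((NMap.swap s t).up p.del).comp
      ((NMap.mergeAt p).comp (NMap.merge t d)))

theorem NMap.splitAt_succ {d : List S} {s : S} (t : S) (p : Pos d s) (r : S)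
    (a : Nm ((t :: d) :: Δ) r) :
    NMap.splitAt (.succ p : Pos (t :: d) s) r a
      = NMap.merge t p.del r ((NMap.swap t s).up p.del r
          (NMap.splitAt p r (NMap.split t d r a))) := rfl

theorem NMap.mergeAt_succ {d : List S} {s : S} (t : S) (p : Pos d s) (r : S)
    (a : Nm ((t :: p.del) :: [s] :: Δ) r) :
    NMap.mergeAt (.succ p : Pos (t :: d) s) r a
      = NMap.merge t d r (NMap.mergeAt p r
          ((NMap.swap s t).up p.del r (NMap.split t p.del r a))) := rfl

theorem NMap.swap_swap (s t : S) :
    (NMap.swap s t).comp (NMap.swap t s) = NMap.id ([t] :: [s] :: Δ) := by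
  apply NMap.ext_cases
  · intros; rfl
  · intro r x
    rcases x with x | x | x <;> rfl

@[simp] theorem NMap.swap_up_swap_up (s t : S) (d : List S) (r : S)
    (a : Nm (d :: [t] :: [s] :: Δ) r) :
    (NMap.swap t s).up d r ((NMap.swap s t).up d r a) = a := by
  have : ((NMap.swap s t).up d).comp ((NMap.swap t s).up d) = NMap.id (d :: [t] :: [s] :: Δ) := by
    rw [← NMap.up_comp, NMap.swap_swap, NMap.up_id]
  exact congrFun (congrFun this r) a

theorem NMap.mergeAt_splitAt {d : List S} {s : S} (p : Pos d s) :
    ∀ {Δ : List (List S)} (r : S) (a : Nm (d :: Δ) r),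
      NMap.mergeAt p r (NMap.splitAt p r a) = a := by
  induction p with
  | zero => intros; exact NMap.merge_split _ _ _ _
  | @succ s t d p ih =>
    intro _ r a
    rw [NMap.splitAt_succ]
    erw [NMap.mergeAt_succ]
    rw [NMap.split_merge, NMap.swap_up_swap_up, ih, NMap.merge_split]

theorem NMap.splitAt_mergeAt {d : List S} {s : S} (p : Pos d s) :
    ∀ {Δ : List (List S)} (r : S) (a : Nm (p.del :: [s] :: Δ) r),
      NMap.splitAt p r (NMap.mergeAt p r a) = a := by
  induction p with
  | zero => intros; exact NMap.split_merge _ _ _ _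
  | @succ s t d p ih =>
    intro _ r a
    erw [NMap.mergeAt_succ]
    rw [NMap.splitAt_succ, NMap.split_merge, ih, NMap.swap_up_swap_up]
    exact NMap.merge_split _ _ _ _

@[simp] theorem NMap.swap_wk_wk (s t r : S) (a : Nm Δ r) :
    NMap.swap s t r (NMap.wk [t] r (NMap.wk [s] r a)) = NMap.wk [s] r (NMap.wk [t] r a) := by
  cases a <;> rfl

theorem NMap.splitAt_wk {d : List S} {s : S} (p : Pos d s) :
    ∀ {Δ : List (List S)} (r : S) (a : Nm Δ r),
      NMap.splitAt p r (NMap.wk d r a) = NMap.wk p.del r (NMap.wk [s] r a) := by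
  induction p with
  | zero => intros; exact NMap.split_wk _ _ _ _
  | @succ s t d p ih =>
    intros
    rw [NMap.splitAt_succ, NMap.split_wk, ih, NMap.up_wk, NMap.swap_wk_wk]
    exact NMap.merge_wk_wk _ _ _ _

theorem NMap.splitAt_self {d : List S} {s : S} (p : Pos d s) :
    ∀ {Δ : List (List S)},
      NMap.splitAt (Δ := Δ) p s (.var (.here p)) = NMap.wk p.del s (.var (.here .zero)) := by
  induction p with
  | zero => intros; rfl
  | @succ s t d p ih =>
    intros
    rw [NMap.splitAt_succ, NMap.split_succ, ih, NMap.up_wk]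
    rfl

theorem cl_nuB_splitAt {d : List S} {s : S} (p : Pos d s) :
    ∀ {Δ : List (List S)} (T : Tm ob (d :: Δ) Γ .proc),
      cl (nuB d T) = cl (.nu s (nuB p.del (T.ren (NMap.splitAt p) (fun _ x => x)))) := by
  induction p with
  | zero => intros; rfl
  | @succ s t d p ih =>
    intro Δ T
    rw [nuB, cl_nu, ih, ← cl_nu, cl_eq.2 (Cong.nuComm' _ _ _), cl_nu, cl_nu]
    change _ = cl (.nu s (.nu t (nuB p.del ((T.ren _ _).ren _ _))))
    simp only [nuB_ren, Tm.ren_ren]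
    rw [cl_nu, cl_nu]
    congr 4
    refine Eq.trans ?_ (Tm.ren_ren _ _ _ _ _).symm
    congr 1
    funext r a
    exact (NMap.split_merge _ _ _ _).symm

/-- Mutually inverse maps between two blocks of names. -/
structure NMap.Iso {d e : List S} (f : NMap (d :: Δ) (e :: Δ)) (g : NMap (e :: Δ) (d :: Δ)) :
    Prop where
  fix : f.Over
  fix' : g.Over
  left : ∀ s a, g s (f s a) = a
  right : ∀ s a, f s (g s a) = a

theorem NMap.Iso.symm {d e : List S} {f : NMap (d :: Δ) (e :: Δ)} {g : NMap (e :: Δ) (d :: Δ)}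
    (h : NMap.Iso f g) : NMap.Iso g f := ⟨h.fix', h.fix, h.right, h.left⟩

theorem NMap.here_ne_wk {d : List S} {s : S} (x : Pos d s) (a : Nm Δ s) :
    (.var (.here x) : Nm (d :: Δ) s) ≠ NMap.wk d s a := by
  cases a <;> simp [NMap.wk]

theorem NMap.here_or_wk {d : List S} {s : S} (a : Nm (d :: Δ) s) :
    (∃ x, a = .var (.here x)) ∨ ∃ b, a = NMap.wk d s b := by
  rcases a with n | x | x
  · exact .inr ⟨.const n, rfl⟩
  · exact .inl ⟨x, rfl⟩
  · exact .inr ⟨.var x, rfl⟩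

/-- A block of restrictions may be permuted. -/
theorem cl_nuB_iso (d : List S) : ∀ {Δ : List (List S)} {e : List S} {f : NMap (d :: Δ) (e :: Δ)}
    {g : NMap (e :: Δ) (d :: Δ)} (_ : NMap.Iso f g) (T : Tm ob (d :: Δ) Γ .proc),
    cl (nuB d T) = cl (nuB e (T.ren f (fun _ x => x))) := by
  induction d with
  | nil =>
    intro Δ e f g h T
    cases e with
    | cons s e =>
      exfalso
      obtain ⟨x, hx⟩ | ⟨b, hb⟩ := NMap.here_or_wk (g s (.var (.here .zero)))
      · cases x
      · have := h.right s (.var (.here .zero))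
        rw [hb, h.fix] at this
        exact NMap.here_ne_wk _ _ this.symm
    | nil =>
      simp only [nuB, Tm.ren_ren]
      congr 2
      apply NMap.block_ext
      · intro s a; simp [h.fix s a]
      · intro s x; cases x
  | cons s d ih =>
    intro Δ e f g h T
    obtain ⟨p, hp⟩ | ⟨b, hb⟩ := NMap.here_or_wk (f s (.var (.here .zero)))
    · -- move the image of the first name of `d` to the front of `e`
      rw [cl_nuB_splitAt p, nuB, cl_nu, cl_nu]
      congr 1
      rw [ih (f := (NMap.merge s d).comp (f.comp (NMap.splitAt p)))
        (g := (NMap.mergeAt p).comp (g.comp (NMap.split s d)))]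
      · simp only [Tm.ren_ren]
        congr 3
        funext r a; simp
      · have hg : g s (.var (.here p)) = .var (.here .zero) := by rw [← hp, h.left]
        refine ⟨?_, ?_, ?_, ?_⟩
        · intro r a
          revert a
          have : (NMap.wk d).comp ((NMap.merge s d).comp (f.comp (NMap.splitAt p)))
              = (NMap.wk p.del : NMap ([s] :: Δ) _) := by
            apply NMap.singleton_ext
            · intro r a; simp [h.fix r a, NMap.splitAt_wk]
            · simp [hp, NMap.splitAt_self]
          exact fun a => congrFun (congrFun this r) a
        · intro r a
          revert a
          have : (NMap.wk p.del).comp ((NMap.mergeAt p).comp (g.comp (NMap.split s d)))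
              = (NMap.wk d : NMap ([s] :: Δ) _) := by
            apply NMap.singleton_ext
            · intro r a
              simp only [NMap.comp_apply]
              rw [← NMap.splitAt_wk, NMap.mergeAt_splitAt, h.fix', NMap.split_wk]
            · simp only [NMap.comp_apply]
              rw [← NMap.splitAt_self, NMap.mergeAt_splitAt, hg]
              rfl
          exact fun a => congrFun (congrFun this r) a
        · intro r a; simp [NMap.mergeAt_splitAt, h.left]
        · intro r a; simp [NMap.splitAt_mergeAt, h.right]
    · exfalso
      have := h.left s (.var (.here .zero))
      rw [hb, h.fix'] at this
      exact NMap.here_ne_wk _ _ this.symm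

end Blocks

/-! ### Free names under renaming -/

theorem Tm.ren_comp {Δ Δ' Δ'' : List (List S)} {Γ : List (List (Ty S))} {τ : Ty S}
    (T : Tm ob Δ Γ τ) (f : NMap Δ Δ') (f' : NMap Δ' Δ'') :
    (T.ren f (fun _ x => x)).ren f' (fun _ x => x) = T.ren (f.comp f') (fun _ x => x) :=
  T.ren_ren _ _ _ _

theorem Tm.ren_congr_fn {Δ : List (List S)} {Γ : List (List (Ty S))} {τ : Ty S} (T : Tm ob Δ Γ τ) :
    ∀ {Δ' : List (List S)} {Γ' : List (List (Ty S))} (f f' : NMap Δ Δ') (g : VMap Γ Γ'),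
      (∀ s n, (⟨s, n⟩ : NameConst S) ∈ T.fn → f s (.const n) = f' s (.const n)) →
      (∀ s x, f s (.var x) = f' s (.var x)) → T.ren f g = T.ren f' g := by
  have name : ∀ {Δ Δ' : List (List S)} {s : S} (a : Nm Δ s) (f f' : NMap Δ Δ'),
      (∀ s n, (⟨s, n⟩ : NameConst S) ∈ a.fn → f s (.const n) = f' s (.const n)) →
      (∀ s x, f s (.var x) = f' s (.var x)) → f s a = f' s a := by
    intro _ _ s a f f' hc hv
    cases a with
    | const n => exact hc _ _ rfl
    | var x => exact hv _ _
  have upc : ∀ {Δ Δ' : List (List S)} (A : Set (NameConst S)) (d : List S) (f f' : NMap Δ Δ'),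
      (∀ s n, (⟨s, n⟩ : NameConst S) ∈ A → f s (.const n) = f' s (.const n)) →
      (∀ s n, (⟨s, n⟩ : NameConst S) ∈ A → f.up d s (.const n) = f'.up d s (.const n)) := by
    intro _ _ A d f f' h s n hn
    rw [NMap.up_const, h s n hn, NMap.up_const]
  have upv : ∀ {Δ Δ' : List (List S)} (d : List S) (f f' : NMap Δ Δ'),
      (∀ s x, f s (.var x) = f' s (.var x)) →
      (∀ s x, f.up d s (.var x) = f'.up d s (.var x)) := by
    intro _ _ d f f' h s x
    cases x with
    | here x => rfl
    | there x => rw [NMap.up_there, h, NMap.up_there]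
  induction T with
  | nil => intros; rfl
  | var x => intros; rfl
  | inp h a T ih =>
    intro _ _ f f' g hc hv
    simp only [Tm.ren]
    rw [name a f f' (fun s n h => hc s n (.inl h)) hv,
      ih f f' _ (fun s n h => hc s n (.inr h)) hv]
  | rinp h a T ih =>
    intro _ _ f f' g hc hv
    simp only [Tm.ren]
    rw [name a f f' (fun s n h => hc s n (.inl h)) hv,
      ih f f' _ (fun s n h => hc s n (.inr h)) hv]
  | out h a A T ih ih' =>
    intro _ _ f f' g hc hv
    simp only [Tm.ren]
    rw [name a f f' (fun s n h => hc s n (.inl (.inl h))) hv,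
      ih f f' _ (fun s n h => hc s n (.inl (.inr h))) hv,
      ih' f f' _ (fun s n h => hc s n (.inr h)) hv]
  | rout h a A T ih ih' =>
    intro _ _ f f' g hc hv
    simp only [Tm.ren]
    rw [name a f f' (fun s n h => hc s n (.inl (.inl h))) hv,
      ih f f' _ (fun s n h => hc s n (.inl (.inr h))) hv,
      ih' f f' _ (fun s n h => hc s n (.inr h)) hv]
  | par A T ih ih' =>
    intro _ _ f f' g hc hv
    simp only [Tm.ren]
    rw [ih f f' _ (fun s n h => hc s n (.inl h)) hv,
      ih' f f' _ (fun s n h => hc s n (.inr h)) hv]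
  | nu s T ih =>
    intro _ _ f f' g hc hv
    simp only [Tm.ren]
    rw [ih _ _ _ (upc _ _ f f' hc) (upv _ _ _ hv)]
  | pabs T ih =>
    intro _ _ f f' g hc hv
    simp only [Tm.ren]
    rw [ih f f' _ hc hv]
  | nabs T ih =>
    intro _ _ f f' g hc hv
    simp only [Tm.ren]
    rw [ih _ _ _ (upc _ _ f f' hc) (upv _ _ _ hv)]
  | papp F K ih ih' =>
    intro _ _ f f' g hc hv
    simp only [Tm.ren]
    rw [ih f f' _ (fun s n h => hc s n (.inl h)) hv]
    congr 1
    funext τ x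
    exact ih' τ x f f' _ (fun s n h => hc s n
      (.inr (Set.mem_iUnion.2 ⟨τ, Set.mem_iUnion.2 ⟨x, h⟩⟩))) hv
  | napp F K ih =>
    intro _ _ f f' g hc hv
    simp only [Tm.ren]
    rw [ih f f' _ (fun s n h => hc s n (.inl h)) hv]
    congr 1
    funext s x
    exact name _ f f' (fun s' n h => hc s' n
      (.inr (Set.mem_iUnion.2 ⟨s, Set.mem_iUnion.2 ⟨x, h⟩⟩))) hv

/-- A renaming of closed terms is determined by its action on free constants. -/
theorem Tm.ren_congr_closed {Γ : List (List (Ty S))} {τ : Ty S} (T : Tm ob [] Γ τ)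
    {Δ' : List (List S)} {Γ' : List (List (Ty S))} {f f' : NMap [] Δ'} {g : VMap Γ Γ'}
    (h : ∀ c ∈ T.fn, f c.sort (.const c.idx) = f' c.sort (.const c.idx)) :
    T.ren f g = T.ren f' g :=
  T.ren_congr_fn f f' g (fun s n hn => h ⟨s, n⟩ hn) (fun _ x => nomatch x)

theorem Nm.fn_wk {Δ : List (List S)} (d : List S) {s : S} (a : Nm Δ s) :
    (NMap.wk d s a).fn = a.fn := by
  cases a <;> rfl

theorem Tm.fn_ren_subset {Δ : List (List S)} {Γ : List (List (Ty S))} {τ : Ty S}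
    (T : Tm ob Δ Γ τ) (G : Set (NameConst S)) :
    ∀ {Δ' : List (List S)} {Γ' : List (List (Ty S))} (f : NMap Δ Δ') (g : VMap Γ Γ'),
      (∀ s a, (f s a).fn ⊆ a.fn ∪ G) → (T.ren f g).fn ⊆ T.fn ∪ G := by
  have up : ∀ {Δ Δ' : List (List S)} (d : List S) (f : NMap Δ Δ'),
      (∀ s a, (f s a).fn ⊆ a.fn ∪ G) → (∀ s a, (f.up d s a).fn ⊆ a.fn ∪ G) := by
    intro _ _ d f h s a
    rcases a with n | x | x
    · rw [NMap.up_const, Nm.fn_wk]; exact h s _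
    · exact Set.empty_subset _
    · rw [NMap.up_there, Nm.fn_wk]; exact h s _
  induction T with
  | nil => intro _ _ _ _ _; exact Set.empty_subset _
  | var x => intro _ _ _ _ _; exact Set.empty_subset _
  | inp h a T ih =>
    intro _ _ f g hf
    have h1 := hf _ a
    have h2 := ih f (g.up _) hf
    simp only [Tm.ren, Tm.fn]
    grind
  | rinp h a T ih =>
    intro _ _ f g hf
    have h1 := hf _ a
    have h2 := ih f (g.up _) hf
    simp only [Tm.ren, Tm.fn]
    grind
  | out h a A T ih ih' =>
    intro _ _ f g hf
    have h1 := hf _ a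
    have h2 := ih f g hf
    have h3 := ih' f g hf
    simp only [Tm.ren, Tm.fn]
    grind
  | rout h a A T ih ih' =>
    intro _ _ f g hf
    have h1 := hf _ a
    have h2 := ih f g hf
    have h3 := ih' f g hf
    simp only [Tm.ren, Tm.fn]
    grind
  | par A T ih ih' =>
    intro _ _ f g hf
    have h2 := ih f g hf
    have h3 := ih' f g hf
    simp only [Tm.ren, Tm.fn]
    grind
  | nu s T ih => intro _ _ f g hf; exact ih _ _ (up _ f hf)
  | pabs T ih => intro _ _ f g hf; exact ih _ _ hf
  | nabs T ih => intro _ _ f g hf; exact ih _ _ (up _ f hf)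
  | papp F K ih ih' =>
    intro _ _ f g hf
    have h1 := ih f g hf
    simp only [Tm.ren, Tm.fn]
    refine Set.union_subset (h1.trans (by grind)) (Set.iUnion₂_subset fun τ x => ?_)
    refine (ih' τ x f g hf).trans (Set.union_subset_union_left _ ?_)
    exact (Set.subset_iUnion₂ (s := fun τ x => (K τ x).fn) τ x).trans Set.subset_union_right
  | napp F K ih =>
    intro _ _ f g hf
    have h1 := ih f g hf
    simp only [Tm.ren, Tm.fn]
    refine Set.union_subset (h1.trans (by grind)) (Set.iUnion₂_subset fun τ x => ?_)
    refine (hf τ _).trans (Set.union_subset_union_left _ ?_)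
    exact (Set.subset_iUnion₂ (s := fun τ x => (K τ x).fn) τ x).trans Set.subset_union_right

instance Pos.finite {α : Type u} (l : List α) : Finite (Σ a, Pos l a) := by
  induction l with
  | nil =>
    have : IsEmpty (Σ a, Pos ([] : List α) a) := ⟨fun x => nomatch x.2⟩
    infer_instance
  | cons b l ih =>
    refine Finite.of_surjective
      (fun o : Option (Σ a, Pos l a) => match o with
        | none => (⟨b, .zero⟩ : Σ a, Pos (b :: l) a)
        | some p => ⟨p.1, .succ p.2⟩) ?_
    rintro ⟨a, x⟩
    cases x with
    | zero => exact ⟨none, rfl⟩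
    | succ x => exact ⟨some ⟨a, x⟩, rfl⟩

theorem finite_iUnion_pos {α : Type u} {β : Type*} (l : List α) (K : ∀ a, Pos l a → Set β)
    (h : ∀ a x, (K a x).Finite) : (⋃ a, ⋃ x, K a x).Finite := by
  have : (⋃ a, ⋃ x, K a x) = ⋃ p : Σ a, Pos l a, K p.1 p.2 := by
    ext b; simp
  rw [this]
  exact Set.finite_iUnion fun p => h _ _

theorem Nm.fn_finite {Δ : List (List S)} {s : S} (a : Nm Δ s) : a.fn.Finite := by
  cases a <;> simp [Nm.fn]

theorem Tm.fn_finite {Δ : List (List S)} {Γ : List (List (Ty S))} {τ : Ty S} (T : Tm ob Δ Γ τ) :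
    T.fn.Finite := by
  induction T with
  | nil => exact Set.finite_empty
  | var => exact Set.finite_empty
  | inp h a T ih => exact a.fn_finite.union ih
  | rinp h a T ih => exact a.fn_finite.union ih
  | out h a A T ih ih' => exact (a.fn_finite.union ih).union ih'
  | rout h a A T ih ih' => exact (a.fn_finite.union ih).union ih'
  | par A T ih ih' => exact ih.union ih'
  | nu s T ih => exact ih
  | pabs T ih => exact ih
  | nabs T ih => exact ih
  | papp F K ih ih' => exact ih.union (finite_iUnion_pos _ _ ih')
  | napp F K ih => exact ih.union (finite_iUnion_pos _ _ fun _ _ => Nm.fn_finite _)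

theorem exists_fresh (s : S) {F : Set (NameConst S)} (hF : F.Finite) :
    ∃ c : NameConst S, c.sort = s ∧ c ∉ F := by
  have : (Set.range fun n : ℕ => (⟨s, n⟩ : NameConst S)).Infinite :=
    Set.infinite_range_of_injective fun a b h => congrArg NameConst.idx h
  obtain ⟨c, ⟨n, rfl⟩, hc⟩ := this.exists_notMem_finite hF
  exact ⟨_, rfl, hc⟩

/-! ### Restriction of constants -/

@[simp] theorem NMap.bind_self {Δ : List (List S)} (c : NameConst S) :
    NMap.bind (Δ := Δ) c c.sort (.const c.idx) = .var (.here .zero) := by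
  simp [NMap.bind]

theorem NMap.bind_ne {Δ : List (List S)} {c : NameConst S} {s : S} {n : ℕ}
    (h : (⟨s, n⟩ : NameConst S) ≠ c) : NMap.bind (Δ := Δ) c s (.const n) = .const n := by
  have : ¬ (c.sort = s ∧ c.idx = n) := by
    rintro ⟨rfl, rfl⟩
    exact h rfl
  simp [NMap.bind, this]

theorem Tm.bind_eq_wkN {Δ : List (List S)} {Γ : List (List (Ty S))} {τ : Ty S} (T : Tm ob Δ Γ τ)
    {c : NameConst S} (h : c ∉ T.fn) : T.ren (NMap.bind c) (fun _ x => x) = T.wkN [c.sort] := by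
  refine T.ren_congr_fn _ _ _ (fun s n hn => ?_) (fun s x => rfl)
  rw [NMap.bind_ne (by rintro rfl; exact h hn)]
  rfl

theorem Tm.inst_bind {Γ : List (List (Ty S))} {τ : Ty S} (c : NameConst S)
    (T : Tm ob [[c.sort]] Γ τ) (h : c ∉ T.fn) :
    (T.ren (NMap.inst (oneN (.const c.idx))) (fun _ x => x)).ren (NMap.bind c) (fun _ x => x)
      = T := by
  rw [Tm.ren_ren]
  refine (T.ren_congr_fn _ (fun _ a => a) _ (fun s n hn => ?_) (fun s x => ?_)).trans T.ren_id
  · rw [NMap.comp_apply, NMap.inst_const, NMap.bind_ne (by rintro rfl; exact h hn)]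
  · rcases x with x | x
    · rcases x with _ | x
      · exact NMap.bind_self c
      · cases x
    · cases x

/-- The map from names over `d` to names over `c` and `d` which turns the constant `c` into the
first name of the block. -/
def NMap.bindB (c : NameConst S) (d : List S) : NMap [d] [c.sort :: d] :=
  ((NMap.bind c).up d).comp (NMap.merge c.sort d)

theorem res_nuB (c : NameConst S) (d : List S) (T : Tm ob [d] [] .proc) :
    res c (nuB d T) = nuB (c.sort :: d) (T.ren (NMap.bindB c d) (fun _ x => x)) := by
  rw [res, nuB_ren, nu_nuB, Tm.ren_ren]
  rfl

theorem NMap.bindB_const {c : NameConst S} {d : List S} {s : S} {n : ℕ}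
    (h : (⟨s, n⟩ : NameConst S) ≠ c) : NMap.bindB c d s (.const n) = .const n := by
  simp only [NMap.bindB, NMap.comp_apply, NMap.up_const, NMap.bind_ne h]
  rfl

/-- A map on names over blocks that fixes the constants outside `cs`. -/
def NMap.FixesOff {d e : List S} (cs : List (NameConst S)) (f : NMap [d] [e]) : Prop :=
  ∀ c, c ∉ cs → f c.sort (.const c.idx) = .const c.idx

theorem Tm.wkN_ren_fixesOff {Γ : List (List (Ty S))} {τ : Ty S} {d e : List S}
    {cs : List (NameConst S)} {f : NMap [d] [e]} (hf : NMap.FixesOff cs f) (T : Tm ob [] Γ τ)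
    (h : Disjoint {c | c ∈ cs} T.fn) : (T.wkN d).ren f (fun _ x => x) = T.wkN e := by
  rw [Tm.wkN, Tm.ren_ren]
  refine T.ren_congr_closed fun c hc => ?_
  exact hf c fun h' => Set.disjoint_left.1 h h' hc

theorem cl_res {c : NameConst S} {T T' : Proc ob} (h : cl T = cl T') :
    cl (res c T) = cl (res c T') := by
  rw [res, cl_nu, cl_ren h, ← cl_nu]; rfl

theorem cl_resList {cs : List (NameConst S)} {T T' : Proc ob} (h : cl T = cl T') :
    cl (resList cs T) = cl (resList cs T') := by
  induction cs with
  | nil => exact h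
  | cons c cs ih => exact cl_res ih

theorem cl_res_par {c : NameConst S} (T V : Proc ob) (h : c ∉ V.fn) :
    cl (res c (.par T V)) = cl (res c T) + cl V := by
  rw [res, Tm.ren, V.bind_eq_wkN h, cl_nu_par]; rfl

theorem cl_resList_par {cs : List (NameConst S)} (T V : Proc ob)
    (h : Disjoint {c | c ∈ cs} V.fn) :
    cl (resList cs (.par T V)) = cl (resList cs T) + cl V := by
  induction cs with
  | nil => rfl
  | cons c cs ih =>
    have hc : c ∉ V.fn := fun h' => Set.disjoint_left.1 h (by simp) h'
    have hcs : Disjoint {c | c ∈ cs} V.fn :=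
      h.mono_left fun x hx => by simp only [Set.mem_ofPred_eq] at hx ⊢; exact .tail _ hx
    change cl (res c (resList cs _)) = cl (res c (resList cs T)) + cl V
    rw [← cl_res_par _ _ hc]
    exact cl_res (by rw [ih hcs, cl_par])

theorem resList_nuB (cs : List (NameConst S)) (d : List S) :
    ∃ (e : List S) (f : NMap [d] [e]), NMap.FixesOff cs f ∧
      ∀ T : Tm ob [d] [] .proc, resList cs (nuB d T) = nuB e (T.ren f (fun _ x => x)) := by
  induction cs with
  | nil => exact ⟨d, fun _ a => a, fun _ _ => rfl, fun T => by simp [resList]⟩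
  | cons c cs ih =>
    obtain ⟨e, f, hf, h⟩ := ih
    refine ⟨c.sort :: e, f.comp (NMap.bindB c e), ?_, ?_⟩
    · intro b hb
      simp only [List.mem_cons, not_or] at hb
      rw [NMap.comp_apply, hf b hb.2]
      exact NMap.bindB_const hb.1
    · intro T
      change res c (resList cs (nuB d T)) = _
      rw [h, res_nuB, Tm.ren_ren]; rfl

theorem cl_res_comm (c b : NameConst S) (hcb : c ≠ b) (T : Proc ob) :
    cl (res c (res b T)) = cl (res b (res c T)) := by
  simp only [res, Tm.ren]
  rw [cl_eq.2 (Cong.nuComm' _ _ _), Tm.ren_ren, Tm.ren_ren, Tm.ren_ren]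
  congr 3
  refine Tm.ren_congr_closed _ fun a _ => ?_
  simp only [NMap.comp_apply]
  rcases eq_or_ne a b with rfl | hb
  · rw [NMap.bind_self, NMap.up_here, NMap.bind_ne (c := c) (s := a.sort) (n := a.idx) hcb.symm,
      NMap.up_const, NMap.bind_self]
    rfl
  · rcases eq_or_ne a c with rfl | hc
    · rw [NMap.bind_self, NMap.bind_ne (c := b) (s := a.sort) (n := a.idx) hcb]
      simp only [NMap.up_const, NMap.bind_self, NMap.up_here]
      rfl
    · rw [NMap.bind_ne (c := b) (s := a.sort) (n := a.idx) hb,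
        NMap.bind_ne (c := c) (s := a.sort) (n := a.idx) hc]
      simp only [NMap.up_const, NMap.bind_ne (c := b) (s := a.sort) (n := a.idx) hb,
        NMap.bind_ne (c := c) (s := a.sort) (n := a.idx) hc]
      rfl

theorem cl_res_resList (c : NameConst S) (cs : List (NameConst S)) (h : c ∉ cs) (T : Proc ob) :
    cl (res c (resList cs T)) = cl (resList cs (res c T)) := by
  induction cs with
  | nil => rfl
  | cons b cs ih =>
    simp only [List.mem_cons, not_or] at h
    change cl (res c (res b (resList cs T))) = cl (res b (resList cs (res c T)))
    rw [cl_res_comm c b h.1]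
    exact cl_res (ih h.2)

theorem nuB_fn_subset (d : List S) : ∀ {Δ : List (List S)} {Γ : List (List (Ty S))}
    (T : Tm ob (d :: Δ) Γ .proc), (nuB d T).fn ⊆ T.fn := by
  induction d with
  | nil =>
    intro _ _ T
    refine (T.fn_ren_subset ∅ _ _ ?_).trans (by simp)
    intro s a
    rcases a with n | x | x
    · simp [NMap.drop, Nm.fn]
    · cases x
    · exact Set.empty_subset _
  | cons s d ih =>
    intro _ _ T
    refine (ih _).trans ((T.fn_ren_subset ∅ _ _ ?_).trans (by simp))
    intro r a
    rcases a with n | x | x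
    · simp [NMap.split, Nm.fn]
    · cases x <;> exact Set.empty_subset _
    · exact Set.empty_subset _

/-- The names of a block of restrictions can be replaced by fresh constants. -/
theorem exists_open (d : List S) : ∀ {F : Set (NameConst S)} (_ : F.Finite),
    ∃ (cs : List (NameConst S)) (f : NMap [d] []), cs.Nodup ∧ Disjoint {c | c ∈ cs} F ∧
      (∀ s n, f s (.const n) = .const n) ∧
      ∀ T : Tm ob [d] [] .proc, Disjoint {c | c ∈ cs} T.fn →
        nuB d T = resList cs (T.ren f (fun _ x => x)) := by
  induction d with
  | nil =>
    intro F hF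
    exact ⟨[], NMap.drop, .nil, by simp, fun _ _ => rfl, fun T _ => rfl⟩
  | cons s d ih =>
    intro F hF
    obtain ⟨c, rfl, hcF⟩ := exists_fresh s hF
    obtain ⟨cs, f, hcs, hd, hf, h⟩ := ih (hF.union (Set.finite_singleton c))
    have hc : c ∉ cs := fun h' => Set.disjoint_left.1 hd h' (by simp)
    let i : NMap [[c.sort]] [] := NMap.inst (oneN (.const c.idx))
    refine ⟨c :: cs, (NMap.split c.sort d).comp ((i.up d).comp f), ?_, ?_, ?_, ?_⟩
    · exact List.nodup_cons.2 ⟨hc, hcs⟩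
    · rw [Set.disjoint_left]
      intro b hb hbF
      rcases List.mem_cons.1 hb with rfl | hb
      · exact hcF hbF
      · exact Set.disjoint_left.1 hd hb (.inl hbF)
    · intro s n
      exact hf s n
    · intro T hT
      have hcT : c ∉ T.fn := fun h' => Set.disjoint_left.1 hT (by simp) h'
      have hs : (T.ren (NMap.split c.sort d) (fun _ x => x)).fn ⊆ T.fn := by
        refine (T.fn_ren_subset ∅ _ _ ?_).trans (by simp)
        intro r a
        rcases a with n | x | x
        · simp [NMap.split, Nm.fn]
        · cases x <;> exact Set.empty_subset _
        · exact Set.empty_subset _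
      change Tm.nu c.sort (nuB d _) = res c (resList cs _)
      rw [← Tm.ren_comp, ← Tm.ren_comp, ← h, res]
      · congr 1
        rw [← nuB_ren]
        exact (Tm.inst_bind c _ fun h' => hcT (hs (nuB_fn_subset d _ h'))).symm
      · have : ((T.ren (NMap.split c.sort d) (fun _ x => x)).ren (i.up d) (fun _ x => x)).fn
            ⊆ T.fn ∪ {c} := by
          refine (Tm.fn_ren_subset _ {c} _ _ ?_).trans (Set.union_subset_union_left _ hs)
          intro r a
          rcases a with n | x | x
          · simp [i, Nm.fn]
          · exact Set.empty_subset _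
          · rcases x with x | x
            · rcases x with _ | x
              · simp [i, Nm.fn, oneN]
              · cases x
            · cases x
        refine Set.disjoint_left.2 fun b hb hb' => ?_
        rcases this hb' with h' | rfl
        · exact Set.disjoint_left.1 hT (List.mem_cons_of_mem _ hb) h'
        · exact hc hb

/-! ### Transitions up to structural congruence -/

/-- `InG g a T`: the prefixed process `g` can input an agent on `a` and continue as `T`, where
the received agent is the innermost variable. -/
inductive InG {Δ : List (List S)} {Γ : List (List (Ty S))} :
    Tm ob Δ Γ .proc → ∀ {s : S} {τ : Ty S}, Nm Δ s → Tm ob Δ ([τ] :: Γ) .proc → Prop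
  | inp {s τ} (h : ob s = τ) (a : Nm Δ s) (T : Tm ob Δ ([τ] :: Γ) .proc) : InG (.inp h a T) a T
  | rinp {s τ} (h : ob s = τ) (a : Nm Δ s) (T : Tm ob Δ ([τ] :: Γ) .proc) :
      InG (.rinp h a T) a (.par T ((Tm.rinp h a T).wkV [τ]))

/-- `OutG g a B V`: the prefixed process `g` can output `B` on `a` and continue as `V`. -/
inductive OutG {Δ : List (List S)} {Γ : List (List (Ty S))} :
    Tm ob Δ Γ .proc → ∀ {s : S} {τ : Ty S}, Nm Δ s → Tm ob Δ Γ τ → Tm ob Δ Γ .proc → Prop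
  | out {s τ} (h : ob s = τ) (a : Nm Δ s) (B : Tm ob Δ Γ τ) (V : Tm ob Δ Γ .proc) :
      OutG (.out h a B V) a B V
  | rout {s τ} (h : ob s = τ) (a : Nm Δ s) (B : Tm ob Δ Γ τ) (V : Tm ob Δ Γ .proc) :
      OutG (.rout h a B V) a B (.par V (.rout h a B V))

theorem Tm.wkV_ren {Δ Δ' : List (List S)} {Γ Γ' : List (List (Ty S))} {τ : Ty S}
    (T : Tm ob Δ Γ τ) (d : List (Ty S)) (f : NMap Δ Δ') (g : VMap Γ Γ') :
    (T.wkV d).ren f (g.up d) = (T.ren f g).wkV d := by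
  simp only [Tm.wkV, Tm.ren_ren]; rfl

theorem Tm.wkV_sub {Δ : List (List S)} {Γ Γ' : List (List (Ty S))} {τ : Ty S}
    (T : Tm ob Δ Γ τ) (d : List (Ty S)) (σ : Sub ob Δ Γ Γ') :
    (T.wkV d).sub (σ.upV d) = (T.sub σ).wkV d := by
  rw [Tm.wkV, Tm.wkV, Tm.sub_ren, Tm.ren_sub]; rfl

theorem Tm.wkV_inst {Δ : List (List S)} {Γ : List (List (Ty S))} {τ : Ty S}
    (T : Tm ob Δ Γ τ) {d : List (Ty S)} (K : ∀ τ, Pos d τ → Tm ob Δ Γ τ) :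
    (T.wkV d).sub (Sub.inst K) = T := by
  rw [Tm.wkV, Tm.ren_sub]
  refine Eq.trans ?_ T.sub_var
  rw [Tm.ren_id]; rfl

theorem Tm.fill_ren {Δ Δ' : List (List S)} {Γ Γ' : List (List (Ty S))} {τ ρ : Ty S}
    (E : Tm ob Δ ([τ] :: Γ) ρ) (A : Tm ob Δ Γ τ) (f : NMap Δ Δ') (g : VMap Γ Γ') :
    (E.fill A).ren f g = (E.ren f (g.up _)).fill (A.ren f g) := by
  rw [Tm.fill, Sub.inst_ren, Tm.fill]
  congr 2
  funext τ x
  rcases x with _ | x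
  · rfl
  · cases x

theorem Tm.fill_ren' {Δ Δ' : List (List S)} {Γ : List (List (Ty S))} {τ ρ : Ty S}
    (E : Tm ob Δ ([τ] :: Γ) ρ) (A : Tm ob Δ Γ τ) (f : NMap Δ Δ') :
    (E.fill A).ren f (fun _ x => x) = (E.ren f (fun _ x => x)).fill (A.ren f (fun _ x => x)) := by
  rw [Tm.fill_ren, VMap.up_id']

theorem Tm.fill_sub {Δ : List (List S)} {Γ Γ' : List (List (Ty S))} {τ ρ : Ty S}
    (E : Tm ob Δ ([τ] :: Γ) ρ) (A : Tm ob Δ Γ τ) (σ : Sub ob Δ Γ Γ') :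
    (E.fill A).sub σ = (E.sub (σ.upV _)).fill (A.sub σ) := by
  rw [Tm.fill, Sub.inst_sub, Tm.fill]
  congr 2
  funext τ x
  rcases x with _ | x
  · rfl
  · cases x

theorem cl_fill {Δ : List (List S)} {Γ : List (List (Ty S))} {τ ρ : Ty S}
    {E E' : Tm ob Δ ([τ] :: Γ) ρ} {A A' : Tm ob Δ Γ τ} (hE : cl E = cl E') (hA : cl A = cl A') :
    cl (E.fill A) = cl (E'.fill A') := by
  refine cl_eq.2 (Cong.sub (cl_eq.1 hE) ?_)
  intro ρ x
  rcases x with x | x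
  · rcases x with _ | x
    · exact cl_eq.1 hA
    · cases x
  · exact .refl _

theorem InG.ren {Δ Δ' : List (List S)} {Γ Γ' : List (List (Ty S))} {g : Tm ob Δ Γ .proc} {s : S}
    {τ : Ty S} {a : Nm Δ s} {T : Tm ob Δ ([τ] :: Γ) .proc} (h : InG g a T) (f : NMap Δ Δ')
    (k : VMap Γ Γ') : InG (g.ren f k) (f s a) (T.ren f (k.up _)) := by
  cases h with
  | inp h a T => exact .inp _ _ _
  | rinp h a T =>
    simp only [Tm.ren, Tm.wkV_ren]
    exact .rinp _ _ _

theorem InG.ren' {Δ Δ' : List (List S)} {Γ : List (List (Ty S))} {g : Tm ob Δ Γ .proc} {s : S}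
    {τ : Ty S} {a : Nm Δ s} {T : Tm ob Δ ([τ] :: Γ) .proc} (h : InG g a T) (f : NMap Δ Δ') :
    InG (g.ren f (fun _ x => x)) (f s a) (T.ren f (fun _ x => x)) := by
  have := h.ren f (fun _ x => x)
  rwa [VMap.up_id'] at this

theorem InG.sub {Δ : List (List S)} {Γ Γ' : List (List (Ty S))} {g : Tm ob Δ Γ .proc} {s : S}
    {τ : Ty S} {a : Nm Δ s} {T : Tm ob Δ ([τ] :: Γ) .proc} (h : InG g a T) (σ : Sub ob Δ Γ Γ') :
    InG (g.sub σ) a (T.sub (σ.upV _)) := by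
  cases h with
  | inp h a T => exact .inp _ _ _
  | rinp h a T =>
    simp only [Tm.sub, Tm.wkV_sub]
    exact .rinp _ _ _

theorem OutG.ren {Δ Δ' : List (List S)} {Γ Γ' : List (List (Ty S))} {g : Tm ob Δ Γ .proc} {s : S}
    {τ : Ty S} {a : Nm Δ s} {B : Tm ob Δ Γ τ} {V : Tm ob Δ Γ .proc} (h : OutG g a B V)
    (f : NMap Δ Δ') (k : VMap Γ Γ') : OutG (g.ren f k) (f s a) (B.ren f k) (V.ren f k) := by
  cases h with
  | out h a T => exact .out _ _ _ _
  | rout h a T => exact .rout _ _ _ _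

theorem OutG.sub {Δ : List (List S)} {Γ Γ' : List (List (Ty S))} {g : Tm ob Δ Γ .proc} {s : S}
    {τ : Ty S} {a : Nm Δ s} {B : Tm ob Δ Γ τ} {V : Tm ob Δ Γ .proc} (h : OutG g a B V)
    (σ : Sub ob Δ Γ Γ') : OutG (g.sub σ) a (B.sub σ) (V.sub σ) := by
  cases h with
  | out h a T => exact .out _ _ _ _
  | rout h a T => exact .rout _ _ _ _

theorem InG.step {g : Proc ob} {a : NameConst S} {τ : Ty S} {T : Tm ob [] [[τ]] .proc}
    (h : InG g (.const a.idx : Nm [] a.sort) T) (A : Closed ob τ) :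
    Step g (.inp a A) (T.fill A) := by
  obtain ⟨s, n⟩ := a
  cases h with
  | inp h a T => exact .inp ⟨s, n⟩ h T A
  | rinp h a T =>
    have := Step.rinp ⟨s, n⟩ h T A
    simp only [Tm.fill, Tm.sub, Tm.wkV_inst] at this ⊢
    exact this

theorem OutG.step {g : Proc ob} {a : NameConst S} {τ : Ty S} {B : Closed ob τ} {V : Proc ob}
    (h : OutG g (.const a.idx : Nm [] a.sort) B V) : Step g (.out [] a B) V := by
  obtain ⟨s, n⟩ := a
  cases h with
  | out h a B V => exact .out ⟨s, n⟩ h B V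
  | rout h a B V => exact .rout ⟨s, n⟩ h B V

theorem Step.congr {P P' Q Q' : Proc ob} {l : Act ob} (h : Step P l P') (hQ : cl Q = cl P)
    (hQ' : cl Q' = cl P') : Step Q l Q' :=
  .cong (cl_eq.1 hQ) h (cl_eq.1 hQ'.symm)

theorem Step.resList {P P' : Proc ob} {l : Act ob} (h : Step P l P') (cs : List (NameConst S))
    (hd : Disjoint {c | c ∈ cs} l.names) : Step (resList cs P) l (resList cs P') := by
  induction cs with
  | nil => exact h
  | cons c cs ih =>
    refine Step.res c (ih (hd.mono_left fun x hx => List.mem_cons_of_mem _ hx)) ?_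
    exact fun h' => Set.disjoint_left.1 hd (List.mem_cons_self ..) h'

theorem Step.par' {P P' : Proc ob} {l : Act ob} (h : Step P l P') (V : Proc ob) (hl : l.bn = ∅) :
    Step (.par P V) l (.par P' V) := .par V h (by simp [hl])

/-- Shape of a process that inputs `A` on `a`. -/
def InShape (P : Proc ob) (a : NameConst S) {τ : Ty S} (A : Closed ob τ) (P' : Proc ob) : Prop :=
  ∃ (d : List S) (g : Tm ob [d] [] .proc) (T : Tm ob [d] [[τ]] .proc) (R : Tm ob [d] [] .proc),
    InG g (.const a.idx : Nm [d] a.sort) T ∧ cl P = cl (nuB d (.par g R)) ∧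
      cl P' = cl (nuB d (.par (T.fill (A.wkN d)) R))

/-- Shape of a process that outputs `B` on `a`, extruding `cs`. -/
def OutShape (P : Proc ob) (cs : List (NameConst S)) (a : NameConst S) {τ : Ty S}
    (B : Closed ob τ) (P' : Proc ob) : Prop :=
  ∃ (d : List S) (g V R : Tm ob [d] [] .proc),
    OutG g (.const a.idx : Nm [d] a.sort) (B.wkN d) V ∧ a ∉ cs ∧
      cl P = cl (resList cs (nuB d (.par g R))) ∧ cl P' = cl (nuB d (.par V R))

/-- Shape of a process that makes an internal move. -/
def TauShape (P P' : Proc ob) : Prop :=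
  ∃ (d : List S) (s : S) (τ : Ty S) (a : Nm [d] s) (g g' : Tm ob [d] [] .proc)
    (T : Tm ob [d] [[τ]] .proc) (B : Tm ob [d] [] τ) (V R : Tm ob [d] [] .proc),
    InG g a T ∧ OutG g' a B V ∧ cl P = cl (nuB d (.par g (.par g' R))) ∧
      cl P' = cl (nuB d (.par (T.fill B) (.par V R)))

/-- Shape of the source and the target of a transition with a given label. -/
def Shape : Proc ob → Act ob → Proc ob → Prop
  | P, .tau, P' => TauShape P P'
  | P, .inp a A, P' => InShape P a A P'
  | P, .out cs a B, P' => OutShape P cs a B P'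

theorem cl_nuB_par_par (d : List S) {Δ : List (List S)} {Γ : List (List (Ty S))}
    (T R : Tm ob (d :: Δ) Γ .proc) (V : Tm ob Δ Γ .proc) :
    cl (nuB d (.par T (.par R (V.wkN d)))) = cl (nuB d (.par T R)) + cl V := by
  rw [← cl_nuB_par]
  exact nuB_eq (by simp only [cl_par]; abel)

theorem bindB_wkN {c : NameConst S} {d : List S} {Γ : List (List (Ty S))} {τ : Ty S}
    (A : Tm ob [] Γ τ) (h : c ∉ A.fn) :
    (A.wkN d).ren (NMap.bindB c d) (fun _ x => x) = A.wkN (c.sort :: d) := by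
  refine A.wkN_ren_fixesOff (cs := [c]) ?_ ?_
  · intro b hb
    simp only [List.mem_singleton] at hb
    exact NMap.bindB_const hb
  · simpa using h

theorem cl_nuB_nil (T : Proc ob) : cl (nuB [] (.par (T.wkN []) .nil)) = cl T := by
  have : nuB [] (.par (T.wkN []) .nil) = .par T .nil := nuB_nil (.par T .nil)
  rw [this, cl_par, cl_nil, add_zero]

@[simp] theorem Tm.wkN_inl {Δ : List (List S)} {Γ : List (List (Ty S))} {τ : Ty S}
    (A : Tm ob Δ Γ τ) (c d : List S) :
    (A.wkN c).ren (NMap.inl c d) (fun _ x => x) = A.wkN (c ++ d) := by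
  rw [Tm.wkN, Tm.ren_comp]
  congr 1
  funext r a; simp

@[simp] theorem Tm.wkN_inr {Δ : List (List S)} {Γ : List (List (Ty S))} {τ : Ty S}
    (A : Tm ob Δ Γ τ) (c d : List S) :
    (A.wkN d).ren (NMap.inr c d) (fun _ x => x) = A.wkN (c ++ d) := by
  rw [Tm.wkN, Tm.ren_comp]
  congr 1
  funext r a; simp

theorem InShape.tau {P P' Q Q' : Proc ob} {cs : List (NameConst S)} {a : NameConst S} {τ : Ty S}
    {A : Closed ob τ} (h : InShape P a A P') (h' : OutShape Q cs a A Q')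
    (hcs : Disjoint {c | c ∈ cs} P.fn) :
    TauShape (.par P Q) (HO.resList cs (.par P' Q')) := by
  obtain ⟨d, g, T, R, hg, hP, hP'⟩ := h
  obtain ⟨d', g', V, R', hg', -, hQ, hQ'⟩ := h'
  obtain ⟨e, f, -, hf⟩ := resList_nuB (ob := ob) cs (d ++ d')
  have key : ∀ X Y : Proc ob, ∀ (U : Tm ob [d] [] .proc) (W : Tm ob [d'] [] .proc),
      cl X = cl (nuB d U) → cl Y = cl (nuB d' W) →
      cl (HO.resList cs (.par X Y)) = cl (nuB e ((Tm.par (U.ren (NMap.inl d d') (fun _ x => x))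
        (W.ren (NMap.inr d d') (fun _ x => x))).ren f (fun _ x => x))) := by
    intro X Y U W hX hY
    rw [← hf]
    exact cl_resList (by rw [cl_par, hX, hY, nuB_add])
  refine ⟨e, a.sort, τ, f _ (.const a.idx), _, _, _, _, _,
    .par ((R.ren (NMap.inl d d') (fun _ x => x)).ren f (fun _ x => x))
      ((R'.ren (NMap.inr d d') (fun _ x => x)).ren f (fun _ x => x)),
    (hg.ren' (NMap.inl d d')).ren' f, (hg'.ren (NMap.inr d d') (fun _ x => x)).ren f (fun _ x => x),
    ?_, ?_⟩
  · have : cl (P.par Q) = cl (HO.resList cs (.par P (nuB d' (.par g' R')))) := by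
      rw [cl_resList (cl_eq.2 (Cong.parComm P _)), cl_resList_par _ _ hcs, cl_par, hQ, add_comm]
    rw [this, key _ _ _ _ hP rfl]
    refine nuB_eq ?_
    simp only [Tm.ren, cl_par]
    abel
  · rw [key _ _ _ _ hP' hQ']
    refine nuB_eq ?_
    simp only [Tm.ren, cl_par, Tm.fill_ren', Tm.wkN_inl, Tm.wkN_inr]
    abel

/-- Transitions up to structural congruence: the acting prefixed processes stand side by side with
the rest below a block of restrictions. -/
theorem Step.shape {P P' : Proc ob} {l : Act ob} (h : Step P l P') : Shape P l P' := by
  induction h with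
  | inp a h T A =>
    exact ⟨[], _, _, .nil, (InG.inp h (.const a.idx) T).ren' (NMap.wk []), (cl_nuB_nil _).symm,
      by rw [Tm.wkN, ← Tm.fill_ren']; exact (cl_nuB_nil _).symm⟩
  | rinp a h T A =>
    refine ⟨[], _, _, .nil, (InG.rinp h (.const a.idx) T).ren' (NMap.wk []), (cl_nuB_nil _).symm,
      ?_⟩
    rw [Tm.wkN, ← Tm.fill_ren']
    refine Eq.trans ?_ (cl_nuB_nil _).symm
    simp only [Tm.fill, Tm.sub, Tm.wkV_inst]
  | out a h A T =>
    exact ⟨[], _, _, .nil, (OutG.out h (.const a.idx) A T).ren (NMap.wk []) (fun _ x => x),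
      by simp, (cl_nuB_nil _).symm, (cl_nuB_nil _).symm⟩
  | rout a h A T =>
    exact ⟨[], _, _, .nil, (OutG.rout h (.const a.idx) A T).ren (NMap.wk []) (fun _ x => x),
      by simp, (cl_nuB_nil _).symm, (cl_nuB_nil _).symm⟩
  | @res T T' l c _ hc ih =>
    cases l with
    | tau =>
      obtain ⟨d, s, τ, a, g, g', U, B, V, R, hg, hg', h1, h2⟩ := ih
      refine ⟨c.sort :: d, s, τ, _, _, _, _, _, _, R.ren (NMap.bindB c d) (fun _ x => x),
        hg.ren' (NMap.bindB c d), hg'.ren (NMap.bindB c d) (fun _ x => x), ?_, ?_⟩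
      · rw [cl_res h1, res_nuB]; rfl
      · rw [cl_res h2, res_nuB, ← Tm.fill_ren']; rfl
    | inp a A =>
      obtain ⟨d, g, U, R, hg, h1, h2⟩ := ih
      simp only [Act.names, Set.singleton_union, Set.mem_insert_iff, not_or] at hc
      have hg' := hg.ren' (NMap.bindB c d)
      rw [NMap.bindB_const (fun h : a = c => hc.1 h.symm)] at hg'
      refine ⟨c.sort :: d, _, _, R.ren (NMap.bindB c d) (fun _ x => x), hg', ?_, ?_⟩
      · rw [cl_res h1, res_nuB]; rfl
      · rw [cl_res h2, res_nuB, ← bindB_wkN A hc.2, ← Tm.fill_ren']; rfl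
    | out cs a B =>
      obtain ⟨d, g, V, R, hg, ha, h1, h2⟩ := ih
      simp only [Act.names, Set.mem_union, Set.mem_ofPred_eq, Set.mem_singleton_iff,
        not_or] at hc
      have hg' := hg.ren (NMap.bindB c d) (fun _ x => x)
      rw [NMap.bindB_const (fun h : a = c => hc.1.2 h.symm), bindB_wkN B hc.2] at hg'
      refine ⟨c.sort :: d, _, _, R.ren (NMap.bindB c d) (fun _ x => x), hg', ha, ?_, ?_⟩
      · rw [cl_res h1, cl_res_resList c cs hc.1.1, res_nuB]; rfl
      · rw [cl_res h2, res_nuB]; rfl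
  | opn c _ _ _ hca ih =>
    obtain ⟨d, g, V, R, hg, ha, h1, h2⟩ := ih
    exact ⟨d, g, V, R, hg, by simp [ha, hca.symm], cl_res h1, h2⟩
  | @par T T' l V _ hd ih =>
    cases l with
    | tau =>
      obtain ⟨d, s, τ, a, g, g', U, B, W, R, hg, hg', h1, h2⟩ := ih
      refine ⟨d, s, τ, a, g, g', U, B, W, .par R (V.wkN d), hg, hg', ?_, ?_⟩
      · rw [cl_par, h1, ← cl_nuB_par]
        exact nuB_eq (by simp only [cl_par]; abel)
      · rw [cl_par, h2, ← cl_nuB_par]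
        exact nuB_eq (by simp only [cl_par]; abel)
    | inp a A =>
      obtain ⟨d, g, U, R, hg, h1, h2⟩ := ih
      refine ⟨d, g, U, .par R (V.wkN d), hg, ?_, ?_⟩
      · rw [cl_par, h1, cl_nuB_par_par]
      · rw [cl_par, h2, cl_nuB_par_par]
    | out cs a B =>
      obtain ⟨d, g, W, R, hg, ha, h1, h2⟩ := ih
      refine ⟨d, g, W, .par R (V.wkN d), hg, ha, ?_, ?_⟩
      · rw [cl_par, h1, ← cl_resList_par _ _ hd]
        exact cl_resList (by rw [cl_nuB_par_par, cl_par])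
      · rw [cl_par, h2, cl_nuB_par_par]
  | comm _ _ hd ih ih' => exact InShape.tau ih ih' hd
  | @cong T T' V V' l h _ h' ih =>
    have h := cl_eq.2 h
    have h' := cl_eq.2 h'
    cases l with
    | tau =>
      obtain ⟨d, s, τ, a, g, g', U, B, W, R, hg, hg', h1, h2⟩ := ih
      exact ⟨d, s, τ, a, g, g', U, B, W, R, hg, hg', h.trans h1, h'.symm.trans h2⟩
    | inp a A =>
      obtain ⟨d, g, U, R, hg, h1, h2⟩ := ih
      exact ⟨d, g, U, R, hg, h.trans h1, h'.symm.trans h2⟩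
    | out cs a B =>
      obtain ⟨d, g, W, R, hg, ha, h1, h2⟩ := ih
      exact ⟨d, g, W, R, hg, ha, h.trans h1, h'.symm.trans h2⟩

/-- In the output clause of a bisimulation the extruded names can be put back among the other
restrictions of the source. -/
theorem OutShape.exists_nuB {P P' : Proc ob} {cs : List (NameConst S)} {a : NameConst S} {τ : Ty S}
    {B : Closed ob τ} (h : OutShape P cs a B P') :
    ∃ (d : List S) (g V R : Tm ob [d] [] .proc) (B' : Tm ob [d] [] τ),
      OutG g (.const a.idx : Nm [d] a.sort) B' V ∧ cl P = cl (nuB d (.par g R)) ∧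
      ∀ E : Ctx ob τ .proc, Disjoint {c | c ∈ cs} E.fn →
        cl (resList cs (.par (E.fill B) P'))
          = cl (nuB d (.par ((E.wkN d).fill B') (.par V R))) := by
  obtain ⟨d, g, V, R, hg, ha, hP, hP'⟩ := h
  obtain ⟨e, f, hfix, hf⟩ := resList_nuB (ob := ob) cs d
  have hg' := hg.ren f (fun _ x => x)
  rw [hfix a ha] at hg'
  refine ⟨e, _, _, R.ren f (fun _ x => x), _, hg', ?_, fun E hE => ?_⟩
  · rw [hP, hf]; rfl
  · have : cl (Tm.par (E.fill B) P')
        = cl (nuB d (.par (.par V R) ((E.fill B).wkN d))) := by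
      rw [cl_nuB_par, cl_par, hP', add_comm]
    rw [cl_resList this, hf]
    refine nuB_eq ?_
    simp only [Tm.ren, cl_par]
    rw [← Tm.wkN_ren_fixesOff hfix E hE, ← Tm.fill_ren']
    simp only [Tm.wkN, Tm.fill_ren']
    abel

/-! ### Transitions from shapes -/

theorem Tm.wkN_open {Γ : List (List (Ty S))} {τ : Ty S} {d : List S} (f : NMap [d] [])
    (hf : ∀ s n, f s (.const n) = .const n) (A : Tm ob [] Γ τ) :
    (A.wkN d).ren f (fun _ x => x) = A := by
  rw [Tm.wkN, Tm.ren_comp]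
  refine (A.ren_congr_closed fun c _ => ?_).trans A.ren_id
  exact hf _ _

theorem Step.tau_nuB {d : List S} {s : S} {τ : Ty S} {a : Nm [d] s} {g g' : Tm ob [d] [] .proc}
    {T : Tm ob [d] [[τ]] .proc} {B : Tm ob [d] [] τ} {V : Tm ob [d] [] .proc} (hg : InG g a T)
    (hg' : OutG g' a B V) (R : Tm ob [d] [] .proc) :
    Step (nuB d (.par g (.par g' R))) .tau (nuB d (.par (T.fill B) (.par V R))) := by
  obtain ⟨cs, f, -, hd, hf, h⟩ := exists_open (ob := ob) d
    ((Tm.fn_finite (.par g (.par g' R))).union (Tm.fn_finite (.par (T.fill B) (.par V R))))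
  rw [h _ (hd.mono_right Set.subset_union_left), h _ (hd.mono_right Set.subset_union_right)]
  refine Step.resList ?_ cs (by simp [Act.names])
  have h1 := hg.ren' f
  have h2 := hg'.ren f (fun _ x => x)
  obtain ⟨n, hn⟩ : ∃ n, f s a = .const n := by
    cases f s a with
    | const n => exact ⟨n, rfl⟩
    | var x => cases x
  rw [hn] at h1 h2
  have := (Step.comm (InG.step (a := ⟨s, n⟩) h1 _) (OutG.step (a := ⟨s, n⟩) h2) (by simp)).par'
    (R.ren f (fun _ x => x)) rfl
  refine this.congr ?_ ?_
  · simp only [Tm.ren, cl_par]; abel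
  · simp only [Tm.ren, cl_par, HO.resList, List.foldr, Tm.fill_ren']; abel

theorem Step.inp_nuB {d : List S} {a : NameConst S} {τ : Ty S} {g : Tm ob [d] [] .proc}
    {T : Tm ob [d] [[τ]] .proc} (hg : InG g (.const a.idx : Nm [d] a.sort) T)
    (R : Tm ob [d] [] .proc) (A : Closed ob τ) :
    Step (nuB d (.par g R)) (.inp a A) (nuB d (.par (T.fill (A.wkN d)) R)) := by
  obtain ⟨cs, f, -, hd, hf, h⟩ := exists_open (ob := ob) d
    (((Tm.fn_finite (.par g R)).union (Tm.fn_finite (.par (T.fill (A.wkN d)) R))).union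
      ((Set.finite_singleton a).union A.fn_finite))
  rw [h _ (hd.mono_right (by grind)), h _ (hd.mono_right (by grind))]
  refine Step.resList ?_ cs (hd.mono_right Set.subset_union_right)
  have h1 := hg.ren' f
  rw [hf] at h1
  have := (InG.step h1 A).par' (R.ren f (fun _ x => x)) rfl
  simp only [Tm.ren, Tm.fill_ren', Tm.wkN_open f hf]
  exact this

/-- A term structurally congruent to `B` in which a given constant occurs: an abstraction applied to
an instance which it discards. -/
def Tm.pad {Δ : List (List S)} {Γ : List (List (Ty S))} {τ : Ty S} (B : Tm ob Δ Γ τ)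
    (c : NameConst S) : Tm ob Δ Γ τ :=
  .papp (.pabs (B.wkV [.proc])) (one (.inp rfl (.const c.idx : Nm Δ c.sort) .nil))

theorem Tm.cl_pad {Δ : List (List S)} {Γ : List (List (Ty S))} {τ : Ty S} (B : Tm ob Δ Γ τ)
    (c : NameConst S) : cl (B.pad c) = cl B := by
  rw [Tm.pad, cl_eq.2 (Cong.pbeta _ _), Tm.wkV_inst]

theorem Nm.mem_fn_ren {Δ Δ' : List (List S)} {s : S} (a : Nm Δ s) (f : NMap Δ Δ')
    (hf : ∀ s n, f s (.const n) = .const n) : a.fn ⊆ (f s a).fn := by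
  cases a with
  | const n => rw [hf]; rfl
  | var x => exact Set.empty_subset _

theorem Tm.fn_subset_ren {Δ : List (List S)} {Γ : List (List (Ty S))} {τ : Ty S}
    (T : Tm ob Δ Γ τ) : ∀ {Δ' : List (List S)} {Γ' : List (List (Ty S))} (f : NMap Δ Δ')
      (g : VMap Γ Γ'), (∀ s n, f s (.const n) = .const n) → T.fn ⊆ (T.ren f g).fn := by
  have up : ∀ {Δ Δ' : List (List S)} (d : List S) (f : NMap Δ Δ'),
      (∀ s n, f s (.const n) = .const n) → (∀ s n, f.up d s (.const n) = .const n) := by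
    intro _ _ d f h s n
    rw [NMap.up_const, h]; rfl
  induction T with
  | nil => intros; exact Set.empty_subset _
  | var x => intros; exact Set.empty_subset _
  | inp h a T ih =>
    intro _ _ f g hf
    exact Set.union_subset_union (a.mem_fn_ren f hf) (ih f _ hf)
  | rinp h a T ih =>
    intro _ _ f g hf
    exact Set.union_subset_union (a.mem_fn_ren f hf) (ih f _ hf)
  | out h a A T ih ih' =>
    intro _ _ f g hf
    exact Set.union_subset_union (Set.union_subset_union (a.mem_fn_ren f hf) (ih f _ hf))
      (ih' f _ hf)
  | rout h a A T ih ih' =>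
    intro _ _ f g hf
    exact Set.union_subset_union (Set.union_subset_union (a.mem_fn_ren f hf) (ih f _ hf))
      (ih' f _ hf)
  | par A T ih ih' =>
    intro _ _ f g hf
    exact Set.union_subset_union (ih f _ hf) (ih' f _ hf)
  | nu s T ih => intro _ _ f g hf; exact ih _ _ (up _ f hf)
  | pabs T ih => intro _ _ f g hf; exact ih _ _ hf
  | nabs T ih => intro _ _ f g hf; exact ih _ _ (up _ f hf)
  | papp F K ih ih' =>
    intro _ _ f g hf
    exact Set.union_subset_union (ih f _ hf)
      (Set.iUnion₂_mono fun τ x => ih' τ x f _ hf)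
  | napp F K ih =>
    intro _ _ f g hf
    exact Set.union_subset_union (ih f _ hf)
      (Set.iUnion₂_mono fun τ x => Nm.mem_fn_ren _ f hf)

/-- A term structurally congruent to `B` in which given constants occur. -/
theorem Tm.exists_pad {τ : Ty S} (B : Closed ob τ) (cs : List (NameConst S)) :
    ∃ B' : Closed ob τ, cl B' = cl B ∧ ∀ c ∈ cs, c ∈ B'.fn := by
  induction cs with
  | nil => exact ⟨B, rfl, by simp⟩
  | cons c cs ih =>
    obtain ⟨B', h, h'⟩ := ih
    refine ⟨B'.pad c, (B'.cl_pad c).trans h, fun b hb => ?_⟩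
    rcases List.mem_cons.1 hb with rfl | hb
    · refine .inr (Set.mem_iUnion.2 ⟨.proc, Set.mem_iUnion.2 ⟨.zero, .inl ?_⟩⟩)
      exact rfl
    · refine .inl (Tm.fn_subset_ren B' (fun _ a => a) (fun _ x => .there x) (fun _ _ => rfl) ?_)
      exact h' b hb

theorem Step.opnList {P P' : Proc ob} {a : NameConst S} {τ : Ty S} {B : Closed ob τ}
    (h : Step P (.out [] a B) P') (cs : List (NameConst S)) (hn : cs.Nodup) (ha : a ∉ cs)
    (hB : ∀ c ∈ cs, c ∈ B.fn) : Step (HO.resList cs P) (.out cs a B) P' := by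
  induction cs with
  | nil => exact h
  | cons c cs ih =>
    simp only [List.nodup_cons, List.mem_cons, not_or] at hn ha
    exact .opn c (ih hn.2 ha.2 fun b hb => hB b (List.mem_cons_of_mem _ hb))
      (hB c (by simp)) hn.1 (fun h => ha.1 h.symm)

theorem Tm.fn_wk_subset {Δ Δ' : List (List S)} {Γ Γ' : List (List (Ty S))} {τ : Ty S}
    (T : Tm ob Δ Γ τ) (f : NMap Δ Δ') (g : VMap Γ Γ') (hf : ∀ s a, (f s a).fn ⊆ a.fn) :
    (T.ren f g).fn ⊆ T.fn :=
  (T.fn_ren_subset ∅ f g fun s a => (hf s a).trans Set.subset_union_left).trans (by simp)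

theorem Tm.fn_sub_subset {Δ : List (List S)} {Γ : List (List (Ty S))} {τ : Ty S}
    (T : Tm ob Δ Γ τ) (G : Set (NameConst S)) :
    ∀ {Γ' : List (List (Ty S))} (σ : Sub ob Δ Γ Γ'),
      (∀ τ x, (σ τ x).fn ⊆ G) → (T.sub σ).fn ⊆ T.fn ∪ G := by
  have upV : ∀ {Δ : List (List S)} {Γ Γ' : List (List (Ty S))} (d : List (Ty S))
      (σ : Sub ob Δ Γ Γ'), (∀ τ x, (σ τ x).fn ⊆ G) → ∀ τ x, (σ.upV d τ x).fn ⊆ G := by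
    intro _ _ _ d σ h τ x
    cases x with
    | here x => exact Set.empty_subset _
    | there x => exact (Tm.fn_wk_subset _ _ _ fun s a => subset_rfl).trans (h τ x)
  have upN : ∀ {Δ : List (List S)} {Γ Γ' : List (List (Ty S))} (d : List S)
      (σ : Sub ob Δ Γ Γ'), (∀ τ x, (σ τ x).fn ⊆ G) → ∀ τ x, (σ.upN d τ x).fn ⊆ G := by
    intro _ _ _ d σ h τ x
    exact (Tm.fn_wk_subset _ _ _ fun s a => (Nm.fn_wk d a).subset).trans (h τ x)
  induction T with
  | nil => intro _ _ _; exact Set.empty_subset _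
  | var x => intro _ _ h; exact (h _ x).trans Set.subset_union_right
  | inp h a T ih =>
    intro _ σ hσ
    have h2 := ih (σ.upV _) (upV _ σ hσ)
    simp only [Tm.sub, Tm.fn]
    grind
  | rinp h a T ih =>
    intro _ σ hσ
    have h2 := ih (σ.upV _) (upV _ σ hσ)
    simp only [Tm.sub, Tm.fn]
    grind
  | out h a A T ih ih' =>
    intro _ σ hσ
    have h2 := ih σ hσ
    have h3 := ih' σ hσ
    simp only [Tm.sub, Tm.fn]
    grind
  | rout h a A T ih ih' =>
    intro _ σ hσ
    have h2 := ih σ hσ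
    have h3 := ih' σ hσ
    simp only [Tm.sub, Tm.fn]
    grind
  | par A T ih ih' =>
    intro _ σ hσ
    have h2 := ih σ hσ
    have h3 := ih' σ hσ
    simp only [Tm.sub, Tm.fn]
    grind
  | nu s T ih => intro _ σ hσ; exact ih _ (upN _ σ hσ)
  | pabs T ih => intro _ σ hσ; exact ih _ (upV _ σ hσ)
  | nabs T ih => intro _ σ hσ; exact ih _ (upN _ σ hσ)
  | papp F K ih ih' =>
    intro _ σ hσ
    have h1 := ih σ hσ
    simp only [Tm.sub, Tm.fn]
    refine Set.union_subset (h1.trans (by grind)) (Set.iUnion₂_subset fun τ x => ?_)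
    refine (ih' τ x σ hσ).trans (Set.union_subset_union_left _ ?_)
    exact (Set.subset_iUnion₂ (s := fun τ x => (K τ x).fn) τ x).trans Set.subset_union_right
  | napp F K ih =>
    intro _ σ hσ
    have h1 := ih σ hσ
    simp only [Tm.sub, Tm.fn]
    grind

/-- An output can extrude all restricted names, because every name occurs in a suitable
representative of the emitted agent. -/
theorem Step.out_nuB {d : List S} {a : NameConst S} {τ : Ty S} {g V : Tm ob [d] [] .proc}
    {B : Tm ob [d] [] τ} (hg : OutG g (.const a.idx : Nm [d] a.sort) B V)
    (R : Tm ob [d] [] .proc) :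
    ∃ (cs : List (NameConst S)) (B' : Closed ob τ) (P' : Proc ob),
      Step (nuB d (.par g R)) (.out cs a B') P' ∧
      ∀ E : Ctx ob τ .proc, Disjoint {c | c ∈ cs} E.fn →
        cl (HO.resList cs (.par (E.fill B') P'))
          = cl (nuB d (.par ((E.wkN d).fill B) (.par V R))) := by
  obtain ⟨cs, f, hn, hd, hf, h⟩ := exists_open (ob := ob) d
    (((Tm.fn_finite (.par g R)).union ((Tm.fn_finite (.par V R)).union B.fn_finite)).union
      (Set.finite_singleton a))
  obtain ⟨B', hB', hcs⟩ := Tm.exists_pad (B.ren f (fun _ x => x)) cs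
  have ha : a ∉ cs := fun h' => Set.disjoint_left.1 hd h' (by simp)
  refine ⟨cs, B', (Tm.par V R).ren f (fun _ x => x), ?_, fun E hE => ?_⟩
  · rw [h _ (hd.mono_right (by grind))]
    refine Step.opnList ?_ cs hn ha hcs
    have h1 := hg.ren f (fun _ x => x)
    rw [hf] at h1
    obtain ⟨s, n⟩ := a
    -- the emitted agent is replaced by its padded representative inside the prefix
    cases hg with
    | out hs a B V =>
      simp only [Tm.ren, hf] at h1 ⊢
      refine ((Step.out ⟨s, n⟩ hs B' (V.ren f (fun _ x => x))).par'
        (R.ren f (fun _ x => x)) (by simp [Act.bn])).congr ?_ rfl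
      rw [cl_par, cl_par]
      congr 1
      exact cl_eq.2 (.out _ _ (cl_eq.1 hB'.symm) (.refl _))
    | rout hs a B V =>
      simp only [Tm.ren, hf] at h1 ⊢
      have e : cl (Tm.rout hs (.const n : Nm [] s) (B.ren f (fun _ x => x))
          (V.ren f (fun _ x => x))) = cl (.rout hs (.const n) B' (V.ren f (fun _ x => x))) :=
        cl_eq.2 (.rout _ _ (cl_eq.1 hB'.symm) (.refl _))
      refine ((Step.rout ⟨s, n⟩ hs B' (V.ren f (fun _ x => x))).par'
        (R.ren f (fun _ x => x)) (by simp [Act.bn])).congr ?_ ?_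
      · rw [cl_par, cl_par, e]
      · simp only [cl_par, e]
  · rw [h]
    · refine cl_resList ?_
      simp only [Tm.ren, cl_par, Tm.fill_ren', Tm.wkN_open f hf]
      rw [cl_fill rfl hB']
    · have h1 : Disjoint {c | c ∈ cs} (Tm.fn (.par V R)) := hd.mono_right (by grind)
      have h2 : ((E.wkN d).fill B).fn ⊆ E.fn ∪ B.fn := by
        refine (Tm.fn_sub_subset _ B.fn _ ?_).trans (Set.union_subset_union_left _ ?_)
        · intro τ x
          rcases x with x | x
          · rcases x with _ | x
            · exact subset_rfl
            · cases x
          · exact Set.empty_subset _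
        · refine (E.fn_ren_subset ∅ _ _ fun s a => ?_).trans (by simp)
          rw [Nm.fn_wk]; simp
      have h3 : Disjoint {c | c ∈ cs} B.fn := hd.mono_right (by grind)
      exact ((hE.union_right h3).mono_right h2).union_right h1

/-! ### A logical relation for structural congruence -/

/-- Induction on types, with the hypothesis for all parameter types of an abstraction. -/
theorem Ty.induction {P : Ty S → Prop} (proc : P .proc)
    (pabs : ∀ d ds ρ, (∀ τ, Pos (d :: ds) τ → P τ) → P ρ → P (.pabs d ds ρ))
    (nabs : ∀ t ts ρ, P ρ → P (.nabs t ts ρ)) : ∀ τ, P τ := by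
  have pos : ∀ {l : List (Ty S)} {τ : Ty S}, Pos l τ → sizeOf τ < sizeOf l := by
    intro l τ x
    induction x with
    | zero => simp; omega
    | succ x ih => simp; omega
  intro τ
  induction h : sizeOf τ using Nat.strong_induction_on generalizing τ with
  | _ n ih =>
    subst h
    cases τ with
    | proc => exact proc
    | pabs d ds ρ =>
      refine pabs d ds ρ (fun τ x => ih _ ?_ τ rfl) (ih _ ?_ ρ rfl)
      · have := pos x
        simp at this ⊢; omega
      · simp
    | nabs t ts ρ => exact nabs t ts ρ (ih _ (by simp) ρ rfl)

theorem Pos.sizeOf_lt {l : List (Ty S)} {τ : Ty S} (x : Pos l τ) : sizeOf τ < sizeOf l := by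
  induction x with
  | zero => simp; omega
  | succ x ih => simp; omega

/-- Head reduction. -/
inductive Head : ∀ {Δ : List (List S)} {Γ : List (List (Ty S))} {τ : Ty S},
    Tm ob Δ Γ τ → Tm ob Δ Γ τ → Prop
  | pbeta {Δ Γ d ds ρ} (T : Tm ob Δ ((d :: ds) :: Γ) ρ)
      (K : ∀ τ, Pos (d :: ds) τ → Tm ob Δ Γ τ) : Head (.papp (.pabs T) K) (T.sub (Sub.inst K))
  | nbeta {Δ Γ t ts ρ} (T : Tm ob ((t :: ts) :: Δ) Γ ρ) (K : ∀ s, Pos (t :: ts) s → Nm Δ s) :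
      Head (.napp (.nabs T) K) (T.ren (NMap.inst K) (fun _ x => x))
  | papp {Δ Γ d ds ρ} {F F' : Tm ob Δ Γ (.pabs d ds ρ)}
      (K : ∀ τ, Pos (d :: ds) τ → Tm ob Δ Γ τ) : Head F F' → Head (.papp F K) (.papp F' K)
  | napp {Δ Γ t ts ρ} {F F' : Tm ob Δ Γ (.nabs t ts ρ)} (K : ∀ s, Pos (t :: ts) s → Nm Δ s) :
      Head F F' → Head (.napp F K) (.napp F' K)

theorem Head.cong {Δ : List (List S)} {Γ : List (List (Ty S))} {τ : Ty S} {T T' : Tm ob Δ Γ τ}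
    (h : Head T T') : Cong T T' := by
  induction h with
  | pbeta T K => exact .pbeta T K
  | nbeta T K => exact .nbeta T K
  | papp K _ ih => exact .papp ih fun _ _ => .refl _
  | napp K _ ih => exact .napp K ih

theorem Head.ren {Δ : List (List S)} {Γ : List (List (Ty S))} {τ : Ty S} {T T' : Tm ob Δ Γ τ}
    (h : Head T T') : ∀ {Δ' : List (List S)} (f : NMap Δ Δ'),
      Head (T.ren f (fun _ x => x)) (T'.ren f (fun _ x => x)) := by
  induction h with
  | pbeta T K => intro _ f; rw [Sub.inst_ren]; exact .pbeta _ _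
  | nbeta T K => intro _ f; rw [NMap.inst_ren]; exact .nbeta _ _
  | papp K _ ih => intro _ f; exact .papp _ (ih f)
  | napp K _ ih => intro _ f; exact .napp _ (ih f)

/-- A partial equivalence on processes over the variables `Γ` that respects the process
constructors, the laws of parallel composition and restriction, and head expansion.  Prefixed
processes are related as soon as their constituents are structurally congruent. -/
structure Base (ob : S → Ty S) (Γ : List (List (Ty S))) where
  /-- The relation. -/
  rel : ∀ {Δ : List (List S)}, Tm ob Δ Γ .proc → Tm ob Δ Γ .proc → Prop
  symm : ∀ {Δ} {T V : Tm ob Δ Γ .proc}, rel T V → rel V T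
  trans : ∀ {Δ} {T V W : Tm ob Δ Γ .proc}, rel T V → rel V W → rel T W
  ren : ∀ {Δ Δ'} {T V : Tm ob Δ Γ .proc} (f : NMap Δ Δ'), rel T V →
    rel (T.ren f (fun _ x => x)) (V.ren f (fun _ x => x))
  head : ∀ {Δ} {T T' V : Tm ob Δ Γ .proc}, Head T T' → rel T' V → rel T V
  nil : ∀ {Δ}, rel (.nil : Tm ob Δ Γ .proc) .nil
  par : ∀ {Δ} {T T' V V' : Tm ob Δ Γ .proc}, rel T T' → rel V V' → rel (.par T V) (.par T' V')
  parNil : ∀ {Δ} {T : Tm ob Δ Γ .proc}, rel T T → rel (.par T .nil) T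
  parComm : ∀ {Δ} {T V : Tm ob Δ Γ .proc}, rel T T → rel V V → rel (.par T V) (.par V T)
  parAssoc : ∀ {Δ} {T V W : Tm ob Δ Γ .proc}, rel T T → rel V V → rel W W →
    rel (.par (.par T V) W) (.par T (.par V W))
  nu : ∀ {Δ} (s : S) {T T' : Tm ob ([s] :: Δ) Γ .proc}, rel T T' → rel (.nu s T) (.nu s T')
  nuComm : ∀ {Δ} (s t : S) {T : Tm ob ([t] :: [s] :: Δ) Γ .proc}, rel T T →
    rel (.nu s (.nu t T)) (.nu t (.nu s (T.ren (NMap.swap s t) (fun _ x => x))))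
  nuPar : ∀ {Δ} (s : S) {T : Tm ob ([s] :: Δ) Γ .proc} {V : Tm ob Δ Γ .proc}, rel T T → rel V V →
    rel (.nu s (.par T (V.wkN [s]))) (.par (.nu s T) V)
  inp : ∀ {Δ s τ} (h : ob s = τ) (a : Nm Δ s) {T T' : Tm ob Δ ([τ] :: Γ) .proc}, Cong T T' →
    rel (.inp h a T) (.inp h a T')
  rinp : ∀ {Δ s τ} (h : ob s = τ) (a : Nm Δ s) {T T' : Tm ob Δ ([τ] :: Γ) .proc}, Cong T T' →
    rel (.rinp h a T) (.rinp h a T')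
  out : ∀ {Δ s τ} (h : ob s = τ) (a : Nm Δ s) {A A' : Tm ob Δ Γ τ} {T T' : Tm ob Δ Γ .proc},
    Cong A A' → Cong T T' → rel (.out h a A T) (.out h a A' T')
  rout : ∀ {Δ s τ} (h : ob s = τ) (a : Nm Δ s) {A A' : Tm ob Δ Γ τ} {T T' : Tm ob Δ Γ .proc},
    Cong A A' → Cong T T' → rel (.rout h a A T) (.rout h a A' T')

variable {Γ : List (List (Ty S))}

/-- The logical relation over a base relation on processes: related abstractions give related
results on related instances, also after a renaming of names. -/
def Base.L (B : Base ob Γ) : ∀ (τ : Ty S) {Δ : List (List S)}, Tm ob Δ Γ τ → Tm ob Δ Γ τ → Prop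
  | .proc, _, T, V => Cong T V ∧ B.rel T V
  | .pabs d ds ρ, Δ, F, G => Cong F G ∧
      ∀ (Δ' : List (List S)) (f : NMap Δ Δ') (K K' : ∀ τ, Pos (d :: ds) τ → Tm ob Δ' Γ τ),
        (∀ τ (x : Pos (d :: ds) τ), Base.L B τ (K τ x) (K' τ x)) →
        Base.L B ρ (.papp (F.ren f (fun _ x => x)) K) (.papp (G.ren f (fun _ x => x)) K')
  | .nabs t ts ρ, Δ, F, G => Cong F G ∧
      ∀ (Δ' : List (List S)) (f : NMap Δ Δ') (K : ∀ s, Pos (t :: ts) s → Nm Δ' s),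
        Base.L B ρ (.napp (F.ren f (fun _ x => x)) K) (.napp (G.ren f (fun _ x => x)) K)
termination_by τ => sizeOf τ
decreasing_by
  · have := x.sizeOf_lt
    simp at this ⊢; omega
  · simp
  · simp

variable (B : Base ob Γ)

theorem Base.L_proc {Δ : List (List S)} {T V : Tm ob Δ Γ .proc} :
    B.L .proc T V ↔ Cong T V ∧ B.rel T V := by
  rw [Base.L]

theorem Base.L_pabs {Δ : List (List S)} {d : Ty S} {ds : List (Ty S)} {ρ : Ty S}
    {F G : Tm ob Δ Γ (.pabs d ds ρ)} :
    B.L (.pabs d ds ρ) F G ↔ Cong F G ∧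
      ∀ (Δ' : List (List S)) (f : NMap Δ Δ') (K K' : ∀ τ, Pos (d :: ds) τ → Tm ob Δ' Γ τ),
        (∀ τ (x : Pos (d :: ds) τ), B.L τ (K τ x) (K' τ x)) →
        B.L ρ (.papp (F.ren f (fun _ x => x)) K) (.papp (G.ren f (fun _ x => x)) K') := by
  rw [Base.L]

theorem Base.L_nabs {Δ : List (List S)} {t : S} {ts : List S} {ρ : Ty S}
    {F G : Tm ob Δ Γ (.nabs t ts ρ)} :
    B.L (.nabs t ts ρ) F G ↔ Cong F G ∧
      ∀ (Δ' : List (List S)) (f : NMap Δ Δ') (K : ∀ s, Pos (t :: ts) s → Nm Δ' s),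
        B.L ρ (.napp (F.ren f (fun _ x => x)) K) (.napp (G.ren f (fun _ x => x)) K) := by
  rw [Base.L]

variable {B}

theorem Base.L.cong {τ : Ty S} {Δ : List (List S)} {T V : Tm ob Δ Γ τ} (h : B.L τ T V) :
    Cong T V := by
  cases τ with
  | proc => exact (B.L_proc.1 h).1
  | pabs d ds ρ => exact (B.L_pabs.1 h).1
  | nabs t ts ρ => exact (B.L_nabs.1 h).1

theorem Base.L.symm {τ : Ty S} : ∀ {Δ : List (List S)} {T V : Tm ob Δ Γ τ},
    B.L τ T V → B.L τ V T := by
  induction τ using Ty.induction with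
  | proc => intro _ T V h; rw [B.L_proc] at h ⊢; exact ⟨h.1.symm, B.symm h.2⟩
  | pabs d ds ρ ih ih' =>
    intro _ T V h
    rw [B.L_pabs] at h ⊢
    exact ⟨h.1.symm, fun Δ' f K K' hK => ih' (h.2 Δ' f K' K fun τ x => ih τ x (hK τ x))⟩
  | nabs t ts ρ ih =>
    intro _ T V h
    rw [B.L_nabs] at h ⊢
    exact ⟨h.1.symm, fun Δ' f K => ih (h.2 Δ' f K)⟩

theorem Base.L.trans {τ : Ty S} : ∀ {Δ : List (List S)} {T V W : Tm ob Δ Γ τ},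
    B.L τ T V → B.L τ V W → B.L τ T W := by
  induction τ using Ty.induction with
  | proc =>
    intro _ T V W h h'
    rw [B.L_proc] at h h' ⊢
    exact ⟨h.1.trans h'.1, B.trans h.2 h'.2⟩
  | pabs d ds ρ ih ih' =>
    intro _ T V W h h'
    rw [B.L_pabs] at h h' ⊢
    refine ⟨h.1.trans h'.1, fun Δ' f K K' hK => ih' (h.2 Δ' f K K' hK) (h'.2 Δ' f K' K' ?_)⟩
    exact fun τ x => ih τ x (hK τ x).symm (hK τ x)
  | nabs t ts ρ ih =>
    intro _ T V W h h'
    rw [B.L_nabs] at h h' ⊢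
    exact ⟨h.1.trans h'.1, fun Δ' f K => ih (h.2 Δ' f K) (h'.2 Δ' f K)⟩

theorem Base.L.ren {τ : Ty S} {Δ Δ' : List (List S)} {T V : Tm ob Δ Γ τ} (h : B.L τ T V)
    (f : NMap Δ Δ') : B.L τ (T.ren f (fun _ x => x)) (V.ren f (fun _ x => x)) := by
  cases τ with
  | proc => rw [B.L_proc] at h ⊢; exact ⟨h.1.ren _ _, B.ren f h.2⟩
  | pabs d ds ρ =>
    rw [B.L_pabs] at h ⊢
    refine ⟨h.1.ren _ _, fun Δ'' f' K K' hK => ?_⟩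
    rw [Tm.ren_comp, Tm.ren_comp]
    exact h.2 _ _ _ _ hK
  | nabs t ts ρ =>
    rw [B.L_nabs] at h ⊢
    refine ⟨h.1.ren _ _, fun Δ'' f' K => ?_⟩
    rw [Tm.ren_comp, Tm.ren_comp]
    exact h.2 _ _ _

/-- Head expansion at process type implies head expansion at all types, since a head reduction of
a function is one of its applications. -/
theorem Base.L.head {τ : Ty S} : ∀ {Δ : List (List S)} {T T' V : Tm ob Δ Γ τ},
    Head T T' → B.L τ T' V → B.L τ T V := by
  induction τ using Ty.induction with
  | proc =>
    intro _ T T' V hh h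
    rw [B.L_proc] at h ⊢
    exact ⟨hh.cong.trans h.1, B.head hh h.2⟩
  | pabs d ds ρ ih ih' =>
    intro _ T T' V hh h
    rw [B.L_pabs] at h ⊢
    exact ⟨hh.cong.trans h.1, fun Δ' f K K' hK => ih' (.papp K (hh.ren f)) (h.2 Δ' f K K' hK)⟩
  | nabs t ts ρ ih =>
    intro _ T T' V hh h
    rw [B.L_nabs] at h ⊢
    exact ⟨hh.cong.trans h.1, fun Δ' f K => ih (.napp K (hh.ren f)) (h.2 Δ' f K)⟩

theorem Base.L.head₂ {τ : Ty S} {Δ : List (List S)} {T T' V V' : Tm ob Δ Γ τ}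
    (hT : Head T T') (hV : Head V V') (h : B.L τ T' V') : B.L τ T V :=
  .head hT (.symm (.head hV h.symm))

/-- Extension of a substitution by a tuple of agents. -/
def Sub.cons {Δ : List (List S)} {Γ Γ' : List (List (Ty S))} {d : List (Ty S)}
    (K : ∀ τ, Pos d τ → Tm ob Δ Γ' τ) (σ : Sub ob Δ Γ Γ') : Sub ob Δ (d :: Γ) Γ'
  | τ, .here x => K τ x
  | τ, .there x => σ τ x

theorem Sub.upV_inst {Δ Δ' Δ'' : List (List S)} {Γ Γ' : List (List (Ty S))} {d : List (Ty S)}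
    {ρ : Ty S} (T : Tm ob Δ (d :: Γ) ρ) (f : NMap Δ Δ') (σ : Sub ob Δ' Γ Γ') (f' : NMap Δ' Δ'')
    (K : ∀ τ, Pos d τ → Tm ob Δ'' Γ' τ) :
    (((T.ren f (fun _ x => x)).sub (σ.upV d)).ren f' (fun _ x => x)).sub (Sub.inst K)
      = (T.ren (f.comp f') (fun _ x => x)).sub
          (Sub.cons K fun τ x => (σ τ x).ren f' (fun _ x => x)) := by
  rw [Tm.sub_ren, Tm.sub_sub, Tm.ren_comp]
  congr 1
  funext τ x
  cases x with
  | here x => rfl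
  | there x =>
    simp only [Sub.upV, Sub.cons]
    rw [← Tm.wkV_inst ((σ τ x).ren f' (fun _ x => x)) K, ← Tm.wkV_ren, VMap.up_id']

theorem Sub.upN_inst {Δ Δ' Δ'' : List (List S)} {Γ Γ' : List (List (Ty S))} {d : List S}
    {ρ : Ty S} (T : Tm ob (d :: Δ) Γ ρ) (f : NMap Δ Δ') (σ : Sub ob Δ' Γ Γ') (f' : NMap Δ' Δ'')
    (K : ∀ s, Pos d s → Nm Δ'' s) :
    (((T.ren (f.up d) (fun _ x => x)).sub (σ.upN d)).ren (f'.up d) (fun _ x => x)).ren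
        (NMap.inst K) (fun _ x => x)
      = (T.ren (((f.up d).comp (f'.up d)).comp (NMap.inst K)) (fun _ x => x)).sub
          (fun τ x => (σ τ x).ren f' (fun _ x => x)) := by
  rw [Tm.sub_ren, Tm.sub_ren, Tm.ren_comp, Tm.ren_comp]
  congr 1
  funext τ x
  simp only [Sub.upN, Tm.wkN, Tm.ren_comp]
  congr 1
  funext s a; simp

theorem Tm.swap_ren_sub {Δ Δ' : List (List S)} {Γ Γ' : List (List (Ty S))} {s t : S}
    (T : Tm ob ([t] :: [s] :: Δ) Γ .proc) (f : NMap Δ Δ') (σ : Sub ob Δ' Γ Γ') :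
    ((T.ren (NMap.swap s t) (fun _ x => x)).ren ((f.up [t]).up [s]) (fun _ x => x)).sub
        ((σ.upN [t]).upN [s])
      = ((T.ren ((f.up [s]).up [t]) (fun _ x => x)).sub ((σ.upN [s]).upN [t])).ren
          (NMap.swap s t) (fun _ x => x) := by
  rw [Tm.sub_ren, Tm.ren_comp, Tm.ren_comp, NMap.swap_up]
  congr 1
  funext τ x
  simp only [Sub.upN, Tm.wkN, Tm.ren_comp]
  congr 1
  funext r a; simp

theorem Base.L.cons {Γ' : List (List (Ty S))} {Δ : List (List S)} {d : List (Ty S)}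
    {K K' : ∀ τ, Pos d τ → Tm ob Δ Γ τ} {σ σ' : Sub ob Δ Γ' Γ}
    (hK : ∀ τ x, B.L τ (K τ x) (K' τ x)) (hσ : ∀ τ x, B.L τ (σ τ x) (σ' τ x)) (τ : Ty S)
    (x : Var (d :: Γ') τ) : B.L τ (Sub.cons K σ τ x) (Sub.cons K' σ' τ x) := by
  cases x with
  | here x => exact hK τ x
  | there x => exact hσ τ x

/-- Every term is related to itself under related substitutions. -/
theorem Base.L.refl_sub {Γ' : List (List (Ty S))} {Δ : List (List S)} {τ : Ty S}
    (T : Tm ob Δ Γ' τ) : ∀ {Δ' : List (List S)} (f : NMap Δ Δ') (σ σ' : Sub ob Δ' Γ' Γ),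
      (∀ τ x, B.L τ (σ τ x) (σ' τ x)) →
      B.L τ ((T.ren f (fun _ x => x)).sub σ) ((T.ren f (fun _ x => x)).sub σ') := by
  have key : ∀ {Γ' : List (List (Ty S))} {Δ Δ' : List (List S)} {τ : Ty S} (T : Tm ob Δ Γ' τ)
      (f : NMap Δ Δ') (σ σ' : Sub ob Δ' Γ' Γ), (∀ τ x, B.L τ (σ τ x) (σ' τ x)) →
      Cong ((T.ren f (fun _ x => x)).sub σ) ((T.ren f (fun _ x => x)).sub σ') :=
    fun T f σ σ' hσ => Cong.sub_right _ fun τ x => (hσ τ x).cong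
  have keyV : ∀ {Γ' : List (List (Ty S))} {Δ Δ' : List (List S)} {d : List (Ty S)} {τ : Ty S}
      (T : Tm ob Δ (d :: Γ') τ)
      (f : NMap Δ Δ') (σ σ' : Sub ob Δ' Γ' Γ), (∀ τ x, B.L τ (σ τ x) (σ' τ x)) →
      Cong ((T.ren f (VMap.up (fun _ x => x) d)).sub (σ.upV d))
        ((T.ren f (VMap.up (fun _ x => x) d)).sub (σ'.upV d)) := by
    intro Γ' Δ Δ' d τ T f σ σ' hσ
    refine Cong.sub_right _ fun τ x => ?_
    cases x with
    | here x => exact .refl _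
    | there x => exact (hσ τ x).cong.ren _ _
  induction T with
  | nil => intros; exact B.L_proc.2 ⟨.refl _, B.nil⟩
  | var x => intro _ f σ σ' hσ; exact hσ _ x
  | inp h a T ih =>
    intro _ f σ σ' hσ
    exact B.L_proc.2 ⟨key _ f σ σ' hσ, B.inp _ _ (keyV T f σ σ' hσ)⟩
  | rinp h a T ih =>
    intro _ f σ σ' hσ
    exact B.L_proc.2 ⟨key _ f σ σ' hσ, B.rinp _ _ (keyV T f σ σ' hσ)⟩
  | out h a A T ih ih' =>
    intro _ f σ σ' hσ
    exact B.L_proc.2 ⟨key _ f σ σ' hσ, B.out _ _ (key A f σ σ' hσ) (key T f σ σ' hσ)⟩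
  | rout h a A T ih ih' =>
    intro _ f σ σ' hσ
    exact B.L_proc.2 ⟨key _ f σ σ' hσ, B.rout _ _ (key A f σ σ' hσ) (key T f σ σ' hσ)⟩
  | par A T ih ih' =>
    intro _ f σ σ' hσ
    exact B.L_proc.2 ⟨key (.par A T) f σ σ' hσ,
      B.par (B.L_proc.1 (ih f σ σ' hσ)).2 (B.L_proc.1 (ih' f σ σ' hσ)).2⟩
  | nu s T ih =>
    intro _ f σ σ' hσ
    exact B.L_proc.2 ⟨key (.nu s T) f σ σ' hσ, B.nu s (B.L_proc.1
      (ih (f.up [s]) (σ.upN [s]) (σ'.upN [s]) fun τ x => (hσ τ x).ren _)).2⟩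
  | pabs T ih =>
    intro _ f σ σ' hσ
    refine B.L_pabs.2 ⟨key (.pabs T) f σ σ' hσ, fun Δ'' f' K K' hK => ?_⟩
    simp only [Tm.ren, Tm.sub, VMap.up_id']
    refine .head₂ (.pbeta _ _) (.pbeta _ _) ?_
    rw [Sub.upV_inst, Sub.upV_inst]
    exact ih _ _ _ (.cons hK fun τ x => (hσ τ x).ren f')
  | nabs T ih =>
    intro _ f σ σ' hσ
    refine B.L_nabs.2 ⟨key (.nabs T) f σ σ' hσ, fun Δ'' f' K => ?_⟩
    simp only [Tm.ren, Tm.sub]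
    refine .head₂ (.nbeta _ _) (.nbeta _ _) ?_
    rw [Sub.upN_inst, Sub.upN_inst]
    exact ih _ _ _ fun τ x => (hσ τ x).ren f'
  | papp F K ih ih' =>
    intro _ f σ σ' hσ
    have := (B.L_pabs.1 (ih f σ σ' hσ)).2 _ (fun _ a => a) _ _ fun τ x => ih' τ x f σ σ' hσ
    rw [Tm.ren_id, Tm.ren_id] at this
    exact this
  | napp F K ih =>
    intro _ f σ σ' hσ
    have := (B.L_nabs.1 (ih f σ σ' hσ)).2 _ (fun _ a => a) (fun s x => f s (K s x))
    rw [Tm.ren_id, Tm.ren_id] at this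
    exact this

theorem Tm.wkN_ren_sub {Δ Δ' : List (List S)} {Γ Γ' : List (List (Ty S))} {τ : Ty S}
    (T : Tm ob Δ Γ τ) (d : List S) (f : NMap Δ Δ') (σ : Sub ob Δ' Γ Γ') :
    ((T.wkN d).ren (f.up d) (fun _ x => x)).sub (σ.upN d)
      = ((T.ren f (fun _ x => x)).sub σ).wkN d := by
  simp only [Tm.wkN, Tm.sub_ren, Tm.ren_comp]
  congr 2
  funext r a; simp

/-- Structurally congruent terms are related under related substitutions. -/
theorem Base.L.of_cong {Γ' : List (List (Ty S))} {Δ : List (List S)} {τ : Ty S}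
    {T V : Tm ob Δ Γ' τ} (h : Cong T V) :
    ∀ {Δ' : List (List S)} (f : NMap Δ Δ') (σ σ' : Sub ob Δ' Γ' Γ),
      (∀ τ x, B.L τ (σ τ x) (σ' τ x)) →
      B.L τ ((T.ren f (fun _ x => x)).sub σ) ((V.ren f (fun _ x => x)).sub σ') := by
  have left : ∀ {Γ' : List (List (Ty S))} {Δ : List (List S)} {σ σ' : Sub ob Δ Γ' Γ},
      (∀ τ x, B.L τ (σ τ x) (σ' τ x)) → ∀ τ x, B.L τ (σ τ x) (σ τ x) :=
    fun h τ x => (h τ x).trans (h τ x).symm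
  have right : ∀ {Γ' : List (List (Ty S))} {Δ : List (List S)} {σ σ' : Sub ob Δ Γ' Γ},
      (∀ τ x, B.L τ (σ τ x) (σ' τ x)) → ∀ τ x, B.L τ (σ' τ x) (σ' τ x) :=
    fun h τ x => (h τ x).symm.trans (h τ x)
  have self : ∀ {Γ' : List (List (Ty S))} {Δ Δ' : List (List S)} (T : Tm ob Δ Γ' .proc)
      (f : NMap Δ Δ') (σ σ' : Sub ob Δ' Γ' Γ), (∀ τ x, B.L τ (σ τ x) (σ' τ x)) →
      B.rel ((T.ren f (fun _ x => x)).sub σ') ((T.ren f (fun _ x => x)).sub σ') :=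
    fun T f σ σ' hσ => (B.L_proc.1 (refl_sub T f σ' σ' (right hσ))).2
  -- a law of structural congruence needs to be checked under one substitution only
  have law : ∀ {Γ' : List (List (Ty S))} {Δ Δ' : List (List S)} {T V : Tm ob Δ Γ' .proc},
      Cong T V → ∀ (f : NMap Δ Δ') (σ σ' : Sub ob Δ' Γ' Γ), (∀ τ x, B.L τ (σ τ x) (σ' τ x)) →
      B.rel ((T.ren f (fun _ x => x)).sub σ') ((V.ren f (fun _ x => x)).sub σ') →
      B.L .proc ((T.ren f (fun _ x => x)).sub σ) ((V.ren f (fun _ x => x)).sub σ') :=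
    fun hc f σ σ' hσ h => (refl_sub _ f σ σ' hσ).trans (B.L_proc.2 ⟨(hc.ren _ _).sub_left _, h⟩)
  have key : ∀ {Γ' : List (List (Ty S))} {Δ Δ' : List (List S)} {τ : Ty S} {T V : Tm ob Δ Γ' τ},
      Cong T V → ∀ (f : NMap Δ Δ') (σ σ' : Sub ob Δ' Γ' Γ), (∀ τ x, B.L τ (σ τ x) (σ' τ x)) →
      Cong ((T.ren f (fun _ x => x)).sub σ) ((V.ren f (fun _ x => x)).sub σ') :=
    fun h f σ σ' hσ => (h.ren _ _).sub fun τ x => (hσ τ x).cong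
  have keyV : ∀ {Γ' : List (List (Ty S))} {Δ Δ' : List (List S)} {d : List (Ty S)} {τ : Ty S}
      {T V : Tm ob Δ (d :: Γ') τ}, Cong T V →
      ∀ (f : NMap Δ Δ') (σ σ' : Sub ob Δ' Γ' Γ), (∀ τ x, B.L τ (σ τ x) (σ' τ x)) →
      Cong ((T.ren f (VMap.up (fun _ x => x) d)).sub (σ.upV d))
        ((V.ren f (VMap.up (fun _ x => x) d)).sub (σ'.upV d)) := by
    intro Γ' Δ Δ' d τ T V h f σ σ' hσ
    refine (h.ren _ _).sub fun τ x => ?_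
    cases x with
    | here x => exact .refl _
    | there x => exact (hσ τ x).cong.ren _ _
  induction h with
  | refl T => intro _ f σ σ' hσ; exact refl_sub T f σ σ' hσ
  | symm _ ih => intro _ f σ σ' hσ; exact (ih f σ' σ fun τ x => (hσ τ x).symm).symm
  | trans _ _ ih ih' => intro _ f σ σ' hσ; exact (ih f σ σ (left hσ)).trans (ih' f σ σ' hσ)
  | parNil T =>
    intro _ f σ σ' hσ
    exact law (.parNil T) f σ σ' hσ (B.parNil (self T f σ σ' hσ))
  | parComm T V =>
    intro _ f σ σ' hσ
    exact law (.parComm T V) f σ σ' hσ (B.parComm (self T f σ σ' hσ) (self V f σ σ' hσ))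
  | parAssoc T V W =>
    intro _ f σ σ' hσ
    exact law (.parAssoc T V W) f σ σ' hσ
      (B.parAssoc (self T f σ σ' hσ) (self V f σ σ' hσ) (self W f σ σ' hσ))
  | nuComm s t T =>
    intro _ f σ σ' hσ
    have hL : B.L .proc (((Tm.nu s (.nu t T)).ren f (fun _ x => x)).sub σ)
        (((Tm.nu t (.nu s (T.ren (NMap.swap s t) (fun _ x => x)))).ren f
          (fun _ x => x)).sub σ') := by
      refine law (.nuComm' s t T) f σ σ' hσ ?_
      have := B.nuComm s t (self T ((f.up [s]).up [t]) ((σ.upN [s]).upN [t])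
        ((σ'.upN [s]).upN [t]) fun τ x => ((hσ τ x).ren _).ren _)
      rw [← Tm.swap_ren_sub] at this
      exact this
    convert hL using 6
    apply NMap.ext_cases
    · intros; rfl
    · intro r x
      rcases x with x | x
      · rfl
      · rcases x with x | x <;> rfl
  | nuPar s T V =>
    intro _ f σ σ' hσ
    refine law (.nuPar s T V) f σ σ' hσ ?_
    have := B.nuPar s (self T (f.up [s]) (σ.upN [s]) (σ'.upN [s]) fun τ x => (hσ τ x).ren _)
      (self V f σ σ' hσ)
    rw [← Tm.wkN_ren_sub] at this
    exact this
  | pbeta T K =>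
    intro _ f σ σ' hσ
    refine .trans (refl_sub _ f σ σ' hσ) ?_
    rw [Sub.inst_ren, Sub.inst_sub]
    refine .head (.pbeta _ _) ?_
    rw [← Sub.inst_sub, ← Sub.inst_ren]
    exact refl_sub _ f σ' σ' (right hσ)
  | nbeta T K =>
    intro _ f σ σ' hσ
    refine .trans (refl_sub _ f σ σ' hσ) ?_
    rw [NMap.inst_ren, NMap.inst_sub]
    refine .head (.nbeta _ _) ?_
    rw [← NMap.inst_sub, ← NMap.inst_ren]
    exact refl_sub _ f σ' σ' (right hσ)
  | inp h a hT ih =>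
    intro _ f σ σ' hσ
    exact B.L_proc.2 ⟨key (.inp h a hT) f σ σ' hσ, B.inp _ _ (keyV hT f σ σ' hσ)⟩
  | rinp h a hT ih =>
    intro _ f σ σ' hσ
    exact B.L_proc.2 ⟨key (.rinp h a hT) f σ σ' hσ, B.rinp _ _ (keyV hT f σ σ' hσ)⟩
  | out h a hA hT ih ih' =>
    intro _ f σ σ' hσ
    exact B.L_proc.2 ⟨key (.out h a hA hT) f σ σ' hσ,
      B.out _ _ (key hA f σ σ' hσ) (key hT f σ σ' hσ)⟩
  | rout h a hA hT ih ih' =>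
    intro _ f σ σ' hσ
    exact B.L_proc.2 ⟨key (.rout h a hA hT) f σ σ' hσ,
      B.rout _ _ (key hA f σ σ' hσ) (key hT f σ σ' hσ)⟩
  | par hT hV ih ih' =>
    intro _ f σ σ' hσ
    exact B.L_proc.2 ⟨key (.par hT hV) f σ σ' hσ,
      B.par (B.L_proc.1 (ih f σ σ' hσ)).2 (B.L_proc.1 (ih' f σ σ' hσ)).2⟩
  | nu s hT ih =>
    intro _ f σ σ' hσ
    exact B.L_proc.2 ⟨key (.nu s hT) f σ σ' hσ, B.nu s (B.L_proc.1
      (ih (f.up [s]) (σ.upN [s]) (σ'.upN [s]) fun τ x => (hσ τ x).ren _)).2⟩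
  | pabs hT ih =>
    intro _ f σ σ' hσ
    refine B.L_pabs.2 ⟨key (.pabs hT) f σ σ' hσ, fun Δ'' f' K K' hK => ?_⟩
    simp only [Tm.ren, Tm.sub, VMap.up_id']
    refine .head₂ (.pbeta _ _) (.pbeta _ _) ?_
    rw [Sub.upV_inst, Sub.upV_inst]
    exact ih _ _ _ (.cons hK fun τ x => (hσ τ x).ren f')
  | nabs hT ih =>
    intro _ f σ σ' hσ
    refine B.L_nabs.2 ⟨key (.nabs hT) f σ σ' hσ, fun Δ'' f' K => ?_⟩
    simp only [Tm.ren, Tm.sub]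
    refine .head₂ (.nbeta _ _) (.nbeta _ _) ?_
    rw [Sub.upN_inst, Sub.upN_inst]
    exact ih _ _ _ fun τ x => (hσ τ x).ren f'
  | papp hF hK ih ih' =>
    intro _ f σ σ' hσ
    have := (B.L_pabs.1 (ih f σ σ' hσ)).2 _ (fun _ a => a) _ _ fun τ x => ih' τ x f σ σ' hσ
    rw [Tm.ren_id, Tm.ren_id] at this
    exact this
  | napp K hF ih =>
    intro _ f σ σ' hσ
    have := (B.L_nabs.1 (ih f σ σ' hσ)).2 _ (fun _ a => a) (fun s x => f s (K s x))
    rw [Tm.ren_id, Tm.ren_id] at this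
    exact this

/-! ### Prefixed processes -/

/-- Two prefixed processes of the same form, on the same name, with structurally congruent
constituents. -/
inductive GRel {Δ : List (List S)} {Γ : List (List (Ty S))} :
    Tm ob Δ Γ .proc → Tm ob Δ Γ .proc → Prop
  | inp {s τ} (h : ob s = τ) (a : Nm Δ s) {T T' : Tm ob Δ ([τ] :: Γ) .proc} :
      Cong T T' → GRel (.inp h a T) (.inp h a T')
  | rinp {s τ} (h : ob s = τ) (a : Nm Δ s) {T T' : Tm ob Δ ([τ] :: Γ) .proc} :
      Cong T T' → GRel (.rinp h a T) (.rinp h a T')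
  | out {s τ} (h : ob s = τ) (a : Nm Δ s) {A A' : Tm ob Δ Γ τ} {T T' : Tm ob Δ Γ .proc} :
      Cong A A' → Cong T T' → GRel (.out h a A T) (.out h a A' T')
  | rout {s τ} (h : ob s = τ) (a : Nm Δ s) {A A' : Tm ob Δ Γ τ} {T T' : Tm ob Δ Γ .proc} :
      Cong A A' → Cong T T' → GRel (.rout h a A T) (.rout h a A' T')

/-- Prefixed processes. -/
inductive Guard {Δ : List (List S)} {Γ : List (List (Ty S))} : Tm ob Δ Γ .proc → Prop
  | inp {s τ} (h : ob s = τ) (a : Nm Δ s) (T : Tm ob Δ ([τ] :: Γ) .proc) : Guard (.inp h a T)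
  | rinp {s τ} (h : ob s = τ) (a : Nm Δ s) (T : Tm ob Δ ([τ] :: Γ) .proc) : Guard (.rinp h a T)
  | out {s τ} (h : ob s = τ) (a : Nm Δ s) (A : Tm ob Δ Γ τ) (T : Tm ob Δ Γ .proc) :
      Guard (.out h a A T)
  | rout {s τ} (h : ob s = τ) (a : Nm Δ s) (A : Tm ob Δ Γ τ) (T : Tm ob Δ Γ .proc) :
      Guard (.rout h a A T)

section Guards

variable {Δ Δ' : List (List S)} {Γ Γ' : List (List (Ty S))}

theorem Guard.refl {g : Tm ob Δ Γ .proc} (h : Guard g) : GRel g g := by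
  cases h with
  | inp h a T => exact .inp _ _ (.refl _)
  | rinp h a T => exact .rinp _ _ (.refl _)
  | out h a A T => exact .out _ _ (.refl _) (.refl _)
  | rout h a A T => exact .rout _ _ (.refl _) (.refl _)

theorem GRel.symm {g g' : Tm ob Δ Γ .proc} (h : GRel g g') : GRel g' g := by
  cases h with
  | inp h a h1 => exact .inp _ _ h1.symm
  | rinp h a h1 => exact .rinp _ _ h1.symm
  | out h a h1 h2 => exact .out _ _ h1.symm h2.symm
  | rout h a h1 h2 => exact .rout _ _ h1.symm h2.symm

theorem GRel.trans {g g' g'' : Tm ob Δ Γ .proc} (h : GRel g g') (h' : GRel g' g'') :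
    GRel g g'' := by
  cases h with
  | inp h a h1 => cases h' with | inp _ _ h1' => exact .inp _ _ (h1.trans h1')
  | rinp h a h1 => cases h' with | rinp _ _ h1' => exact .rinp _ _ (h1.trans h1')
  | out h a h1 h2 =>
    cases h' with | out _ _ h1' h2' => exact .out _ _ (h1.trans h1') (h2.trans h2')
  | rout h a h1 h2 =>
    cases h' with | rout _ _ h1' h2' => exact .rout _ _ (h1.trans h1') (h2.trans h2')

theorem GRel.cong {g g' : Tm ob Δ Γ .proc} (h : GRel g g') : Cong g g' := by
  cases h with
  | inp h a h1 => exact .inp _ _ h1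
  | rinp h a h1 => exact .rinp _ _ h1
  | out h a h1 h2 => exact .out _ _ h1 h2
  | rout h a h1 h2 => exact .rout _ _ h1 h2

theorem GRel.ren {g g' : Tm ob Δ Γ .proc} (h : GRel g g') (f : NMap Δ Δ') (k : VMap Γ Γ') :
    GRel (g.ren f k) (g'.ren f k) := by
  cases h with
  | inp h a h1 => exact .inp _ _ (h1.ren _ _)
  | rinp h a h1 => exact .rinp _ _ (h1.ren _ _)
  | out h a h1 h2 => exact .out _ _ (h1.ren _ _) (h2.ren _ _)
  | rout h a h1 h2 => exact .rout _ _ (h1.ren _ _) (h2.ren _ _)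

theorem Guard.ren {g : Tm ob Δ Γ .proc} (h : Guard g) (f : NMap Δ Δ') (k : VMap Γ Γ') :
    Guard (g.ren f k) := by
  cases h with
  | inp h a T => exact .inp _ _ _
  | rinp h a T => exact .rinp _ _ _
  | out h a A T => exact .out _ _ _ _
  | rout h a A T => exact .rout _ _ _ _

theorem Guard.sub {g : Tm ob Δ Γ .proc} (h : Guard g) (σ : Sub ob Δ Γ Γ') : Guard (g.sub σ) := by
  cases h with
  | inp h a T => exact .inp _ _ _
  | rinp h a T => exact .rinp _ _ _
  | out h a A T => exact .out _ _ _ _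
  | rout h a A T => exact .rout _ _ _ _

theorem rel_gRel_refl {M : Multiset (Tm ob Δ Γ .proc)} (h : ∀ g ∈ M, Guard g) :
    Multiset.Rel GRel M M :=
  Multiset.rel_refl_of_refl_on fun g hg => (h g hg).refl

theorem cl_bigPar_congr {M N : Multiset (Tm ob Δ Γ .proc)} (h : Multiset.Rel GRel M N) :
    cl (bigPar M) = cl (bigPar N) := by
  induction h with
  | zero => rfl
  | cons h _ ih => rw [cl_bigPar_cons, cl_bigPar_cons, ih, cl_eq.2 h.cong]

end Guards

/-! ### Evaluation of processes to parallel compositions of prefixed processes -/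

/-- Configurations: a multiset of prefixed processes under a block of restrictions. -/
abbrev Conf (ob : S → Ty S) (Δ : List (List S)) (Γ : List (List (Ty S))) : Type u :=
  Σ d : List S, Multiset (Tm ob (d :: Δ) Γ .proc)

section Eval

variable {Γ : List (List (Ty S))}

/-- Parallel composition of configurations. -/
def Conf.par {Δ : List (List S)} (c c' : Conf ob Δ Γ) : Conf ob Δ Γ :=
  ⟨c.1 ++ c'.1, c.2.map (fun T => T.ren (NMap.inl c.1 c'.1) (fun _ x => x))
    + c'.2.map (fun T => T.ren (NMap.inr c.1 c'.1) (fun _ x => x))⟩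

/-- Restriction of a configuration. -/
def Conf.nu {Δ : List (List S)} (s : S) (c : Conf ob ([s] :: Δ) Γ) : Conf ob Δ Γ :=
  ⟨s :: c.1, c.2.map fun T => T.ren (NMap.merge s c.1) (fun _ x => x)⟩

/-- Renaming of a configuration. -/
def Conf.ren {Δ Δ' : List (List S)} (f : NMap Δ Δ') (c : Conf ob Δ Γ) : Conf ob Δ' Γ :=
  ⟨c.1, c.2.map fun T => T.ren (f.up c.1) (fun _ x => x)⟩

/-- Evaluation: head reduction at the active positions until all active processes are
prefixed. -/
inductive Eval : ∀ {Δ : List (List S)}, Tm ob Δ Γ .proc → Conf ob Δ Γ → Prop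
  | nil {Δ} : Eval (.nil : Tm ob Δ Γ .proc) ⟨[], 0⟩
  | guard {Δ} {g : Tm ob Δ Γ .proc} : Guard g → Eval g ⟨[], {g.wkN []}⟩
  | par {Δ} {T V : Tm ob Δ Γ .proc} {c c' : Conf ob Δ Γ} :
      Eval T c → Eval V c' → Eval (.par T V) (c.par c')
  | nu {Δ} (s : S) {T : Tm ob ([s] :: Δ) Γ .proc} {c : Conf ob ([s] :: Δ) Γ} :
      Eval T c → Eval (.nu s T) (c.nu s)
  | head {Δ} {T T' : Tm ob Δ Γ .proc} {c : Conf ob Δ Γ} : Head T T' → Eval T' c → Eval T c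

variable {Δ Δ' : List (List S)}

theorem Head.det {τ : Ty S} {T V V' : Tm ob Δ Γ τ} (h : Head T V) (h' : Head T V') : V = V' := by
  induction h with
  | pbeta T K =>
    cases h' with
    | pbeta => rfl
    | papp _ h => cases h
  | nbeta T K =>
    cases h' with
    | nbeta => rfl
    | napp _ h => cases h
  | papp K h ih =>
    cases h' with
    | pbeta => cases h
    | papp _ h' => rw [ih h']
  | napp K h ih =>
    cases h' with
    | nbeta => cases h
    | napp _ h' => rw [ih h']

theorem Eval.det {T : Tm ob Δ Γ .proc} {c c' : Conf ob Δ Γ} (h : Eval T c) (h' : Eval T c') :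
    c = c' := by
  induction h with
  | nil =>
    cases h' with
    | nil => rfl
    | guard h => cases h
    | head h => cases h
  | guard hg =>
    cases h' with
    | guard => rfl
    | nil => cases hg
    | par => cases hg
    | nu => cases hg
    | head h => cases hg <;> cases h
  | par h1 h2 ih1 ih2 =>
    cases h' with
    | par h1' h2' => rw [ih1 h1', ih2 h2']
    | guard h => cases h
    | head h => cases h
  | nu s h1 ih =>
    cases h' with
    | nu _ h1' => rw [ih h1']
    | guard h => cases h
    | head h => cases h
  | head hh h1 ih =>
    cases h' with
    | head hh' h1' => cases hh.det hh'; exact ih h1'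
    | guard h => cases h <;> cases hh
    | nil => cases hh
    | par => cases hh
    | nu => cases hh

theorem Eval.guards {T : Tm ob Δ Γ .proc} {c : Conf ob Δ Γ} (h : Eval T c) :
    ∀ g ∈ c.2, Guard g := by
  induction h with
  | nil => simp
  | guard hg =>
    intro g' h
    rw [Multiset.mem_singleton] at h
    rw [h]
    exact hg.ren _ _
  | par h1 h2 ih1 ih2 =>
    intro g h
    rcases Multiset.mem_add.1 h with h | h
    · obtain ⟨g', h', rfl⟩ := Multiset.mem_map.1 h
      exact (ih1 g' h').ren _ _
    · obtain ⟨g', h', rfl⟩ := Multiset.mem_map.1 h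
      exact (ih2 g' h').ren _ _
  | nu s h1 ih =>
    intro g h
    obtain ⟨g', h', rfl⟩ := Multiset.mem_map.1 h
    exact (ih g' h').ren _ _
  | head _ _ ih => exact ih

theorem NMap.inl_up (f : NMap Δ Δ') (c d : List S) :
    (f.up c).comp (NMap.inl c d) = (NMap.inl c d).comp (f.up (c ++ d)) := by
  apply NMap.block_ext
  · intros; simp
  · intros; rfl

theorem NMap.inr_up (f : NMap Δ Δ') (c d : List S) :
    (f.up d).comp (NMap.inr c d) = (NMap.inr c d).comp (f.up (c ++ d)) := by
  apply NMap.block_ext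
  · intros; simp
  · intros; rfl

theorem NMap.merge_up (f : NMap Δ Δ') (s : S) (d : List S) :
    ((f.up [s]).up d).comp (NMap.merge s d) = (NMap.merge s d).comp (f.up (s :: d)) := by
  funext r a
  obtain ⟨b, rfl⟩ : ∃ b, a = NMap.split s d r b := ⟨_, (NMap.split_merge s d r a).symm⟩
  have := congrFun (congrFun (NMap.split_up f s d) r) b
  simp only [NMap.comp_apply] at this ⊢
  rw [← this, NMap.merge_split, NMap.merge_split]

theorem Conf.ext {d : List S} {M N : Multiset (Tm ob (d :: Δ) Γ .proc)} (h : M = N) :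
    (⟨d, M⟩ : Conf ob Δ Γ) = ⟨d, N⟩ := by rw [h]

theorem Conf.ren_par (c c' : Conf ob Δ Γ) (f : NMap Δ Δ') :
    (c.par c').ren f = (c.ren f).par (c'.ren f) := by
  obtain ⟨c, M⟩ := c
  obtain ⟨c', M'⟩ := c'
  refine Conf.ext (d := c ++ c') (M := (M.map (fun T => T.ren (NMap.inl c c') (fun _ x => x))
    + M'.map (fun T => T.ren (NMap.inr c c') (fun _ x => x))).map
      fun T => T.ren (f.up (c ++ c')) (fun _ x => x))
    (N := (M.map fun T => T.ren (f.up c) (fun _ x => x)).map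
        (fun T => T.ren (NMap.inl c c') (fun _ x => x))
      + (M'.map fun T => T.ren (f.up c') (fun _ x => x)).map
        (fun T => T.ren (NMap.inr c c') (fun _ x => x))) ?_
  simp only [Multiset.map_add, Multiset.map_map, Function.comp_def, Tm.ren_comp,
    NMap.inl_up, NMap.inr_up]

theorem Conf.ren_nu {s : S} (c : Conf ob ([s] :: Δ) Γ) (f : NMap Δ Δ') :
    (c.nu s).ren f = (c.ren (f.up [s])).nu s := by
  obtain ⟨c, M⟩ := c
  refine Conf.ext (d := s :: c) (M := (M.map fun T => T.ren (NMap.merge s c) (fun _ x => x)).map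
      fun T => T.ren (f.up (s :: c)) (fun _ x => x))
    (N := (M.map fun T => T.ren ((f.up [s]).up c) (fun _ x => x)).map
      fun T => T.ren (NMap.merge s c) (fun _ x => x)) ?_
  simp only [Multiset.map_map, Function.comp_def, Tm.ren_comp, NMap.merge_up]

theorem Eval.ren {T : Tm ob Δ Γ .proc} {c : Conf ob Δ Γ} (h : Eval T c) :
    ∀ {Δ' : List (List S)} (f : NMap Δ Δ'), Eval (T.ren f (fun _ x => x)) (c.ren f) := by
  induction h with
  | nil => intros; exact .nil
  | @guard _ g hg =>
    intro _ f
    have := Eval.guard (hg.ren f (fun _ x => x))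
    convert this using 1
    simp only [Conf.ren, Multiset.map_singleton, Tm.wkN, Tm.ren_comp]
    congr 3
    funext r a; simp
  | @par _ T V c c' h1 h2 ih1 ih2 =>
    intro _ f
    have := Eval.par (ih1 f) (ih2 f)
    rwa [← Conf.ren_par] at this
  | nu s h1 ih =>
    intro _ f
    have := Eval.nu s (ih (f.up [s]))
    rwa [← Conf.ren_nu] at this
  | head hh _ ih => intro _ f; exact .head (hh.ren f) (ih f)

theorem Eval.cl_eq {T : Tm ob Δ Γ .proc} {c : Conf ob Δ Γ} (h : Eval T c) :
    cl T = cl (nuB c.1 (bigPar c.2)) := by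
  induction h with
  | nil =>
    refine Eq.trans ?_ (nuB_eq (T := .nil) ?_)
    · rfl
    · simp [cl_nil]
  | @guard _ g hg => rw [nuB_eq (T' := g.wkN []) (by simp), nuB_nil]
  | @par _ T V c c' h1 h2 ih1 ih2 =>
    rw [cl_par, ih1, ih2, ← nuB_add]
    refine nuB_eq ?_
    simp only [Conf.par, cl_bigPar_add, cl_par, cl_bigPar_ren]
  | nu s h1 ih =>
    rw [cl_nu, ih, ← cl_nu, nu_nuB]
    exact nuB_eq (cl_bigPar_ren _ _ _)
  | head hh _ ih => rw [HO.cl_eq.2 hh.cong, ih]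

/-! ### Configurations up to permutation of restrictions -/

/-- Configurations that agree up to a permutation of the restrictions and structural congruence
below prefixes. -/
def Conf.Rel (c c' : Conf ob Δ Γ) : Prop :=
  ∃ (f : NMap (c.1 :: Δ) (c'.1 :: Δ)) (g : NMap (c'.1 :: Δ) (c.1 :: Δ)), NMap.Iso f g ∧
    Multiset.Rel GRel (c.2.map fun T => T.ren f (fun _ x => x)) c'.2

theorem NMap.Iso.id {d : List S} : NMap.Iso (NMap.id (d :: Δ)) (NMap.id (d :: Δ)) :=
  ⟨fun _ _ => rfl, fun _ _ => rfl, fun _ _ => rfl, fun _ _ => rfl⟩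

theorem NMap.Iso.trans {c d e : List S} {f : NMap (c :: Δ) (d :: Δ)} {g : NMap (d :: Δ) (c :: Δ)}
    {f' : NMap (d :: Δ) (e :: Δ)} {g' : NMap (e :: Δ) (d :: Δ)} (h : NMap.Iso f g)
    (h' : NMap.Iso f' g') : NMap.Iso (f.comp f') (g'.comp g) := by
  refine ⟨?_, ?_, ?_, ?_⟩ <;> intro s a
  · rw [NMap.comp_apply, h.fix, h'.fix]
  · rw [NMap.comp_apply, h'.fix', h.fix']
  · simp [h'.left, h.left]
  · simp [h'.right, h.right]

theorem NMap.Iso.exists_here {c d : List S} {f : NMap (c :: Δ) (d :: Δ)}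
    {g : NMap (d :: Δ) (c :: Δ)} (h : NMap.Iso f g) (s : S) (x : Pos c s) :
    ∃ y, f s (.var (.here x)) = .var (.here y) := by
  obtain h' | ⟨b, hb⟩ := NMap.here_or_wk (f s (.var (.here x)))
  · exact h'
  · have := h.left s (.var (.here x))
    rw [hb, h.fix'] at this
    exact absurd this.symm (NMap.here_ne_wk _ _)

/-- The map on names given by a map on the positions of the innermost block. -/
def NMap.ofPos {c d : List S} (p : ∀ s, Pos c s → Pos d s) : NMap (c :: Δ) (d :: Δ)
  | _, .const n => .const n
  | s, .var (.here x) => .var (.here (p s x))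
  | _, .var (.there x) => .var (.there x)

theorem NMap.ofPos_wk {c d : List S} (p : ∀ s, Pos c s → Pos d s) (s : S) (a : Nm Δ s) :
    NMap.ofPos p s (NMap.wk c s a) = NMap.wk d s a := by
  cases a <;> rfl

/-- A permutation of a block makes sense over every name context. -/
theorem NMap.Iso.exists_up {c d : List S} {f : NMap (c :: Δ) (d :: Δ)}
    {g : NMap (d :: Δ) (c :: Δ)} (h : NMap.Iso f g) (k : NMap Δ Δ') :
    ∃ (f' : NMap (c :: Δ') (d :: Δ')) (g' : NMap (d :: Δ') (c :: Δ')), NMap.Iso f' g' ∧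
      (k.up c).comp f' = f.comp (k.up d) := by
  choose p hp using h.exists_here
  choose q hq using h.symm.exists_here
  have hqp : ∀ s x, q s (p s x) = x := by
    intro s x
    have := h.left s (.var (.here x))
    rw [hp, hq] at this
    simpa using this
  have hpq : ∀ s x, p s (q s x) = x := by
    intro s x
    have := h.right s (.var (.here x))
    rw [hq, hp] at this
    simpa using this
  refine ⟨NMap.ofPos p, NMap.ofPos q, ⟨fun s a => ?_, fun s a => ?_, fun s a => ?_,
    fun s a => ?_⟩, ?_⟩
  · exact NMap.ofPos_wk p s a
  · exact NMap.ofPos_wk q s a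
  · rcases a with n | x | x
    · rfl
    · simp [NMap.ofPos, hqp]
    · rfl
  · rcases a with n | x | x
    · rfl
    · simp [NMap.ofPos, hpq]
    · rfl
  · apply NMap.block_ext
    · intro s a
      simp [NMap.ofPos_wk, h.fix s a]
    · intro s x
      simp [NMap.ofPos, hp]

theorem Conf.Rel.symm {c c' : Conf ob Δ Γ} (h : c.Rel c') : c'.Rel c := by
  obtain ⟨f, g, hi, hr⟩ := h
  refine ⟨g, f, hi.symm, ?_⟩
  rw [Multiset.rel_map_left] at hr ⊢
  rw [← Multiset.rel_flip]
  refine hr.mono fun T _ V _ h => ?_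
  have := h.symm.ren g (fun _ x => x)
  rw [Tm.ren_comp, show f.comp g = NMap.id _ from funext fun s => funext fun a => hi.left s a,
    Tm.ren_id] at this
  exact this

theorem rel_gRel_trans {M N K : Multiset (Tm ob Δ Γ .proc)} (h : Multiset.Rel GRel M N)
    (h' : Multiset.Rel GRel N K) : Multiset.Rel GRel M K :=
  haveI : IsTrans (Tm ob Δ Γ .proc) GRel := ⟨fun _ _ _ h h' => h.trans h'⟩
  h.trans _ h'

theorem rel_gRel_ren {M N : Multiset (Tm ob Δ Γ .proc)} (h : Multiset.Rel GRel M N)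
    (f : NMap Δ Δ') : Multiset.Rel GRel (M.map fun T => T.ren f (fun _ x => x))
      (N.map fun T => T.ren f (fun _ x => x)) :=
  Multiset.rel_map.2 (h.mono fun _ _ _ _ h => h.ren _ _)

theorem Conf.Rel.trans {c c' c'' : Conf ob Δ Γ} (h : c.Rel c') (h' : c'.Rel c'') :
    c.Rel c'' := by
  obtain ⟨f, g, hi, hr⟩ := h
  obtain ⟨f', g', hi', hr'⟩ := h'
  refine ⟨_, _, hi.trans hi', ?_⟩
  have := rel_gRel_trans (rel_gRel_ren hr f') hr'
  simpa only [Multiset.map_map, Function.comp_def, Tm.ren_comp] using this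

theorem Conf.Rel.ren {c c' : Conf ob Δ Γ} (h : c.Rel c') (k : NMap Δ Δ') :
    (c.ren k).Rel (c'.ren k) := by
  obtain ⟨f, g, hi, hr⟩ := h
  obtain ⟨f', g', hi', hf⟩ := hi.exists_up k
  refine ⟨f', g', hi', ?_⟩
  have := rel_gRel_ren hr (k.up c'.1)
  simp only [Multiset.map_map, Function.comp_def, Tm.ren_comp] at this
  simpa only [Conf.ren, Multiset.map_map, Function.comp_def, Tm.ren_comp, hf] using this

/-- Elimination of positions in a concatenated block. -/
def Pos.elim {c d : List S} {s : S} : Pos (c ++ d) s → Pos c s ⊕ Pos d s :=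
  match c with
  | [] => fun x => .inr x
  | _ :: _ => fun x => match x with
    | .zero => .inl .zero
    | .succ x => (Pos.elim x).map .succ _root_.id

theorem Pos.elim_inl (c d : List S) {s : S} (x : Pos c s) :
    Pos.elim (NMap.inl.go d c x) = .inl x := by
  induction x with
  | zero => rfl
  | succ x ih => simp [NMap.inl.go, Pos.elim, ih]

theorem Pos.elim_inr (c d : List S) {s : S} (x : Pos d s) :
    Pos.elim (NMap.inr.go d c x) = .inr x := by
  induction c with
  | nil => rfl
  | cons t c ih => simp [NMap.inr.go, Pos.elim, ih]

theorem Pos.eq_inl_or_inr (c d : List S) {s : S} (x : Pos (c ++ d) s) :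
    (∃ y, x = NMap.inl.go d c y) ∨ ∃ y, x = NMap.inr.go d c y := by
  induction c with
  | nil => exact .inr ⟨x, rfl⟩
  | cons t c ih =>
    cases x with
    | zero => exact .inl ⟨.zero, rfl⟩
    | succ x =>
      obtain ⟨y, rfl⟩ | ⟨y, rfl⟩ := ih x
      · exact .inl ⟨.succ y, rfl⟩
      · exact .inr ⟨y, rfl⟩

/-- The map on names over a concatenated block given by maps on both parts. -/
def NMap.elim {c d : List S} (f : NMap (c :: Δ) Δ') (g : NMap (d :: Δ) Δ') :
    NMap ((c ++ d) :: Δ) Δ'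
  | s, .const n => f s (.const n)
  | s, .var (.here x) => (Pos.elim x).elim (fun y => f s (.var (.here y)))
      (fun y => g s (.var (.here y)))
  | s, .var (.there x) => f s (.var (.there x))

theorem NMap.elim_inl {c d : List S} (f : NMap (c :: Δ) Δ') (g : NMap (d :: Δ) Δ') (s : S)
    (a : Nm (c :: Δ) s) : NMap.elim f g s (NMap.inl c d s a) = f s a := by
  rcases a with n | x | x
  · rfl
  · simp [NMap.inl, NMap.elim, Pos.elim_inl]
  · rfl

theorem NMap.elim_inr {c d : List S} {f : NMap (c :: Δ) Δ'} {g : NMap (d :: Δ) Δ'}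
    (h : ∀ s a, f s (NMap.wk c s a) = g s (NMap.wk d s a)) (s : S)
    (a : Nm (d :: Δ) s) : NMap.elim f g s (NMap.inr c d s a) = g s a := by
  rcases a with n | x | x
  · exact h s (.const n)
  · simp [NMap.inr, NMap.elim, Pos.elim_inr]
  · exact h s (.var x)

theorem NMap.elim_wk {c d : List S} (f : NMap (c :: Δ) Δ') (g : NMap (d :: Δ) Δ') (s : S)
    (a : Nm Δ s) : NMap.elim f g s (NMap.wk (c ++ d) s a) = f s (NMap.wk c s a) := by
  cases a <;> rfl

theorem NMap.append_ext {c d : List S} {f g : NMap ((c ++ d) :: Δ) Δ'}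
    (h : ∀ s a, f s (NMap.inl c d s a) = g s (NMap.inl c d s a))
    (h' : ∀ s a, f s (NMap.inr c d s a) = g s (NMap.inr c d s a)) (s : S)
    (a : Nm ((c ++ d) :: Δ) s) : f s a = g s a := by
  rcases a with n | x | x
  · exact h s (.const n)
  · obtain ⟨y, rfl⟩ | ⟨y, rfl⟩ := Pos.eq_inl_or_inr c d x
    · exact h s (.var (.here y))
    · exact h' s (.var (.here y))
  · exact h s (.var (.there x))

theorem NMap.Iso.append {c c' e e' : List S} {f : NMap (c :: Δ) (c' :: Δ)}
    {g : NMap (c' :: Δ) (c :: Δ)} {f' : NMap (e :: Δ) (e' :: Δ)} {g' : NMap (e' :: Δ) (e :: Δ)}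
    (hi : NMap.Iso f g) (hi' : NMap.Iso f' g') :
    NMap.Iso (NMap.elim (f.comp (NMap.inl c' e')) (f'.comp (NMap.inr c' e')))
      (NMap.elim (g.comp (NMap.inl c e)) (g'.comp (NMap.inr c e))) := by
  have w : ∀ s a, (f.comp (NMap.inl c' e')) s (NMap.wk c s a)
      = (f'.comp (NMap.inr c' e')) s (NMap.wk e s a) := by
    intro s a; simp [hi.fix s a, hi'.fix s a]
  have w' : ∀ s a, (g.comp (NMap.inl c e)) s (NMap.wk c' s a)
      = (g'.comp (NMap.inr c e)) s (NMap.wk e' s a) := by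
    intro s a; simp [hi.fix' s a, hi'.fix' s a]
  refine ⟨?_, ?_, ?_, ?_⟩
  · intro s a
    rw [NMap.elim_wk]; simp [hi.fix s a]
  · intro s a
    rw [NMap.elim_wk]; simp [hi.fix' s a]
  · refine NMap.append_ext (f := (NMap.elim _ _).comp (NMap.elim _ _)) (g := NMap.id _) ?_ ?_
    · intro s a
      rw [NMap.comp_apply, NMap.elim_inl, NMap.comp_apply, NMap.elim_inl, NMap.comp_apply, hi.left]
    · intro s a
      rw [NMap.comp_apply, NMap.elim_inr w, NMap.comp_apply, NMap.elim_inr w', NMap.comp_apply,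
        hi'.left]
  · refine NMap.append_ext (f := (NMap.elim _ _).comp (NMap.elim _ _)) (g := NMap.id _) ?_ ?_
    · intro s a
      rw [NMap.comp_apply, NMap.elim_inl, NMap.comp_apply, NMap.elim_inl, NMap.comp_apply,
        hi.right]
    · intro s a
      rw [NMap.comp_apply, NMap.elim_inr w', NMap.comp_apply, NMap.elim_inr w, NMap.comp_apply,
        hi'.right]

theorem NMap.Iso.cons {s : S} {c c' : List S} {f : NMap (c :: [s] :: Δ) (c' :: [s] :: Δ)}
    {g : NMap (c' :: [s] :: Δ) (c :: [s] :: Δ)} (hi : NMap.Iso f g) :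
    NMap.Iso ((NMap.split s c).comp (f.comp (NMap.merge s c')))
      ((NMap.split s c').comp (g.comp (NMap.merge s c))) := by
  refine ⟨?_, ?_, ?_, ?_⟩ <;> intro r a <;> simp only [NMap.comp_apply, NMap.split_merge]
  · rw [NMap.split_wk, hi.fix, NMap.merge_wk_wk]
  · rw [NMap.split_wk, hi.fix', NMap.merge_wk_wk]
  · rw [hi.left, NMap.merge_split]
  · rw [hi.right, NMap.merge_split]

theorem Conf.Rel.par {c c' e e' : Conf ob Δ Γ} (h : c.Rel c') (h' : e.Rel e') :
    (c.par e).Rel (c'.par e') := by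
  obtain ⟨f, g, hi, hr⟩ := h
  obtain ⟨f', g', hi', hr'⟩ := h'
  refine ⟨_, _, hi.append hi', ?_⟩
  have h1 : (NMap.inl c.1 e.1).comp (NMap.elim (f.comp (NMap.inl c'.1 e'.1))
      (f'.comp (NMap.inr c'.1 e'.1))) = f.comp (NMap.inl c'.1 e'.1) := by
    funext s a; exact NMap.elim_inl _ _ s a
  have h2 : (NMap.inr c.1 e.1).comp (NMap.elim (f.comp (NMap.inl c'.1 e'.1))
      (f'.comp (NMap.inr c'.1 e'.1))) = f'.comp (NMap.inr c'.1 e'.1) := by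
    funext s a
    exact NMap.elim_inr (fun s a => by simp [hi.fix s a, hi'.fix s a]) s a
  simp only [Conf.par, Multiset.map_add, Multiset.map_map, Function.comp_def, Tm.ren_comp,
    h1, h2]
  refine .add ?_ ?_
  · simpa only [Multiset.map_map, Function.comp_def, Tm.ren_comp] using
      rel_gRel_ren hr (NMap.inl c'.1 e'.1)
  · simpa only [Multiset.map_map, Function.comp_def, Tm.ren_comp] using
      rel_gRel_ren hr' (NMap.inr c'.1 e'.1)

theorem Conf.Rel.nu {s : S} {c c' : Conf ob ([s] :: Δ) Γ} (h : c.Rel c') :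
    (c.nu s).Rel (c'.nu s) := by
  obtain ⟨f, g, hi, hr⟩ := h
  refine ⟨_, _, hi.cons, ?_⟩
  have h1 : (NMap.merge s c.1).comp ((NMap.split s c.1).comp (f.comp (NMap.merge s c'.1)))
      = f.comp (NMap.merge s c'.1) := by
    funext r a; simp
  simp only [Conf.nu, Multiset.map_map, Function.comp_def, Tm.ren_comp, h1]
  simpa only [Multiset.map_map, Function.comp_def, Tm.ren_comp] using
    rel_gRel_ren hr (NMap.merge s c'.1)

/-- Equality of configurations up to a permutation of restrictions. -/
theorem Conf.rel_of_iso {c c' : Conf ob Δ Γ} {f : NMap (c.1 :: Δ) (c'.1 :: Δ)}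
    {g : NMap (c'.1 :: Δ) (c.1 :: Δ)} (hi : NMap.Iso f g) (hc : ∀ T ∈ c'.2, Guard T)
    (h : (c.2.map fun T => T.ren f (fun _ x => x)) = c'.2) : c.Rel c' :=
  ⟨f, g, hi, h ▸ rel_gRel_refl (h ▸ hc)⟩

theorem Conf.Rel.refl {c : Conf ob Δ Γ} (hc : ∀ T ∈ c.2, Guard T) : c.Rel c :=
  Conf.rel_of_iso NMap.Iso.id hc (by simp)

end Eval

section Eval

variable {Δ Δ' : List (List S)} {Γ : List (List (Ty S))}

/-- The map on names out of an empty block. -/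
def NMap.ofNil {c : List S} : NMap ([] :: Δ) (c :: Δ) := NMap.ofPos fun _ x => nomatch x

theorem NMap.Iso.appendNil {c : List S} :
    NMap.Iso (Δ := Δ) (NMap.elim (NMap.id (c :: Δ)) NMap.ofNil)
      (NMap.inl c []) := by
  have w : ∀ s a, NMap.id (c :: Δ) s (NMap.wk c s a)
      = NMap.ofNil s (NMap.wk [] s a) :=
    fun s a => (NMap.ofPos_wk _ s a).symm
  refine ⟨?_, ?_, ?_, ?_⟩
  · intro s a; rw [NMap.elim_wk]
  · intro s a; exact NMap.inl_wk _ _ _ _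
  · refine NMap.append_ext (f := (NMap.elim _ _).comp (NMap.inl _ _)) (g := NMap.id _) ?_ ?_
    · intro s a
      rw [NMap.comp_apply, NMap.elim_inl]
    · intro s a
      rw [NMap.comp_apply, NMap.elim_inr w]
      rcases a with n | x | x
      · rfl
      · cases x
      · rfl
  · intro s a; rw [NMap.elim_inl]

theorem NMap.Iso.appendComm {c d : List S} :
    NMap.Iso (Δ := Δ) (NMap.elim (NMap.inr d c) (NMap.inl d c))
      (NMap.elim (NMap.inr c d) (NMap.inl c d)) := by
  have w : ∀ (c d : List S) s (a : Nm Δ s), NMap.inr d c s (NMap.wk c s a)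
      = NMap.inl d c s (NMap.wk d s a) := by
    intros; simp
  refine ⟨?_, ?_, ?_, ?_⟩
  · intro s a; rw [NMap.elim_wk]; simp
  · intro s a; rw [NMap.elim_wk]; simp
  · refine NMap.append_ext (f := (NMap.elim _ _).comp (NMap.elim _ _)) (g := NMap.id _) ?_ ?_
    · intro s a
      rw [NMap.comp_apply, NMap.elim_inl, NMap.elim_inr (w d c)]
    · intro s a
      rw [NMap.comp_apply, NMap.elim_inr (w c d), NMap.elim_inl]
  · refine NMap.append_ext (f := (NMap.elim _ _).comp (NMap.elim _ _)) (g := NMap.id _) ?_ ?_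
    · intro s a
      rw [NMap.comp_apply, NMap.elim_inl, NMap.elim_inr (w c d)]
    · intro s a
      rw [NMap.comp_apply, NMap.elim_inr (w d c), NMap.elim_inl]

theorem NMap.Iso.appendAssoc {c d e : List S} :
    NMap.Iso (Δ := Δ)
      (NMap.elim (c := c ++ d) (d := e)
        (NMap.elim (NMap.inl c (d ++ e)) ((NMap.inl d e).comp (NMap.inr c (d ++ e))))
        ((NMap.inr d e).comp (NMap.inr c (d ++ e))))
      (NMap.elim (c := c) (d := d ++ e) ((NMap.inl c d).comp (NMap.inl (c ++ d) e))
        (NMap.elim ((NMap.inr c d).comp (NMap.inl (c ++ d) e)) (NMap.inr (c ++ d) e))) := by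
  have w1 : ∀ s (a : Nm Δ s), NMap.inl c (d ++ e) s (NMap.wk c s a)
      = ((NMap.inl d e).comp (NMap.inr c (d ++ e))) s (NMap.wk d s a) := by
    intros; simp
  have w2 : ∀ s (a : Nm Δ s),
      (NMap.elim (NMap.inl c (d ++ e)) ((NMap.inl d e).comp (NMap.inr c (d ++ e)))) s
        (NMap.wk (c ++ d) s a)
      = ((NMap.inr d e).comp (NMap.inr c (d ++ e))) s (NMap.wk e s a) := by
    intros; rw [NMap.elim_wk]; simp
  have w3 : ∀ s (a : Nm Δ s), ((NMap.inr c d).comp (NMap.inl (c ++ d) e)) s (NMap.wk d s a)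
      = NMap.inr (c ++ d) e s (NMap.wk e s a) := by
    intros; simp
  have w4 : ∀ s (a : Nm Δ s), ((NMap.inl c d).comp (NMap.inl (c ++ d) e)) s (NMap.wk c s a)
      = (NMap.elim ((NMap.inr c d).comp (NMap.inl (c ++ d) e)) (NMap.inr (c ++ d) e)) s
        (NMap.wk (d ++ e) s a) := by
    intros; rw [NMap.elim_wk]; simp
  refine ⟨?_, ?_, ?_, ?_⟩
  · intro s a; rw [NMap.elim_wk, NMap.elim_wk]; simp
  · intro s a; rw [NMap.elim_wk]; simp
  · refine NMap.append_ext (f := (NMap.elim _ _).comp (NMap.elim _ _)) (g := NMap.id _) ?_ ?_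
    · refine NMap.append_ext (f := (NMap.inl _ _).comp ((NMap.elim _ _).comp (NMap.elim _ _)))
        (g := NMap.inl _ _) ?_ ?_
      · intro s a
        rw [NMap.comp_apply, NMap.comp_apply, NMap.elim_inl, NMap.elim_inl, NMap.elim_inl,
          NMap.comp_apply]
      · intro s a
        rw [NMap.comp_apply, NMap.comp_apply, NMap.elim_inl, NMap.elim_inr w1, NMap.comp_apply,
          NMap.elim_inr w4, NMap.elim_inl, NMap.comp_apply]
    · intro s a
      rw [NMap.comp_apply, NMap.elim_inr w2, NMap.comp_apply, NMap.elim_inr w4, NMap.elim_inr w3]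
  · refine NMap.append_ext (f := (NMap.elim _ _).comp (NMap.elim _ _)) (g := NMap.id _) ?_ ?_
    · intro s a
      rw [NMap.comp_apply, NMap.elim_inl, NMap.comp_apply, NMap.elim_inl, NMap.elim_inl]
    · refine NMap.append_ext (f := (NMap.inr _ _).comp ((NMap.elim _ _).comp (NMap.elim _ _)))
        (g := NMap.inr _ _) ?_ ?_
      · intro s a
        rw [NMap.comp_apply, NMap.comp_apply, NMap.elim_inr w4, NMap.elim_inl, NMap.comp_apply,
          NMap.elim_inl, NMap.elim_inr w1, NMap.comp_apply]
      · intro s a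
        rw [NMap.comp_apply, NMap.comp_apply, NMap.elim_inr w4, NMap.elim_inr w3,
          NMap.elim_inr w2, NMap.comp_apply]

theorem NMap.merge_wk {s : S} {c : List S} (r : S) (a : Nm Δ r) :
    NMap.merge s c r (NMap.wk c r (NMap.wk [s] r a)) = NMap.wk (s :: c) r a :=
  NMap.merge_wk_wk _ _ _ _

theorem NMap.swap_up_left (s t : S) (c : List S) (r : S) (a : Nm (c :: [t] :: [s] :: Δ) r) :
    (NMap.swap t s).up c r ((NMap.swap s t).up c r a) = a := by
  have := congrFun (congrFun (NMap.up_comp (NMap.swap (Δ := Δ) s t) (NMap.swap t s) c) r) a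
  rw [NMap.swap_swap] at this
  simp at this ⊢

/-- Exchange of the two outermost names of a block. -/
def NMap.exch (s t : S) (c : List S) : NMap ((s :: t :: c) :: Δ) ((t :: s :: c) :: Δ) :=
  (NMap.split s (t :: c)).comp ((NMap.split t c).comp (((NMap.swap s t).up c).comp
    ((NMap.merge s c).comp (NMap.merge t (s :: c)))))

theorem NMap.Iso.exch {s t : S} {c : List S} :
    NMap.Iso (Δ := Δ) (NMap.exch s t c) (NMap.exch t s c) := by
  have w : ∀ (s t : S), (NMap.exch (Δ := Δ) s t c).Over := by
    intro s t r a
    simp only [NMap.exch, NMap.comp_apply]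
    rw [NMap.split_wk, NMap.split_wk, NMap.up_wk, NMap.swap_wk_wk, NMap.merge_wk, NMap.merge_wk]
  have l : ∀ (s t r : S) (a : Nm ((s :: t :: c) :: Δ) r),
      NMap.exch t s c r (NMap.exch s t c r a) = a := by
    intro s t r a
    simp only [NMap.exch, NMap.comp_apply]
    rw [NMap.split_merge, NMap.split_merge, NMap.swap_up_left, NMap.merge_split, NMap.merge_split]
  exact ⟨w s t, w t s, l s t, l t s⟩

theorem NMap.inl_merge (s : S) (c d : List S) :
    (NMap.inl c d).comp (NMap.merge s (c ++ d))
      = (NMap.merge s c).comp (NMap.inl (Δ := Δ) (s :: c) d) := by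
  funext r b
  have := NMap.split_inl (Δ := Δ) s c d r (NMap.merge s c r b)
  rw [NMap.split_merge] at this
  rw [NMap.comp_apply, NMap.comp_apply, ← this, NMap.merge_split]

theorem NMap.inr_merge (s : S) (c d : List S) :
    ((NMap.wk [s]).up d).comp ((NMap.inr c d).comp (NMap.merge s (c ++ d)))
      = NMap.inr (Δ := Δ) (s :: c) d := by
  funext r b
  have := NMap.split_inr (Δ := Δ) s c d r b
  rw [NMap.comp_apply, NMap.comp_apply, ← this, NMap.merge_split]

theorem Conf.guards_par {c c' : Conf ob Δ Γ} (h : ∀ g ∈ c.2, Guard g) (h' : ∀ g ∈ c'.2, Guard g) :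
    ∀ g ∈ (c.par c').2, Guard g := by
  intro g hg
  rcases Multiset.mem_add.1 hg with hg | hg
  · obtain ⟨g', h1, rfl⟩ := Multiset.mem_map.1 hg
    exact (h g' h1).ren _ _
  · obtain ⟨g', h1, rfl⟩ := Multiset.mem_map.1 hg
    exact (h' g' h1).ren _ _

theorem Conf.par_nil {c : Conf ob Δ Γ} (h : ∀ g ∈ c.2, Guard g) : (c.par ⟨[], 0⟩).Rel c := by
  refine ⟨_, _, NMap.Iso.appendNil, ?_⟩
  obtain ⟨c, M⟩ := c
  have h1 : (NMap.inl c []).comp (NMap.elim (NMap.id (c :: Δ)) NMap.ofNil)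
      = NMap.id _ := by
    funext s a; exact NMap.elim_inl _ _ s a
  have e1 : ((M.map fun T => T.ren (NMap.inl c []) (fun _ x => x))
      + (0 : Multiset (Tm ob ([] :: Δ) Γ .proc)).map fun T =>
        T.ren (NMap.inr c []) (fun _ x => x)).map
        (fun T => T.ren (NMap.elim (NMap.id (c :: Δ)) NMap.ofNil) (fun _ x => x)) = M := by
    simp only [Multiset.map_zero, add_zero, Multiset.map_map, Function.comp_def,
      Tm.ren_comp, h1, Tm.ren_id, Multiset.map_id']
  exact (congrArg (fun X => Multiset.Rel GRel X _) e1).mpr (rel_gRel_refl h)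

theorem Conf.par_comm {c c' : Conf ob Δ Γ} (h : ∀ g ∈ c.2, Guard g) (h' : ∀ g ∈ c'.2, Guard g) :
    (c.par c').Rel (c'.par c) := by
  refine ⟨_, _, NMap.Iso.appendComm, ?_⟩
  have h1 : (NMap.inl c.1 c'.1).comp (NMap.elim (NMap.inr c'.1 c.1) (NMap.inl c'.1 c.1))
      = NMap.inr (Δ := Δ) c'.1 c.1 := by
    funext s a; exact NMap.elim_inl _ _ s a
  have h2 : (NMap.inr c.1 c'.1).comp (NMap.elim (NMap.inr c'.1 c.1) (NMap.inl c'.1 c.1))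
      = NMap.inl (Δ := Δ) c'.1 c.1 := by
    funext s a; exact NMap.elim_inr (by simp) s a
  have := rel_gRel_refl (Conf.guards_par h' h)
  simp only [Conf.par, Multiset.map_add, Multiset.map_map, Function.comp_def,
    Tm.ren_comp, h1, h2] at this ⊢
  rwa [add_comm]

theorem Conf.par_assoc {c c' c'' : Conf ob Δ Γ} (h : ∀ g ∈ c.2, Guard g)
    (h' : ∀ g ∈ c'.2, Guard g) (h'' : ∀ g ∈ c''.2, Guard g) :
    ((c.par c').par c'').Rel (c.par (c'.par c'')) := by
  refine ⟨_, _, NMap.Iso.appendAssoc, ?_⟩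
  have := rel_gRel_refl (Conf.guards_par h (Conf.guards_par h' h''))
  obtain ⟨c, M⟩ := c
  obtain ⟨d, N⟩ := c'
  obtain ⟨e, K⟩ := c''
  set f := (NMap.elim (Δ := Δ) (c := c ++ d) (d := e)
        (NMap.elim (NMap.inl c (d ++ e)) ((NMap.inl d e).comp (NMap.inr c (d ++ e))))
        ((NMap.inr d e).comp (NMap.inr c (d ++ e)))) with hf
  have h1 : ((NMap.inl c d).comp (NMap.inl (c ++ d) e)).comp f = NMap.inl (Δ := Δ) c (d ++ e) := by
    funext s a
    rw [NMap.comp_apply, NMap.comp_apply, hf, NMap.elim_inl, NMap.elim_inl]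
  have h2 : ((NMap.inr c d).comp (NMap.inl (c ++ d) e)).comp f
      = (NMap.inl d e).comp (NMap.inr (Δ := Δ) c (d ++ e)) := by
    funext s a
    rw [NMap.comp_apply, NMap.comp_apply, hf, NMap.elim_inl, NMap.elim_inr (by simp)]
  have h3 : (NMap.inr (c ++ d) e).comp f
      = (NMap.inr d e).comp (NMap.inr (Δ := Δ) c (d ++ e)) := by
    funext s a
    rw [NMap.comp_apply, hf, NMap.elim_inr]
    intro s a; rw [NMap.elim_wk]; simp
  have e1 : ((((M.map fun T => T.ren (NMap.inl c d) (fun _ x => x))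
      + (N.map fun T => T.ren (NMap.inr c d) (fun _ x => x))).map
        fun T => T.ren (NMap.inl (c ++ d) e) (fun _ x => x))
      + (K.map fun T => T.ren (NMap.inr (c ++ d) e) (fun _ x => x))).map
        (fun T => T.ren f (fun _ x => x)) =
      (M.map fun T => T.ren (NMap.inl c (d ++ e)) (fun _ x => x)) +
      (((N.map fun T => T.ren (NMap.inl d e) (fun _ x => x))
      + (K.map fun T => T.ren (NMap.inr d e) (fun _ x => x))).map
        fun T => T.ren (NMap.inr c (d ++ e)) (fun _ x => x)) := by
    simp only [Multiset.map_add, Multiset.map_map, Function.comp_def, Tm.ren_comp, h1, h2, h3,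
      add_assoc]
  exact e1 ▸ this

theorem Conf.nu_comm {s t : S} {c : Conf ob ([t] :: [s] :: Δ) Γ} (h : ∀ g ∈ c.2, Guard g) :
    ((c.nu t).nu s).Rel (((c.ren (NMap.swap s t)).nu s).nu t) := by
  refine ⟨_, _, NMap.Iso.exch, ?_⟩
  obtain ⟨c, M⟩ := c
  have e1 : ((M.map fun T => T.ren (NMap.merge t c) (fun _ x => x)).map
        fun T => T.ren (NMap.merge s (t :: c)) (fun _ x => x)).map
        (fun T => T.ren (NMap.exch s t c) (fun _ x => x)) =
      ((M.map fun T => T.ren ((NMap.swap s t).up c) (fun _ x => x)).map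
        fun T => T.ren (NMap.merge s c) (fun _ x => x)).map
        (fun T => T.ren (NMap.merge t (s :: c)) (fun _ x => x)) := by
    simp only [Multiset.map_map, Function.comp_def, Tm.ren_comp]
    congr 1
    funext T
    congr 1
    funext r a
    simp only [NMap.exch, NMap.comp_apply, NMap.split_merge]
  refine (congrArg (fun X => Multiset.Rel GRel X _) e1).mpr (rel_gRel_refl ?_)
  simp only [Multiset.mem_map]
  rintro _ ⟨_, ⟨_, ⟨g, hg, rfl⟩, rfl⟩, rfl⟩
  exact (((h g hg).ren _ _).ren _ _).ren _ _

theorem Conf.nu_par {s : S} {c : Conf ob ([s] :: Δ) Γ} {c' : Conf ob Δ Γ} :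
    ((c.par (c'.ren (NMap.wk [s]))).nu s) = (c.nu s).par c' := by
  obtain ⟨c, M⟩ := c
  obtain ⟨d, N⟩ := c'
  refine Conf.ext (d := s :: (c ++ d)) (M := ((M.map fun T => T.ren (NMap.inl c d) (fun _ x => x))
      + ((N.map fun T => T.ren ((NMap.wk [s]).up d) (fun _ x => x)).map
        fun T => T.ren (NMap.inr c d) (fun _ x => x))).map
        fun T => T.ren (NMap.merge s (c ++ d)) (fun _ x => x))
    (N := ((M.map fun T => T.ren (NMap.merge s c) (fun _ x => x)).map
        fun T => T.ren (NMap.inl (s :: c) d) (fun _ x => x))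
      + (N.map fun T => T.ren (NMap.inr (s :: c) d) (fun _ x => x))) ?_
  simp only [Multiset.map_add, Multiset.map_map, Function.comp_def, Tm.ren_comp, NMap.inl_merge]
  congr 2
  rw [← NMap.inr_merge]
  rfl

theorem Conf.rel_guard {g g' : Tm ob Δ Γ .proc} (h : GRel g g') :
    Conf.Rel (⟨[], {g.wkN []}⟩ : Conf ob Δ Γ) ⟨[], {g'.wkN []}⟩ := by
  refine ⟨NMap.id _, NMap.id _, NMap.Iso.id, ?_⟩
  simp only [Tm.ren_id, ← Multiset.cons_zero]
  exact .cons (h.ren _ _) .zero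

/-- Processes with the same value under evaluation, up to a permutation of restrictions. -/
def evalBase (ob : S → Ty S) (Γ : List (List (Ty S))) : Base ob Γ where
  rel T V := ∃ c c', Eval T c ∧ Eval V c' ∧ c.Rel c'
  symm := fun ⟨c, c', h, h', r⟩ => ⟨c', c, h', h, r.symm⟩
  trans := by
    rintro Δ T V W ⟨c, c', h, h', r⟩ ⟨d, d', k, k', r'⟩
    cases h'.det k
    exact ⟨_, _, h, k', r.trans r'⟩
  ren := fun f ⟨c, c', h, h', r⟩ => ⟨_, _, h.ren f, h'.ren f, r.ren f⟩
  head := fun hh ⟨c, c', h, h', r⟩ => ⟨_, _, .head hh h, h', r⟩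
  nil := ⟨_, _, .nil, .nil, Conf.Rel.refl (by simp)⟩
  par := fun ⟨_, _, h, h', r⟩ ⟨_, _, k, k', r'⟩ => ⟨_, _, .par h k, .par h' k', r.par r'⟩
  parNil := fun ⟨_, _, h, _, _⟩ => ⟨_, _, .par h .nil, h, Conf.par_nil h.guards⟩
  parComm := fun ⟨_, _, h, _, _⟩ ⟨_, _, k, _, _⟩ =>
    ⟨_, _, .par h k, .par k h, Conf.par_comm h.guards k.guards⟩
  parAssoc := fun ⟨_, _, h, _, _⟩ ⟨_, _, k, _, _⟩ ⟨_, _, l, _, _⟩ =>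
    ⟨_, _, .par (.par h k) l, .par h (.par k l), Conf.par_assoc h.guards k.guards l.guards⟩
  nu := fun s _ _ ⟨_, _, h, h', r⟩ => ⟨_, _, .nu s h, .nu s h', r.nu⟩
  nuComm := fun s t _ ⟨_, _, h, _, _⟩ =>
    ⟨_, _, .nu s (.nu t h), .nu t (.nu s (h.ren _)), Conf.nu_comm h.guards⟩
  nuPar := fun s _ _ ⟨_, _, h, _, _⟩ ⟨_, _, k, _, _⟩ =>
    ⟨_, _, .nu s (.par h (k.ren _)), .par (.nu s h) k, by
      rw [Conf.nu_par]
      exact Conf.Rel.refl (Eval.par (.nu s h) k).guards⟩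
  inp := fun h a _ _ hc => ⟨_, _, .guard (.inp h a _), .guard (.inp h a _),
    Conf.rel_guard (GRel.inp h a hc)⟩
  rinp := fun h a _ _ hc => ⟨_, _, .guard (.rinp h a _), .guard (.rinp h a _),
    Conf.rel_guard (GRel.rinp h a hc)⟩
  out := fun h a _ _ _ _ hc hc' => ⟨_, _, .guard (.out h a _ _), .guard (.out h a _ _),
    Conf.rel_guard (GRel.out h a hc hc')⟩
  rout := fun h a _ _ _ _ hc hc' => ⟨_, _, .guard (.rout h a _ _), .guard (.rout h a _ _),
    Conf.rel_guard (GRel.rout h a hc hc')⟩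

theorem Eval.bigPar {M : Multiset (Tm ob Δ Γ .proc)} (hM : ∀ g ∈ M, Guard g) :
    Eval (bigPar M) ⟨[], M.map (Tm.wkN [])⟩ := by
  have : ∀ l : List (Tm ob Δ Γ .proc), (∀ g ∈ l, Guard g) →
      Eval (l.foldr Tm.par .nil) ⟨[], (l : Multiset _).map (Tm.wkN [])⟩ := by
    intro l
    induction l with
    | nil => intro _; exact .nil
    | cons g l ih =>
      intro h
      have := Eval.par (Eval.guard (h g (by simp))) (ih fun g hg => h g (by simp [hg]))
      refine (Conf.ext (d := []) ?_ : _ = _) ▸ this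
      have h1 : NMap.inl (Δ := Δ) [] [] = NMap.id _ :=
        NMap.block_ext (fun s a => by simp [NMap.id]) (fun s x => nomatch x)
      have h2 : NMap.inr (Δ := Δ) [] [] = NMap.id _ :=
        NMap.block_ext (fun s a => by simp [NMap.id]) (fun s x => nomatch x)
      simp only [h1, h2, Tm.ren_id, Multiset.map_id']
      rw [← Multiset.cons_coe, Multiset.map_cons, Multiset.singleton_add]
  have h := this M.toList fun g hg => hM g (Multiset.mem_toList.1 hg)
  rwa [Multiset.coe_toList] at h

theorem Eval.nuB {d : List S} : ∀ {Δ : List (List S)} {T : Tm ob (d :: Δ) Γ .proc}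
    {M : Multiset (Tm ob (d :: Δ) Γ .proc)} (_ : Eval T ⟨[], M.map (Tm.wkN [])⟩),
    Eval (nuB d T) ⟨d, M⟩ := by
  induction d with
  | nil =>
    intro Δ T M h
    have := h.ren NMap.drop
    refine (Conf.ext (d := []) ?_ : _ = _) ▸ this
    simp only [Multiset.map_map, Function.comp_def, Tm.wkN, Tm.ren_comp]
    have h1 : (NMap.wk []).comp (NMap.drop.up []) = NMap.id ([] :: Δ) :=
      NMap.block_ext (fun s a => by cases a <;> rfl) (fun s x => nomatch x)
    simp [h1]
  | cons s d ih =>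
    intro Δ T M h
    have h1 : Eval (T.ren (NMap.split s d) (fun _ x => x)) ⟨[], (M.map (Tm.wkN [])).map
        fun T => T.ren ((NMap.split s d).up []) (fun _ x => x)⟩ := h.ren (NMap.split s d)
    have h2 := ih (M := M.map fun T => T.ren (NMap.split s d) (fun _ x => x)) (by
      refine (Conf.ext (d := []) ?_ : _ = _) ▸ h1
      simp only [Multiset.map_map, Function.comp_def, Tm.wkN, Tm.ren_comp]
      congr 1; funext T; congr 1; funext r a; simp)
    have h3 := h2.nu s
    refine (Conf.ext (d := s :: d) ?_ : _ = _) ▸ h3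
    have h1 : (NMap.split s d).comp (NMap.merge s d) = NMap.id ((s :: d) :: Δ) := by
      funext r a; simp [NMap.id]
    simp [Tm.ren_comp, h1]

/-- Evaluation of a parallel composition of prefixed processes below restrictions. -/
theorem Eval.nuB_bigPar {d : List S} {M : Multiset (Tm ob (d :: Δ) Γ .proc)}
    (hM : ∀ g ∈ M, Guard g) : Eval (HO.nuB d (HO.bigPar M)) ⟨d, M⟩ :=
  Eval.nuB (Eval.bigPar hM)

theorem Tm.sub_empty {τ : Ty S} (T : Tm ob Δ [] τ) (σ : Sub ob Δ [] []) : T.sub σ = T := by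
  have : σ = fun _ x => .var x := by funext τ x; cases x
  rw [this, Tm.sub_var]

/-- Structurally congruent processes without free variables have equal values. -/
theorem Cong.exists_eval {T V : Tm ob Δ [] .proc} (h : Cong T V) :
    ∃ c c', Eval T c ∧ Eval V c' ∧ c.Rel c' := by
  have := Base.L.of_cong (B := evalBase ob []) h (NMap.id _) (fun _ x => nomatch x)
    (fun _ x => nomatch x) (fun _ x => nomatch x)
  rw [Base.L_proc, Tm.sub_empty, Tm.sub_empty, Tm.ren_id, Tm.ren_id] at this
  exact this.2

/-- Parallel compositions of prefixed processes below restrictions are structurally congruent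
only if they agree componentwise. -/
theorem rel_of_cl_eq {c d : List S} {M : Multiset (Tm ob (c :: Δ) [] .proc)}
    {N : Multiset (Tm ob (d :: Δ) [] .proc)} (hM : ∀ g ∈ M, Guard g) (hN : ∀ g ∈ N, Guard g)
    (h : cl (nuB c (bigPar M)) = cl (nuB d (bigPar N))) :
    Conf.Rel (⟨c, M⟩ : Conf ob Δ []) ⟨d, N⟩ := by
  obtain ⟨c', d', h1, h2, h3⟩ := (cl_eq.1 h).exists_eval
  rwa [h1.det (Eval.nuB_bigPar hM), h2.det (Eval.nuB_bigPar hN)] at h3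

/-- Joining two consecutive blocks of names. -/
def NMap.join (c d : List S) : NMap (d :: c :: Δ) ((c ++ d) :: Δ)
  | _, .const n => .const n
  | s, .var (.here x) => NMap.inr c d s (.var (.here x))
  | s, .var (.there x) => NMap.inl c d s (.var x)

theorem NMap.wk_join (c d : List S) :
    (NMap.wk d).comp (NMap.join c d) = NMap.inl (Δ := Δ) c d := by
  funext s a; rcases a with n | x | x <;> rfl

theorem NMap.join_splitApp (c d : List S) :
    (NMap.join c d).comp (NMap.splitApp c d) = NMap.id (d :: c :: Δ) := by
  apply NMap.block_ext
  · intro s a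
    have := NMap.splitApp_inl (Δ := Δ) c d s a
    rw [← NMap.wk_join] at this
    exact this
  · intro s x
    exact NMap.splitApp_inr c d s (.var (.here x))

theorem cl_nuB_nuB (c d : List S) (T : Tm ob (d :: c :: Δ) Γ .proc) :
    cl (nuB c (nuB d T)) = cl (nuB (c ++ d) (T.ren (NMap.join c d) (fun _ x => x))) := by
  rw [cl_nuB_append, Tm.ren_comp, NMap.join_splitApp, Tm.ren_id]

/-- If part of a process consists of prefixed processes then these are, up to renaming of the
restricted names and structural congruence, among the components of any presentation as a
parallel composition of prefixed processes; and replacing them on both sides by another process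
gives structurally congruent processes. -/
theorem exists_match {d e : List S} {L : Multiset (Tm ob (d :: Δ) [] .proc)}
    {R : Tm ob (d :: Δ) [] .proc} {M : Multiset (Tm ob (e :: Δ) [] .proc)}
    (hL : ∀ g ∈ L, Guard g) (hM : ∀ g ∈ M, Guard g)
    (h : cl (nuB d (.par (bigPar L) R)) = cl (nuB e (bigPar M))) :
    ∃ (θ : NMap (d :: Δ) (e :: Δ)) (L' M' : Multiset (Tm ob (e :: Δ) [] .proc)),
      θ.Over ∧ M = L' + M' ∧ Multiset.Rel GRel (L.map fun T => T.ren θ (fun _ x => x)) L' ∧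
      ∀ Y : Tm ob (d :: Δ) [] .proc, cl (nuB d (.par Y R))
        = cl (nuB e (.par (Y.ren θ (fun _ x => x)) (bigPar M'))) := by
  -- with `R` evaluated, both sides are parallel compositions of prefixed processes
  obtain ⟨⟨r, N⟩, -, hR, -, -⟩ := (Cong.refl R).exists_eval
  have key : ∀ Y : Tm ob (d :: Δ) [] .proc, cl (nuB d (.par Y R)) =
      cl (nuB (d ++ r) (.par (Y.ren (NMap.inl d r) (fun _ x => x))
        (bigPar (N.map fun T => T.ren (NMap.join d r) (fun _ x => x))))) := by
    intro Y
    rw [nuB_eq (T' := nuB r (.par (Y.wkN r) (bigPar N))), cl_nuB_nuB]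
    · refine nuB_eq ?_
      simp only [Tm.ren, cl_par, Tm.wkN, Tm.ren_comp, NMap.wk_join, cl_bigPar_ren]
    · rw [cl_par, hR.cl_eq, add_comm, ← cl_nuB_par]
      exact nuB_eq (by rw [cl_par, cl_par, add_comm])
  have hN' : ∀ g ∈ N.map fun T => T.ren (NMap.join d r) (fun _ x => x), Guard g := by
    intro g hg
    obtain ⟨g', h', rfl⟩ := Multiset.mem_map.1 hg
    exact (hR.guards g' h').ren _ _
  have hL' : ∀ g ∈ L.map fun T => T.ren (NMap.inl d r) (fun _ x => x), Guard g := by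
    intro g hg
    obtain ⟨g', h', rfl⟩ := Multiset.mem_map.1 hg
    exact (hL g' h').ren _ _
  rw [key, nuB_eq (T' := bigPar ((L.map fun T => T.ren (NMap.inl d r) (fun _ x => x))
    + N.map fun T => T.ren (NMap.join d r) (fun _ x => x)))
    (by rw [cl_bigPar_add, cl_par, cl_bigPar_ren])] at h
  obtain ⟨f, g, hi, hrel⟩ := rel_of_cl_eq (fun g hg => (Multiset.mem_add.1 hg).elim (hL' g) (hN' g))
    hM h
  simp only [Multiset.map_add] at hrel
  obtain ⟨L', M', h1, h2, rfl⟩ := Multiset.rel_add_left.1 hrel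
  refine ⟨(NMap.inl d r).comp f, L', M', ?_, rfl, ?_, ?_⟩
  · intro s a
    rw [NMap.comp_apply, NMap.inl_wk]; exact hi.fix s a
  · simpa only [Multiset.map_map, Function.comp_def, Tm.ren_comp] using h1
  · intro Y
    rw [key, cl_nuB_iso _ hi]
    refine nuB_eq ?_
    simp only [Tm.ren, cl_par, Tm.ren_comp]
    rw [cl_bigPar_ren, cl_bigPar_congr h2]

end Eval

/-! ### Transitions of parallel compositions of prefixed processes -/

section Transitions

variable {Δ Δ' : List (List S)} {Γ Γ' : List (List (Ty S))}

theorem InG.gRel {g g' : Tm ob Δ Γ .proc} {s : S} {τ : Ty S} {a : Nm Δ s}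
    {T : Tm ob Δ ([τ] :: Γ) .proc} (h : InG g a T) (hg : GRel g g') :
    ∃ T', InG g' a T' ∧ cl T = cl T' := by
  cases h with
  | inp h a T => cases hg with | inp _ _ h1 => exact ⟨_, .inp _ _ _, cl_eq.2 h1⟩
  | rinp h a T =>
    cases hg with
    | rinp _ _ h1 =>
      exact ⟨_, .rinp _ _ _, cl_eq.2 (.par h1 (Cong.ren (.rinp h a h1) _ _))⟩

theorem OutG.gRel {g g' : Tm ob Δ Γ .proc} {s : S} {τ : Ty S} {a : Nm Δ s}
    {B : Tm ob Δ Γ τ} {V : Tm ob Δ Γ .proc} (h : OutG g a B V) (hg : GRel g g') :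
    ∃ B' V', OutG g' a B' V' ∧ cl B = cl B' ∧ cl V = cl V' := by
  cases h with
  | out h a B V =>
    cases hg with | out _ _ h1 h2 => exact ⟨_, _, .out _ _ _ _, cl_eq.2 h1, cl_eq.2 h2⟩
  | rout h a B V =>
    cases hg with
    | rout _ _ h1 h2 =>
      exact ⟨_, _, .rout _ _ _ _, cl_eq.2 h1, cl_eq.2 (.par h2 (.rout h a h1 h2))⟩

theorem InG.guard {g : Tm ob Δ Γ .proc} {s : S} {τ : Ty S} {a : Nm Δ s}
    {T : Tm ob Δ ([τ] :: Γ) .proc} (h : InG g a T) : Guard g := by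
  cases h with
  | inp => exact .inp _ _ _
  | rinp => exact .rinp _ _ _

theorem OutG.guard {g : Tm ob Δ Γ .proc} {s : S} {τ : Ty S} {a : Nm Δ s}
    {B : Tm ob Δ Γ τ} {V : Tm ob Δ Γ .proc} (h : OutG g a B V) : Guard g := by
  cases h with
  | out => exact .out _ _ _ _
  | rout => exact .rout _ _ _ _

/-- Inputs of an instance of a prefixed process come from the prefixed process. -/
theorem InG.of_sub {g : Tm ob Δ Γ .proc} (hg : Guard g) {f : NMap Δ Δ'} {σ : Sub ob Δ' Γ Γ'}
    {s : S} {τ : Ty S} {a : Nm Δ' s} {T : Tm ob Δ' ([τ] :: Γ') .proc}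
    (h : InG ((g.ren f (fun _ x => x)).sub σ) a T) :
    ∃ b T', InG g b T' ∧ a = f s b ∧ T = (T'.ren f (fun _ x => x)).sub (σ.upV _) := by
  cases hg with
  | inp hs b T0 =>
    simp only [Tm.ren, Tm.sub, VMap.up_id'] at h
    cases h
    exact ⟨b, T0, .inp _ _ _, rfl, rfl⟩
  | rinp hs b T0 =>
    have h1 := Tm.wkV_ren (Tm.rinp hs b T0) [τ] f (fun _ x => x)
    have h2 := Tm.wkV_sub ((Tm.rinp hs b T0).ren f (fun _ x => x)) [τ] σ
    rw [VMap.up_id'] at h1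
    simp only [Tm.ren, Tm.sub, VMap.up_id'] at h h1 h2
    cases h
    refine ⟨b, _, .rinp _ _ _, rfl, ?_⟩
    simp only [Tm.ren, Tm.sub, h1, h2]
  | out => simp only [Tm.ren, Tm.sub] at h; cases h
  | rout => simp only [Tm.ren, Tm.sub] at h; cases h

/-- Outputs of an instance of a prefixed process come from the prefixed process. -/
theorem OutG.of_sub {g : Tm ob Δ Γ .proc} (hg : Guard g) {f : NMap Δ Δ'} {σ : Sub ob Δ' Γ Γ'}
    {s : S} {τ : Ty S} {a : Nm Δ' s} {B : Tm ob Δ' Γ' τ} {V : Tm ob Δ' Γ' .proc}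
    (h : OutG ((g.ren f (fun _ x => x)).sub σ) a B V) :
    ∃ b B' V', OutG g b B' V' ∧ a = f s b ∧ B = (B'.ren f (fun _ x => x)).sub σ ∧
      V = (V'.ren f (fun _ x => x)).sub σ := by
  cases hg with
  | inp => simp only [Tm.ren, Tm.sub] at h; cases h
  | rinp => simp only [Tm.ren, Tm.sub] at h; cases h
  | out hs b B0 V0 =>
    simp only [Tm.ren, Tm.sub] at h
    cases h
    exact ⟨b, B0, V0, .out _ _ _ _, rfl, rfl, rfl⟩
  | rout hs b B0 V0 =>
    simp only [Tm.ren, Tm.sub] at h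
    cases h
    exact ⟨b, B0, _, .rout _ _ _ _, rfl, rfl, rfl⟩

theorem rel_pair_left {α β : Type*} {r : α → β → Prop} {a b : α} {M : Multiset β}
    (h : Multiset.Rel r (a ::ₘ b ::ₘ 0) M) : ∃ a' b', M = a' ::ₘ b' ::ₘ 0 ∧ r a a' ∧ r b b' := by
  obtain ⟨a', M', ha, h', rfl⟩ := Multiset.rel_cons_left.1 h
  obtain ⟨b', M'', hb, h'', rfl⟩ := Multiset.rel_cons_left.1 h'
  rw [Multiset.rel_zero_left] at h''
  exact ⟨a', b', by rw [h''], ha, hb⟩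

theorem Tm.wkN_over {τ : Ty S} {d e : List S} {θ : NMap (d :: Δ) (e :: Δ)} (hθ : θ.Over)
    (A : Tm ob Δ Γ τ) : (A.wkN d).ren θ (fun _ x => x) = A.wkN e := by
  rw [Tm.wkN, Tm.ren_comp]
  congr 1
  funext s a
  exact hθ s a

/-- The internal moves of a parallel composition of prefixed processes. -/
theorem Step.tau_canon {P P' : Proc ob} (h : Step P .tau P') {e : List S}
    {M : Multiset (Tm ob [e] [] .proc)} (hM : ∀ g ∈ M, Guard g)
    (hP : cl P = cl (nuB e (bigPar M))) :
    ∃ (s : S) (τ : Ty S) (a : Nm [e] s) (g g' : Tm ob [e] [] .proc) (T : Tm ob [e] [[τ]] .proc)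
      (B : Tm ob [e] [] τ) (V : Tm ob [e] [] .proc) (M' : Multiset (Tm ob [e] [] .proc)),
      M = g ::ₘ g' ::ₘ M' ∧ InG g a T ∧ OutG g' a B V ∧
        cl P' = cl (nuB e (.par (T.fill B) (.par V (bigPar M')))) := by
  obtain ⟨d, s, τ, a, g, g', T, B, V, R, hg, hg', h1, h2⟩ := h.shape
  rw [hP, nuB_eq (T' := .par (bigPar (g ::ₘ g' ::ₘ 0)) R)
    (by simp only [cl_par, cl_bigPar_cons, cl_bigPar_zero]; abel)] at h1
  obtain ⟨θ, L', M', -, rfl, hL, hY⟩ := exists_match (by simp [hg.guard, hg'.guard]) hM h1.symm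
  simp only [Multiset.map_cons, Multiset.map_zero] at hL
  obtain ⟨q, q', rfl, hq, hq'⟩ := rel_pair_left hL
  obtain ⟨T', hT', eT⟩ := (hg.ren' θ).gRel hq
  obtain ⟨B', V', hB', eB, eV⟩ := (hg'.ren θ (fun _ x => x)).gRel hq'
  refine ⟨s, τ, θ s a, q, q', T', B', V', M', by simp, hT', hB', ?_⟩
  rw [h2, nuB_eq (T' := .par (.par (T.fill B) V) R) (by simp only [cl_par]; abel), hY]
  refine nuB_eq ?_
  simp only [Tm.ren, cl_par, Tm.fill_ren', eV, cl_fill eT eB]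
  abel

/-- The inputs of a parallel composition of prefixed processes. -/
theorem Step.inp_canon {P P' : Proc ob} {a : NameConst S} {τ : Ty S} {A : Closed ob τ}
    (h : Step P (.inp a A) P') {e : List S}
    {M : Multiset (Tm ob [e] [] .proc)} (hM : ∀ g ∈ M, Guard g)
    (hP : cl P = cl (nuB e (bigPar M))) :
    ∃ (g : Tm ob [e] [] .proc) (T : Tm ob [e] [[τ]] .proc) (M' : Multiset (Tm ob [e] [] .proc)),
      M = g ::ₘ M' ∧ InG g (.const a.idx : Nm [e] a.sort) T ∧
        cl P' = cl (nuB e (.par (T.fill (A.wkN e)) (bigPar M'))) := by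
  obtain ⟨d, g, T, R, hg, h1, h2⟩ := h.shape
  rw [hP, nuB_eq (T' := .par (bigPar {g}) R) (by simp only [cl_par, cl_bigPar_singleton])] at h1
  obtain ⟨θ, L', M', hθ, rfl, hL, hY⟩ := exists_match (by simp [hg.guard]) hM h1.symm
  rw [Multiset.map_singleton, ← Multiset.cons_zero] at hL
  obtain ⟨q, L'', hq, hL', rfl⟩ := Multiset.rel_cons_left.1 hL
  rw [Multiset.rel_zero_left] at hL'
  subst hL'
  obtain ⟨T', hT', eT⟩ := (hg.ren' θ).gRel hq
  rw [show θ a.sort (.const a.idx) = .const a.idx from hθ _ (.const a.idx)] at hT'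
  refine ⟨q, T', M', by simp, hT', ?_⟩
  rw [h2, hY]
  refine nuB_eq ?_
  simp only [cl_par, Tm.fill_ren', Tm.wkN_over hθ, cl_fill eT rfl]

/-- The outputs of a parallel composition of prefixed processes. -/
theorem Step.out_canon {P P' : Proc ob} {cs : List (NameConst S)} {a : NameConst S} {τ : Ty S}
    {B : Closed ob τ} (h : Step P (.out cs a B) P') {e : List S}
    {M : Multiset (Tm ob [e] [] .proc)} (hM : ∀ g ∈ M, Guard g)
    (hP : cl P = cl (nuB e (bigPar M))) :
    ∃ (g : Tm ob [e] [] .proc) (B' : Tm ob [e] [] τ) (V : Tm ob [e] [] .proc)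
      (M' : Multiset (Tm ob [e] [] .proc)),
      M = g ::ₘ M' ∧ OutG g (.const a.idx : Nm [e] a.sort) B' V ∧
        ∀ E : Ctx ob τ .proc, Disjoint {c | c ∈ cs} E.fn →
          cl (HO.resList cs (.par (E.fill B) P'))
            = cl (nuB e (.par ((E.wkN e).fill B') (.par V (bigPar M')))) := by
  obtain ⟨d, g, V, R, B', hg, h1, h2⟩ := OutShape.exists_nuB h.shape
  rw [hP, nuB_eq (T' := .par (bigPar {g}) R) (by simp only [cl_par, cl_bigPar_singleton])] at h1
  obtain ⟨θ, L', M', hθ, rfl, hL, hY⟩ := exists_match (by simp [hg.guard]) hM h1.symm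
  rw [Multiset.map_singleton, ← Multiset.cons_zero] at hL
  obtain ⟨q, L'', hq, hL', rfl⟩ := Multiset.rel_cons_left.1 hL
  rw [Multiset.rel_zero_left] at hL'
  subst hL'
  obtain ⟨B1, V1, hT', eB, eV⟩ := (hg.ren θ (fun _ x => x)).gRel hq
  rw [show θ a.sort (.const a.idx) = .const a.idx from hθ _ (.const a.idx)] at hT'
  refine ⟨q, B1, V1, M', by simp, hT', fun E hE => ?_⟩
  rw [h2 E hE, nuB_eq (T' := .par (.par ((E.wkN d).fill B') V) R) (by simp only [cl_par]; abel),
    hY]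
  refine nuB_eq ?_
  simp only [Tm.ren, cl_par, Tm.fill_ren', Tm.wkN_over hθ, cl_fill rfl eB, eV]
  abel

end Transitions

/-! ### Simulation -/

/-- The clauses of context bisimulation for a single pair of processes. -/
structure Simulates (R : Proc ob → Proc ob → Prop) (P Q : Proc ob) : Prop where
  tau : ∀ P', Step P .tau P' → ∃ Q', Taus Q Q' ∧ R P' Q'
  inp : ∀ P' (a : NameConst S) (τ : Ty S) (A : Closed ob τ), Step P (.inp a A) P' →
    ∃ Q', Weak Q (.inp a A) Q' ∧ R P' Q'
  out : ∀ P' (cs : List (NameConst S)) (a : NameConst S) (τ : Ty S) (A : Closed ob τ),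
    Step P (.out cs a A) P' →
    ∃ (ds : List (NameConst S)) (B : Closed ob τ) (Q' : Proc ob), Weak Q (.out ds a B) Q' ∧
      ∀ E : Ctx ob τ .proc, Disjoint ({c | c ∈ cs} ∪ {d | d ∈ ds}) E.fn →
        R (resList cs (.par (E.fill A) P')) (resList ds (.par (E.fill B) Q'))

theorem IsContextBisim.of_simulates {R : Proc ob → Proc ob → Prop}
    (symm : ∀ P Q, R P Q → R Q P) (h : ∀ P Q, R P Q → Simulates R P Q) : IsContextBisim R where
  symm := symm
  tau P Q P' hR := (h P Q hR).tau P'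
  inp P Q P' a τ A hR := (h P Q hR).inp P' a τ A
  out P Q P' cs a τ A hR := (h P Q hR).out P' cs a τ A

theorem Weak.of_step {P P' : Proc ob} {l : Act ob} (h : Step P l P') : Weak P l P' :=
  ⟨P, P', .refl, h, .refl⟩

theorem Weak.tau_left {P P₁ P' : Proc ob} {l : Act ob} (h : Step P .tau P₁) (h' : Weak P₁ l P') :
    Weak P l P' := by
  obtain ⟨Q, Q', h1, h2, h3⟩ := h'
  exact ⟨Q, Q', .head h h1, h2, h3⟩

theorem Weak.congr {P P' Q : Proc ob} {l : Act ob} (h : Weak P l P') (hQ : cl Q = cl P) :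
    Weak Q l P' := by
  obtain ⟨P₁, P₂, h1, h2, h3⟩ := h
  rcases Relation.ReflTransGen.cases_head h1 with rfl | ⟨c, hc, hc'⟩
  · exact ⟨Q, P₂, .refl, h2.congr hQ rfl, h3⟩
  · exact ⟨P₁, P₂, .head (Step.congr hc hQ rfl) hc', h2, h3⟩

/-- The answering process may make internal moves in advance. -/
theorem Simulates.tau_right {R : Proc ob → Proc ob → Prop} {P Q Q₁ : Proc ob}
    (h : Step Q .tau Q₁) (hs : Simulates R P Q₁) : Simulates R P Q where
  tau P' hP := by
    obtain ⟨Q', h1, h2⟩ := hs.tau P' hP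
    exact ⟨Q', .head h h1, h2⟩
  inp P' a τ A hP := by
    obtain ⟨Q', h1, h2⟩ := hs.inp P' a τ A hP
    exact ⟨Q', h1.tau_left h, h2⟩
  out P' cs a τ A hP := by
    obtain ⟨ds, B, Q', h1, h2⟩ := hs.out P' cs a τ A hP
    exact ⟨ds, B, Q', h1.tau_left h, h2⟩

theorem Simulates.congr {R : Proc ob → Proc ob → Prop}
    (hR : ∀ P Q Q', R P Q → cl Q' = cl Q → R P Q') {P P₁ Q Q₁ : Proc ob}
    (hs : Simulates R P Q) (hP : cl P₁ = cl P) (hQ : cl Q₁ = cl Q) : Simulates R P₁ Q₁ where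
  tau P' h := by
    obtain ⟨Q', h1, h2⟩ := hs.tau P' (h.congr hP.symm rfl)
    rcases Relation.ReflTransGen.cases_head h1 with rfl | ⟨c, hc, hc'⟩
    · exact ⟨Q₁, .refl, hR _ _ _ h2 hQ⟩
    · exact ⟨Q', .head (Step.congr hc hQ rfl) hc', h2⟩
  inp P' a τ A h := by
    obtain ⟨Q', h1, h2⟩ := hs.inp P' a τ A (h.congr hP.symm rfl)
    exact ⟨Q', h1.congr hQ, h2⟩
  out P' cs a τ A h := by
    obtain ⟨ds, B, Q', h1, h2⟩ := hs.out P' cs a τ A (h.congr hP.symm rfl)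
    exact ⟨ds, B, Q', h1.congr hQ, h2⟩

/-! ### Calls, triggers and handlers -/

/-- The kinds of agents `X` that can be factored out: processes, abstractions on an agent and
abstractions on a name.  The first index is the type of `X`, the second one the type of the agents
carried by the trigger name. -/
inductive Kind (S : Type u) : Ty S → Ty S → Type u
  | proc : Kind S .proc .proc
  | agent (τ : Ty S) : Kind S (.pabs τ [] .proc) τ
  | name (t : S) : Kind S (.nabs t [] .proc) (.pabs (.nabs t [] .proc) [] .proc)

section Kinds

variable {Δ Δ' : List (List S)} {Γ Γ' : List (List (Ty S))} {τX τm : Ty S}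

/-- The arguments of an agent of a given kind: none, an agent or a name. -/
def Kind.Arg (ob : S → Ty S) (Δ : List (List S)) (Γ : List (List (Ty S))) :
    ∀ {τX τm : Ty S}, Kind S τX τm → Type u
  | _, _, .proc => PUnit
  | _, _, .agent τ => Tm ob Δ Γ τ
  | _, _, .name t => Nm Δ t

/-- Renaming of an argument. -/
def Kind.Arg.ren : ∀ {τX τm : Ty S} {k : Kind S τX τm}, k.Arg ob Δ Γ → NMap Δ Δ' →
    VMap Γ Γ' → k.Arg ob Δ' Γ'
  | _, _, .proc, _, _, _ => .unit
  | _, _, .agent _, e, f, g => Tm.ren e f g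
  | _, _, .name _, e, f, _ => f _ e

/-- Substitution in an argument. -/
def Kind.Arg.sub : ∀ {τX τm : Ty S} {k : Kind S τX τm}, k.Arg ob Δ Γ → Sub ob Δ Γ Γ' →
    k.Arg ob Δ Γ'
  | _, _, .proc, _, _ => .unit
  | _, _, .agent _, e, σ => Tm.sub e σ
  | _, _, .name _, e, _ => e

/-- The process `X`, `X⟨K⟩` or `X⟨u⟩` in which an agent is used. -/
def Kind.call : ∀ {τX τm : Ty S} (k : Kind S τX τm), Tm ob Δ Γ τX → k.Arg ob Δ Γ →
    Tm ob Δ Γ .proc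
  | _, _, .proc, X, _ => X
  | _, _, .agent _, X, e => .papp X (one e)
  | _, _, .name _, X, e => .napp X (oneN e)

/-- The agent sent along the trigger name to request a call with given argument: `0`, `K` or
`⟨Y⟩(Y⟨u⟩)`. -/
def Kind.enc : ∀ {τX τm : Ty S} (k : Kind S τX τm), k.Arg ob Δ Γ → Tm ob Δ Γ τm
  | _, _, .proc, _ => .nil
  | _, _, .agent _, e => e
  | _, _, .name _, e => .pabs (.napp (.var (.here .zero)) (oneN e))

/-- The trigger `m̄`, `⟨Z⟩m̄Z` or `⟨z⟩m̄[⟨Y⟩(Y⟨z⟩)]`. -/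
def Kind.trig : ∀ {τX τm : Ty S} (_ : Kind S τX τm) {s : S}, ob s = τm → Nm Δ s → Tm ob Δ Γ τX
  | _, _, .proc, _, h, v => .out h v .nil .nil
  | _, _, .agent _, _, h, v => .pabs (.out h v (.var (.here .zero)) .nil)
  | _, _, .name t, s, h, v => .nabs (.out h (NMap.wk [t] s v)
      (.pabs (.napp (.var (.here .zero)) (oneN (.var (.here .zero))))) .nil)

/-- What the handler does with a received agent: `A`, `A⟨Z⟩` or `Z⟨A⟩`. -/
def Kind.body : ∀ {τX τm : Ty S} (_ : Kind S τX τm), Closed ob τX → Tm ob Δ ([τm] :: Γ) .proc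
  | _, _, .proc, A => A.lift _ _
  | _, _, .agent _, A => .papp (A.lift _ _) (one (.var (.here .zero)))
  | _, _, .name _, A => .papp (.var (.here .zero)) (one (A.lift _ _))

/-- The handler `!m.A`, `!m(Z).A⟨Z⟩` or `!m(Z).Z⟨A⟩`. -/
def Kind.hand (k : Kind S τX τm) {s : S} (h : ob s = τm) (v : Nm Δ s) (A : Closed ob τX) :
    Tm ob Δ Γ .proc :=
  .rinp h v (k.body A)

theorem Tm.lift_ren {τ : Ty S} (A : Closed ob τ) (f : NMap Δ Δ') (g : VMap Γ Γ')
    (hf : ∀ c ∈ A.fn, f c.sort (.const c.idx) = .const c.idx) :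
    (A.lift Δ Γ).ren f g = A.lift Δ' Γ' := by
  rw [Tm.lift, Tm.ren_ren, Tm.lift]
  refine (A.ren_congr_closed (f' := fun _ a => match a with | .const n => .const n)
    fun c hc => hf c hc).trans ?_
  congr 1
  funext τ x; cases x

theorem Tm.ren_eq_ren_sub {τ : Ty S} (T : Tm ob Δ Γ τ) (f : NMap Δ Δ') (g : VMap Γ Γ') :
    T.ren f g = (T.ren f (fun _ x => x)).sub (fun τ x => .var (g τ x)) := by
  have := T.ren_sub f g (fun _ x => .var x)
  rwa [Tm.sub_var] at this

theorem Tm.lift_sub {τ : Ty S} (A : Closed ob τ) (σ : Sub ob Δ Γ Γ') :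
    (A.lift Δ Γ).sub σ = A.lift Δ Γ' := by
  rw [Tm.lift, Tm.ren_sub]
  refine Eq.trans ?_ (A.ren_eq_ren_sub _ _).symm
  congr 1
  funext τ x; cases x

theorem Tm.lift_self {τ : Ty S} (A : Closed ob τ) : A.lift [] [] = A := by
  refine Eq.trans ?_ A.ren_id
  rw [Tm.lift]
  congr 1
  · funext s a
    rcases a with n | x
    · rfl
    · cases x
  · funext τ x; cases x

theorem one_map {τ : Ty S} (e : Tm ob Δ Γ τ) (F : ∀ τ, Tm ob Δ Γ τ → Tm ob Δ' Γ' τ) :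
    (fun τ' x => F τ' (one e τ' x)) = one (F τ e) := by
  funext τ' x
  rcases x with _ | x
  · rfl
  · cases x

theorem oneN_map {t : S} (e : Nm Δ t) (f : NMap Δ Δ') :
    (fun s x => f s (oneN e s x)) = oneN (f t e) := by
  funext τ' x
  rcases x with _ | x
  · rfl
  · cases x

theorem one_eta {τ : Ty S} (K : ∀ τ', Pos [τ] τ' → Tm ob Δ Γ τ') : K = one (K τ .zero) := by
  funext τ' x
  rcases x with _ | x
  · rfl
  · cases x

theorem oneN_eta {t : S} (K : ∀ s, Pos [t] s → Nm Δ s) : K = oneN (K t .zero) := by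
  funext τ' x
  rcases x with _ | x
  · rfl
  · cases x

theorem Kind.call_ren (k : Kind S τX τm) (X : Tm ob Δ Γ τX) (e : k.Arg ob Δ Γ) (f : NMap Δ Δ')
    (g : VMap Γ Γ') : (k.call X e).ren f g = k.call (X.ren f g) (e.ren f g) := by
  cases k with
  | proc => rfl
  | agent τ =>
    exact congrArg (Tm.papp (X.ren f g)) (one_map (τ := τm) e fun _ T => T.ren f g)
  | name t =>
    exact congrArg (Tm.napp (X.ren f g)) (oneN_map (t := t) e f)

theorem Kind.call_sub (k : Kind S τX τm) (X : Tm ob Δ Γ τX) (e : k.Arg ob Δ Γ)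
    (σ : Sub ob Δ Γ Γ') : (k.call X e).sub σ = k.call (X.sub σ) (e.sub σ) := by
  cases k with
  | proc => rfl
  | agent τ =>
    exact congrArg (Tm.papp (X.sub σ)) (one_map (τ := τm) e fun _ T => T.sub σ)
  | name t => rfl

theorem Kind.trig_ren (k : Kind S τX τm) {s : S} (h : ob s = τm) (v : Nm Δ s) (f : NMap Δ Δ')
    (g : VMap Γ Γ') : (k.trig h v : Tm ob Δ Γ τX).ren f g = k.trig h (f s v) := by
  cases k with
  | proc => rfl
  | agent τ => rfl
  | name t =>
    simp only [Kind.trig, Tm.ren, VMap.up, NMap.up_wk]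
    rw [oneN_map]
    rfl

theorem Kind.trig_sub (k : Kind S τX τm) {s : S} (h : ob s = τm) (v : Nm Δ s)
    (σ : Sub ob Δ Γ Γ') : (k.trig h v : Tm ob Δ Γ τX).sub σ = k.trig h v := by
  cases k <;> rfl

theorem Kind.body_ren (k : Kind S τX τm) (A : Closed ob τX) (f : NMap Δ Δ') (g : VMap Γ Γ')
    (hf : ∀ c ∈ A.fn, f c.sort (.const c.idx) = .const c.idx) :
    (k.body A : Tm ob Δ ([τm] :: Γ) .proc).ren f (g.up _) = k.body A := by
  cases k with
  | proc => exact A.lift_ren _ _ hf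
  | agent τ =>
    simp only [Kind.body, Tm.ren, A.lift_ren _ _ hf]
    rw [one_map (F := fun _ T => T.ren f (g.up _))]
    rfl
  | name t =>
    simp only [Kind.body, Tm.ren]
    rw [one_map (F := fun _ T => T.ren f (g.up _)), A.lift_ren _ _ hf]
    rfl

theorem Kind.body_sub (k : Kind S τX τm) (A : Closed ob τX) (σ : Sub ob Δ Γ Γ') :
    (k.body A : Tm ob Δ ([τm] :: Γ) .proc).sub (σ.upV _) = k.body A := by
  cases k with
  | proc => exact A.lift_sub _
  | agent τ =>
    simp only [Kind.body, Tm.sub, A.lift_sub]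
    rw [one_map (F := fun _ T => T.sub (σ.upV _))]
    rfl
  | name t =>
    simp only [Kind.body, Tm.sub]
    rw [one_map (F := fun _ T => T.sub (σ.upV _)), A.lift_sub]
    rfl

theorem Kind.hand_ren (k : Kind S τX τm) {s : S} (h : ob s = τm) (v : Nm Δ s) (A : Closed ob τX)
    (f : NMap Δ Δ') (g : VMap Γ Γ') (hf : ∀ c ∈ A.fn, f c.sort (.const c.idx) = .const c.idx) :
    (k.hand h v A : Tm ob Δ Γ .proc).ren f g = k.hand h (f s v) A := by
  simp only [Kind.hand, Tm.ren, k.body_ren A f g hf]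

theorem Kind.hand_sub (k : Kind S τX τm) {s : S} (h : ob s = τm) (v : Nm Δ s) (A : Closed ob τX)
    (σ : Sub ob Δ Γ Γ') : (k.hand h v A : Tm ob Δ Γ .proc).sub σ = k.hand h v A := by
  simp only [Kind.hand, Tm.sub, k.body_sub A σ]

/-- A called trigger requests the call. -/
theorem Kind.cl_call_trig (k : Kind S τX τm) {s : S} (h : ob s = τm) (v : Nm Δ s)
    (e : k.Arg ob Δ Γ) : cl (k.call (k.trig h v) e) = cl (.out h v (k.enc e) .nil) := by
  cases k with
  | proc => rfl
  | agent τ => exact cl_eq.2 (.pbeta _ _)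
  | name t =>
    refine (cl_eq.2 (.nbeta _ _)).trans ?_
    simp only [Tm.ren, NMap.inst_wk, Kind.enc]
    rw [oneN_map]
    rfl

/-- The handler answers a request with the call. -/
theorem Kind.cl_body_fill (k : Kind S τX τm) (A : Closed ob τX) (e : k.Arg ob Δ Γ) :
    cl ((k.body A : Tm ob Δ ([τm] :: Γ) .proc).fill (k.enc e)) = cl (k.call (A.lift Δ Γ) e) := by
  cases k with
  | proc => exact congrArg cl (A.lift_sub _)
  | agent τ =>
    simp only [Kind.body, Tm.fill, Tm.sub, A.lift_sub]
    exact congrArg (fun K => cl (Tm.papp (A.lift Δ Γ) K))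
      (one_map (.var (.here .zero)) fun _ T => T.sub (Sub.inst (one (τ := τm) e)))
  | name t =>
    simp only [Kind.body, Tm.fill, Tm.sub]
    rw [one_map (F := fun _ T => T.sub (Sub.inst (one _))), A.lift_sub]
    exact cl_eq.2 (.pbeta _ _)

end Kinds

/-! ### Predicates on processes as base relations -/

/-- Predicates on processes over the variables `Γ` that respect structural congruence and the
process constructors and hold for prefixed processes. -/
structure BasePred (ob : S → Ty S) (Γ : List (List (Ty S))) where
  /-- The predicate. -/
  holds : ∀ {Δ : List (List S)}, Tm ob Δ Γ .proc → Prop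
  cong : ∀ {Δ} {T V : Tm ob Δ Γ .proc}, cl T = cl V → holds V → holds T
  ren : ∀ {Δ Δ'} {T : Tm ob Δ Γ .proc} (f : NMap Δ Δ'), holds T →
    holds (T.ren f (fun _ x => x))
  nil : ∀ {Δ}, holds (.nil : Tm ob Δ Γ .proc)
  par : ∀ {Δ} {T V : Tm ob Δ Γ .proc}, holds T → holds V → holds (.par T V)
  nu : ∀ {Δ} (s : S) {T : Tm ob ([s] :: Δ) Γ .proc}, holds T → holds (.nu s T)
  guard : ∀ {Δ} {T : Tm ob Δ Γ .proc}, Guard T → holds T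

section BasePred

variable {Δ Δ' : List (List S)} {Γ Γ' : List (List (Ty S))} {τX τm : Ty S}

/-- The base relation given by a predicate. -/
def BasePred.base (G : BasePred ob Γ) : Base ob Γ where
  rel T V := G.holds T ∧ G.holds V
  symm h := h.symm
  trans h h' := ⟨h.1, h'.2⟩
  ren f h := ⟨G.ren f h.1, G.ren f h.2⟩
  head hh h := ⟨G.cong (cl_eq.2 hh.cong) h.1, h.2⟩
  nil := ⟨G.nil, G.nil⟩
  par h h' := ⟨G.par h.1 h'.1, G.par h.2 h'.2⟩
  parNil h := ⟨G.par h.1 G.nil, h.1⟩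
  parComm h h' := ⟨G.par h.1 h'.1, G.par h'.1 h.1⟩
  parAssoc h h' h'' := ⟨G.par (G.par h.1 h'.1) h''.1, G.par h.1 (G.par h'.1 h''.1)⟩
  nu s _ _ h := ⟨G.nu s h.1, G.nu s h.2⟩
  nuComm s t _ h := ⟨G.nu s (G.nu t h.1), G.nu t (G.nu s (G.ren _ h.1))⟩
  nuPar s _ _ h h' := ⟨G.nu s (G.par h.1 (G.ren _ h'.1)), G.par (G.nu s h.1) h'.1⟩
  inp h a _ _ _ := ⟨G.guard (.inp h a _), G.guard (.inp h a _)⟩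
  rinp h a _ _ _ := ⟨G.guard (.rinp h a _), G.guard (.rinp h a _)⟩
  out h a _ _ _ _ _ _ := ⟨G.guard (.out h a _ _), G.guard (.out h a _ _)⟩
  rout h a _ _ _ _ _ _ := ⟨G.guard (.rout h a _ _), G.guard (.rout h a _ _)⟩

/-- Arguments that are related to themselves. -/
def BasePred.Arg (G : BasePred ob Γ) : ∀ {τX τm : Ty S} {k : Kind S τX τm}, k.Arg ob Δ Γ → Prop
  | _, _, .proc, _ => True
  | _, _, .agent τ, e => G.base.L τ e e
  | _, _, .name _, _ => True

/-- An agent is related to itself iff its calls satisfy the predicate. -/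
theorem BasePred.L_iff (G : BasePred ob Γ) (k : Kind S τX τm) (X : Tm ob Δ Γ τX) :
    G.base.L τX X X ↔ ∀ (Δ' : List (List S)) (f : NMap Δ Δ') (e : k.Arg ob Δ' Γ), G.Arg e →
      G.holds (k.call (X.ren f (fun _ x => x)) e) := by
  cases k with
  | proc =>
    rw [Base.L_proc]
    constructor
    · intro h Δ' f e _
      exact G.ren f h.2.1
    · intro h
      have := h Δ (NMap.id _) .unit trivial
      rw [Tm.ren_id] at this
      exact ⟨.refl _, this, this⟩
  | agent τ =>
    rw [Base.L_pabs]
    constructor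
    · intro h Δ' f e he
      have := h.2 Δ' f (one e) (one e) (by
        intro τ' x
        rcases x with _ | x
        · exact he
        · cases x)
      rw [Base.L_proc] at this
      exact this.2.1
    · intro h
      refine ⟨.refl _, fun Δ' f K K' hK => G.base.L_proc.2 ⟨?_, ?_⟩⟩
      · exact .papp (.refl _) fun τ x => (hK τ x).cong
      · rw [one_eta K, one_eta K']
        exact ⟨h Δ' f _ ((hK _ .zero).trans (hK _ .zero).symm),
          h Δ' f _ ((hK _ .zero).symm.trans (hK _ .zero))⟩
  | name t =>
    rw [Base.L_nabs]
    constructor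
    · intro h Δ' f e _
      have := h.2 Δ' f (oneN e)
      rw [Base.L_proc] at this
      exact this.2.1
    · intro h
      refine ⟨.refl _, fun Δ' f K => G.base.L_proc.2 ⟨.refl _, ?_⟩⟩
      rw [oneN_eta K]
      exact ⟨h Δ' f _ trivial, h Δ' f _ trivial⟩

/-- The predicate holds for all processes over one variable if it holds for the calls of this
variable. -/
theorem BasePred.holds_of_call (G : BasePred ob [[τX]]) (k : Kind S τX τm)
    (h : ∀ (Δ : List (List S)) (e : k.Arg ob Δ [[τX]]), G.Arg e →
      G.holds (k.call (.var (.here .zero)) e)) (T : Tm ob Δ [[τX]] .proc) : G.holds T := by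
  have := Base.L.of_cong (B := G.base) (Cong.refl T) (NMap.id _) (fun _ x => .var x)
    (fun _ x => .var x) (by
      intro τ x
      rcases x with x | x
      · rcases x with _ | x
        · exact (G.L_iff k _).2 fun Δ' f e he => h Δ' e he
        · cases x
      · cases x)
  rw [Tm.ren_id, Tm.sub_var, Base.L_proc] at this
  exact this.2.1

/-- Closed agents are related to themselves. -/
theorem BasePred.L_lift (G : BasePred ob Γ) {τ : Ty S} (A : Closed ob τ) :
    G.base.L τ (A.lift Δ Γ) (A.lift Δ Γ) := by
  have := Base.L.of_cong (B := G.base) (Cong.refl A)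
    (fun _ a => match a with | .const n => .const n : NMap [] Δ) (fun _ x => nomatch x)
    (fun _ x => nomatch x) (fun _ x => nomatch x)
  convert this using 1 <;>
  · rw [Tm.lift, Tm.ren_eq_ren_sub]
    congr 1
    funext τ x; cases x

end BasePred

/-! ### Processes over one variable as parallel compositions -/

section Forms

variable {Δ Δ' : List (List S)} {Γ : List (List (Ty S))} {τX τm : Ty S}

theorem cl_nuB_single (T : Tm ob Δ Γ .proc) : cl (nuB [] (bigPar {T.wkN []})) = cl T := by
  rw [nuB_eq (T' := T.wkN []) (by simp), nuB_nil]

theorem cl_nuB_zero : cl (nuB [] (bigPar 0) : Tm ob Δ Γ .proc) = 0 := by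
  refine (nuB_eq (T' := .nil) (by simp [cl_nil])).trans ?_
  rfl

theorem cl_nuB_par_nil (T : Tm ob Δ Γ .proc) : cl (nuB [] (.par (T.wkN []) .nil)) = cl T := by
  have : nuB [] (.par (T.wkN []) .nil) = .par T .nil := nuB_nil (.par T .nil)
  rw [this, cl_par, cl_nil, add_zero]

/-- The call of the variable. -/
def Kind.callX (k : Kind S τX τm) (e : k.Arg ob Δ [[τX]]) : Tm ob Δ [[τX]] .proc :=
  k.call (.var (.here .zero)) e

theorem Kind.callX_ren (k : Kind S τX τm) (e : k.Arg ob Δ [[τX]]) (f : NMap Δ Δ') :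
    (k.callX e).ren f (fun _ x => x) = k.callX (e.ren f (fun _ x => x)) :=
  k.call_ren _ _ _ _

/-- Active components of a process over one variable: prefixed processes and calls of the
variable. -/
inductive Kind.Atom (k : Kind S τX τm) (ob : S → Ty S) (Δ : List (List S)) : Type u
  | pre (T : Tm ob Δ [[τX]] .proc) (h : Guard T)
  | call (e : k.Arg ob Δ [[τX]])

/-- The process given by an active component. -/
def Kind.Atom.tm {k : Kind S τX τm} : k.Atom ob Δ → Tm ob Δ [[τX]] .proc
  | .pre T _ => T
  | .call e => k.callX e

/-- Renaming of active components. -/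
def Kind.Atom.ren {k : Kind S τX τm} (f : NMap Δ Δ') : k.Atom ob Δ → k.Atom ob Δ'
  | .pre T h => .pre (T.ren f (fun _ x => x)) (h.ren _ _)
  | .call e => .call (e.ren f (fun _ x => x))

theorem Kind.Atom.tm_ren {k : Kind S τX τm} (f : NMap Δ Δ') (a : k.Atom ob Δ) :
    (a.ren f).tm = a.tm.ren f (fun _ x => x) := by
  cases a with
  | pre T h => rfl
  | call e => exact (k.callX_ren e f).symm

/-- Every process over one variable is structurally congruent to a parallel composition of
prefixed processes and calls of the variable below restrictions. -/
def Kind.canonPred (ob : S → Ty S) (k : Kind S τX τm) : BasePred ob [[τX]] where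
  holds {Δ} T := ∃ (d : List S) (M : Multiset (k.Atom ob (d :: Δ))),
    cl T = cl (nuB d (bigPar (M.map Kind.Atom.tm)))
  cong := fun h ⟨d, M, h'⟩ => ⟨d, M, h.trans h'⟩
  ren := by
    rintro Δ Δ' T f ⟨d, M, h⟩
    refine ⟨d, M.map (Kind.Atom.ren (f.up d)), (cl_ren h f _).trans ?_⟩
    rw [nuB_ren]
    refine nuB_eq ?_
    rw [cl_bigPar_ren]
    simp only [Multiset.map_map, Function.comp_def, Kind.Atom.tm_ren]
  nil := ⟨[], 0, by rw [Multiset.map_zero, cl_nuB_zero, cl_nil]⟩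
  par := by
    rintro Δ T V ⟨d, M, h⟩ ⟨d', M', h'⟩
    refine ⟨d ++ d', M.map (Kind.Atom.ren (NMap.inl d d'))
      + M'.map (Kind.Atom.ren (NMap.inr d d')), ?_⟩
    rw [cl_par, h, h', ← nuB_add]
    refine nuB_eq ?_
    simp only [cl_par, cl_bigPar_ren, Multiset.map_add, cl_bigPar_add, Multiset.map_map,
      Function.comp_def, Kind.Atom.tm_ren]
  nu := by
    rintro Δ s T ⟨d, M, h⟩
    refine ⟨s :: d, M.map (Kind.Atom.ren (NMap.merge s d)), ?_⟩
    rw [cl_nu, h, ← cl_nu, nu_nuB]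
    refine nuB_eq ?_
    rw [cl_bigPar_ren]
    simp only [Multiset.map_map, Function.comp_def, Kind.Atom.tm_ren]
  guard := by
    intro Δ T hT
    refine ⟨[], {.pre (T.wkN []) (hT.ren _ _)}, ?_⟩
    rw [Multiset.map_singleton]
    exact (cl_nuB_single T).symm

/-- A process over one variable is a parallel composition of prefixed processes and calls of the
variable, below restrictions. -/
theorem Kind.exists_canon (k : Kind S τX τm) (T : Tm ob Δ [[τX]] .proc) :
    ∃ (d : List S) (M : Multiset (k.Atom ob (d :: Δ))),
      cl T = cl (nuB d (bigPar (M.map Kind.Atom.tm))) := by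
  refine (k.canonPred ob).holds_of_call k (fun Δ e _ => ?_) T
  refine ⟨[], {.call (e.ren (NMap.wk []) (fun _ x => x))}, ?_⟩
  rw [Multiset.map_singleton]
  refine (cl_nuB_single _).symm.trans ?_
  rw [Tm.wkN, Kind.call_ren]
  rfl

/-- Processes over one variable from which a parallel composition of prefixed processes is
reached by finitely many unfoldings: replacements of an active occurrence of the variable by the
agent `A`. -/
inductive Kind.Ready (k : Kind S τX τm) (A : Closed ob τX) :
    ∀ {Δ : List (List S)}, Tm ob Δ [[τX]] .proc → Prop
  | guards {Δ : List (List S)} {T : Tm ob Δ [[τX]] .proc} (d : List S)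
      (M : Multiset (Tm ob (d :: Δ) [[τX]] .proc)) :
      (∀ g ∈ M, Guard g) → cl T = cl (nuB d (bigPar M)) → Kind.Ready k A T
  | unfold {Δ : List (List S)} {T : Tm ob Δ [[τX]] .proc} (d : List S)
      (e : k.Arg ob (d :: Δ) [[τX]])
      (R : Tm ob (d :: Δ) [[τX]] .proc) : cl T = cl (nuB d (.par (k.callX e) R)) →
      Kind.Ready k A (nuB d (.par (k.call (A.lift _ _) e) R)) → Kind.Ready k A T

theorem Kind.Ready.cong {k : Kind S τX τm} {A : Closed ob τX} {T V : Tm ob Δ [[τX]] .proc}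
    (h : cl T = cl V) (hV : k.Ready A V) : k.Ready A T := by
  cases hV with
  | guards d M hM h' => exact .guards d M hM (h.trans h')
  | unfold d e R h' h'' => exact .unfold d e R (h.trans h') h''

theorem Kind.Ready.par {k : Kind S τX τm} {A : Closed ob τX} {T V : Tm ob Δ [[τX]] .proc}
    (hT : k.Ready A T) (hV : k.Ready A V) : k.Ready A (.par T V) := by
  have assoc : ∀ {Δ : List (List S)} (d : List S) (T R : Tm ob (d :: Δ) [[τX]] .proc)
      (V : Tm ob Δ [[τX]] .proc), cl (nuB d (.par T (.par R (V.wkN d))))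
        = cl (.par (nuB d (.par T R)) V) := fun d T R V => cl_nuB_par_par d T R V
  induction hT with
  | unfold d e R h _ ih =>
    refine .unfold d e (.par R (V.wkN d)) ?_ (Kind.Ready.cong (assoc _ _ _ _) ih)
    rw [assoc, cl_par, h, ← cl_par]
  | @guards T d M hM h =>
    induction hV with
    | unfold d' e R h' _ ih =>
      refine .unfold d' e (.par R (T.wkN d')) ?_ (Kind.Ready.cong ?_ ih)
      · rw [assoc, cl_par, h', ← cl_par, cl_par, cl_par, add_comm]
      · rw [assoc, cl_par, cl_par, add_comm]
    | guards d' M' hM' h' =>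
      refine .guards (d ++ d') ((M.map fun T => T.ren (NMap.inl d d') (fun _ x => x))
        + M'.map fun T => T.ren (NMap.inr d d') (fun _ x => x)) ?_ ?_
      · intro g hg
        rcases Multiset.mem_add.1 hg with hg | hg <;>
          obtain ⟨g', hg', rfl⟩ := Multiset.mem_map.1 hg
        · exact (hM g' hg').ren _ _
        · exact (hM' g' hg').ren _ _
      · rw [cl_par, h, h', ← nuB_add]
        exact nuB_eq (by simp only [cl_par, cl_bigPar_ren, cl_bigPar_add])

theorem Kind.Ready.nu {k : Kind S τX τm} {A : Closed ob τX} {s : S}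
    {T : Tm ob ([s] :: Δ) [[τX]] .proc} (hT : k.Ready A T) : k.Ready A (.nu s T) := by
  have key : ∀ {Δ₁ : List (List S)} {T : Tm ob Δ₁ [[τX]] .proc}, k.Ready A T →
      ∀ h : Δ₁ = [s] :: Δ, k.Ready A (.nu s (h ▸ T)) := by
    intro Δ₁ T hT hΔ
    induction hT with
    | guards d M hM h =>
      subst hΔ
      refine .guards (s :: d) (M.map fun T => T.ren (NMap.merge s d) (fun _ x => x)) ?_ ?_
      · intro g hg
        obtain ⟨g', hg', rfl⟩ := Multiset.mem_map.1 hg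
        exact (hM g' hg').ren _ _
      · rw [cl_nu, h, ← cl_nu, nu_nuB]
        exact nuB_eq (cl_bigPar_ren _ _ _)
    | unfold d e R h _ ih =>
      subst hΔ
      refine .unfold (s :: d) (e.ren (NMap.merge s d) (fun _ x => x))
        (R.ren (NMap.merge s d) (fun _ x => x)) ?_ (Kind.Ready.cong ?_ ih)
      · rw [cl_nu, h, ← cl_nu, nu_nuB]
        simp only [Tm.ren, Kind.callX_ren]
      · rw [nu_nuB]
        simp only [Tm.ren, Kind.call_ren]
        rw [Tm.lift_ren _ _ _ fun s n => rfl]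
  exact key hT rfl

/-- Every process over one variable reaches a parallel composition of prefixed processes by
unfolding. -/
def Kind.readyPred (k : Kind S τX τm) (A : Closed ob τX) : BasePred ob [[τX]] where
  holds {Δ} T := ∀ (Δ' : List (List S)) (f : NMap Δ Δ'), k.Ready A (T.ren f (fun _ x => x))
  cong h hV Δ' f := (hV Δ' f).cong (cl_ren h f _)
  ren f h Δ' f' := by rw [Tm.ren_comp]; exact h _ _
  nil Δ' f := .guards [] 0 (by simp) (by rw [cl_nuB_zero]; rfl)
  par h h' Δ' f := (h Δ' f).par (h' Δ' f)
  nu s _ h Δ' f := (h _ (f.up [s])).nu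
  guard h Δ' f := .guards [] _ (fun g hg => by
    rw [Multiset.mem_singleton] at hg
    exact hg ▸ (h.ren f (fun _ x => x)).ren (NMap.wk []) _)
    (cl_nuB_single _).symm

theorem BasePred.Arg.ren {G : BasePred ob Γ} {k : Kind S τX τm} {e : k.Arg ob Δ Γ} (h : G.Arg e)
    (f : NMap Δ Δ') : G.Arg (e.ren f (fun _ x => x)) := by
  cases k with
  | proc => trivial
  | agent τ => exact Base.L.ren h f
  | name t => trivial

/-- Unfolding the active calls of the variable terminates, also when the agent is an abstraction
whose calls activate arguments that call the variable again. -/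
theorem Kind.ready (k : Kind S τX τm) (A : Closed ob τX) (T : Tm ob Δ [[τX]] .proc) :
    k.Ready A T := by
  have := (k.readyPred A).holds_of_call k (fun Δ e he Δ' f => ?_) T _ (NMap.id _)
  · rwa [Tm.ren_id] at this
  · have h1 := ((k.readyPred A).L_iff k _).1 ((k.readyPred A).L_lift (Δ := Δ') A) Δ' (NMap.id _) _
      (he.ren f) Δ' (NMap.id _)
    rw [Tm.ren_id, Tm.ren_id] at h1
    rw [Kind.call_ren]
    refine .unfold [] ((e.ren f (fun _ x => x)).ren (NMap.wk []) (fun _ x => x)) .nil ?_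
      (h1.cong ?_)
    · rw [← Kind.callX_ren]
      exact (cl_nuB_par_nil _).symm
    · refine Eq.trans ?_ (cl_nuB_par_nil _)
      simp only [Tm.wkN, Kind.call_ren]
      rw [Tm.lift_ren _ _ _ fun s n => rfl]

end Forms

/-! ### Two interpretations of a context -/

section Interp

variable {τX τm : Ty S}

theorem Tm.wkN_eq_lift {τ : Ty S} (A : Closed ob τ) (d : List S) : A.wkN d = A.lift [d] [] := by
  have h := A.lift_ren (Δ := []) (Γ := []) (NMap.wk d) (fun _ x => x) (fun _ _ => rfl)
  rwa [A.lift_self] at h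

/-- The renaming of variables out of the empty context. -/
def VMap.empty (Γ : List (List (Ty S))) : VMap [] Γ := fun _ x => nomatch x

/-- A context whose variable is not among `Γ`, regarded as a term with further variables. -/
def Tm.under {τ : Ty S} (C : Ctx ob τ .proc) (d : List S) (Γ : List (List (Ty S))) :
    Tm ob [d] ([τ] :: Γ) .proc :=
  C.ren (NMap.wk d) (VMap.up (VMap.empty _) _)

/-- A way to turn contexts into processes: the variable is replaced by an agent, below a possibly
larger block of restrictions and next to a further process. -/
structure Interp (ob : S → Ty S) (τX : Ty S) where
  /-- The process assigned to a context. -/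
  top : Ctx ob τX .proc → Proc ob
  /-- The restrictions added. -/
  blk : List S → List S
  /-- The renaming of the restricted names. -/
  map : ∀ d, NMap [d] [blk d]
  /-- The agent put in for the variable. -/
  agent : ∀ d, Tm ob [blk d] [] τX
  /-- The process put next to the context. -/
  rest : ∀ d, Tm ob [blk d] [] .proc
  fixes : ∀ d, (map d).Over
  eq : ∀ {E : Ctx ob τX .proc} {d : List S} {T : Tm ob [d] [[τX]] .proc}, cl E = cl (nuB d T) →
    cl (top E) = cl (nuB (blk d) (.par ((T.ren (map d) (fun _ x => x)).fill (agent d)) (rest d)))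

variable (I : Interp ob τX)

theorem Interp.map_const (d : List S) (s : S) (n : ℕ) : I.map d s (.const n) = .const n :=
  I.fixes d s (.const n)

/-- The substitution used by an interpretation. -/
def Interp.sub (d : List S) : Sub ob [I.blk d] [[τX]] [] := Sub.inst (one (I.agent d))

/-- The effect of an interpretation on a subterm. -/
def Interp.app {ρ : Ty S} (d : List S) (T : Tm ob [d] [[τX]] ρ) : Tm ob [I.blk d] [] ρ :=
  (T.ren (I.map d) (fun _ x => x)).sub (I.sub d)

/-- The effect of an interpretation on the body of an input. -/
def Interp.app' {ρ τ : Ty S} (d : List S) (T : Tm ob [d] ([τ] :: [[τX]]) ρ) :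
    Tm ob [I.blk d] [[τ]] ρ :=
  (T.ren (I.map d) (fun _ x => x)).sub ((I.sub d).upV _)

theorem Interp.cl_top {E : Ctx ob τX .proc} {d : List S} {T : Tm ob [d] [[τX]] .proc}
    (h : cl E = cl (nuB d T)) : cl (I.top E) = cl (nuB (I.blk d) (.par (I.app d T) (I.rest d))) :=
  I.eq h

theorem Interp.app_fill {τ : Ty S} {d : List S} (T : Tm ob [d] ([τ] :: [[τX]]) .proc)
    (B : Tm ob [d] [[τX]] τ) : I.app d (T.fill B) = (I.app' d T).fill (I.app d B) := by
  rw [Interp.app, Tm.fill_ren', Tm.fill_sub]; rfl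

theorem Interp.app_lift {τ : Ty S} {d : List S} (B : Closed ob τ) :
    I.app d (B.lift _ _) = B.wkN (I.blk d) := by
  rw [Interp.app, Tm.lift_ren _ _ _ (fun _ _ => I.map_const d _ _), Tm.lift_sub, Tm.wkN_eq_lift]

theorem Interp.app_under {τ : Ty S} {d : List S} (C : Ctx ob τ .proc) :
    I.app' d (C.under d [[τX]]) = C.wkN (I.blk d) := by
  rw [Interp.app', Tm.under, Tm.ren_ren, Tm.ren_sub]
  have h : (NMap.wk d).comp (I.map d) = NMap.wk (I.blk d) := by
    funext s a; exact I.fixes d s a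
  rw [h]
  refine Eq.trans ?_ (Tm.sub_var _)
  congr 1
  funext τ x
  rcases x with x | x
  · rfl
  · cases x

theorem Interp.cl_app_bigPar {d : List S} (M : Multiset (Tm ob [d] [[τX]] .proc)) :
    cl (I.app d (bigPar M)) = cl (bigPar (M.map (I.app d))) := by
  rw [Interp.app, cl_sub (cl_bigPar_ren _ _ _), cl_bigPar_sub, Multiset.map_map]
  rfl

theorem Interp.app_par {d : List S} (T V : Tm ob [d] [[τX]] .proc) :
    I.app d (.par T V) = .par (I.app d T) (I.app d V) := rfl

theorem Interp.app_inG {d : List S} {q : Tm ob [d] [[τX]] .proc} {s : S} {τ : Ty S} {a : Nm [d] s}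
    {T : Tm ob [d] ([τ] :: [[τX]]) .proc} (h : InG q a T) :
    InG (I.app d q) (I.map d s a) (I.app' d T) :=
  (h.ren' _).sub _

theorem Interp.app_outG {d : List S} {q : Tm ob [d] [[τX]] .proc} {s : S} {τ : Ty S} {a : Nm [d] s}
    {B : Tm ob [d] [[τX]] τ} {V : Tm ob [d] [[τX]] .proc} (h : OutG q a B V) :
    OutG (I.app d q) (I.map d s a) (I.app d B) (I.app d V) :=
  (h.ren _ _).sub _

/-- Internal moves of a context are moves of its interpretations. -/
theorem Interp.tau {E : Ctx ob τX .proc} {d : List S} {q q' R : Tm ob [d] [[τX]] .proc} {s : S}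
    {τ : Ty S} {a : Nm [d] s} {T : Tm ob [d] ([τ] :: [[τX]]) .proc} {B : Tm ob [d] [[τX]] τ}
    {V : Tm ob [d] [[τX]] .proc} (hE : cl E = cl (nuB d (.par q (.par q' R)))) (hq : InG q a T)
    (hq' : OutG q' a B V) :
    Step (I.top E) .tau (I.top (nuB d (.par (T.fill B) (.par V R)))) := by
  refine (Step.tau_nuB (I.app_inG hq) (I.app_outG hq') (.par (I.app d R) (I.rest d))).congr ?_ ?_
  · rw [I.cl_top hE]
    exact nuB_eq (by simp only [Interp.app_par, cl_par]; abel)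
  · rw [I.cl_top rfl]
    exact nuB_eq (by simp only [Interp.app_par, Interp.app_fill, cl_par]; abel)

/-- Inputs of a context are inputs of its interpretations. -/
theorem Interp.inp {E : Ctx ob τX .proc} {d : List S} {q R : Tm ob [d] [[τX]] .proc}
    {a : NameConst S} {τ : Ty S} {T : Tm ob [d] ([τ] :: [[τX]]) .proc}
    (hE : cl E = cl (nuB d (.par q R))) (hq : InG q (.const a.idx : Nm [d] a.sort) T)
    (B : Closed ob τ) :
    Step (I.top E) (.inp a B) (I.top (nuB d (.par (T.fill (B.lift _ _)) R))) := by
  have h := I.app_inG hq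
  rw [I.map_const] at h
  refine (Step.inp_nuB h (.par (I.app d R) (I.rest d)) B).congr ?_ ?_
  · rw [I.cl_top hE]
    exact nuB_eq (by simp only [Interp.app_par, cl_par]; abel)
  · rw [I.cl_top rfl]
    exact nuB_eq (by
      simp only [Interp.app_par, Interp.app_fill, Interp.app_lift, cl_par]; abel)

/-- Outputs of a context are outputs of its interpretations. -/
theorem Interp.out {E : Ctx ob τX .proc} {d : List S} {q R : Tm ob [d] [[τX]] .proc}
    {a : NameConst S} {τ : Ty S} {B : Tm ob [d] [[τX]] τ} {V : Tm ob [d] [[τX]] .proc}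
    (hE : cl E = cl (nuB d (.par q R))) (hq : OutG q (.const a.idx : Nm [d] a.sort) B V) :
    ∃ (cs : List (NameConst S)) (B' : Closed ob τ) (P' : Proc ob),
      Step (I.top E) (.out cs a B') P' ∧ ∀ C : Ctx ob τ .proc, Disjoint {c | c ∈ cs} C.fn →
        cl (resList cs (.par (C.fill B') P'))
          = cl (I.top (nuB d (.par ((C.under d _).fill B) (.par V R)))) := by
  have h := I.app_outG hq
  rw [I.map_const] at h
  obtain ⟨cs, B', P', h1, h2⟩ := Step.out_nuB h (.par (I.app d R) (I.rest d))
  refine ⟨cs, B', P', h1.congr ?_ rfl, fun C hC => ?_⟩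
  · rw [I.cl_top hE]
    exact nuB_eq (by simp only [Interp.app_par, cl_par]; abel)
  · rw [h2 C hC, I.cl_top rfl]
    exact nuB_eq (by
      simp only [Interp.app_par, Interp.app_fill, Interp.app_under, cl_par]; abel)

/-- Filling with a closed agent. -/
@[reducible] def Interp.fill (A : Closed ob τX) : Interp ob τX where
  top E := E.fill A
  blk d := d
  map _ := NMap.id _
  agent _ := A.lift _ _
  rest _ := .nil
  fixes _ _ _ := rfl
  eq {E d T} h := by
    rw [cl_fill h rfl, Tm.fill, nuB_sub]
    refine nuB_eq ?_
    rw [cl_par, cl_nil, add_zero, Tm.ren_id, Tm.fill]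
    congr 2
    funext τ x
    rcases x with x | x
    · rcases x with _ | x
      · exact A.wkN_eq_lift d
      · cases x
    · cases x

/-- The inclusion of a block of names in the block with one more name. -/
def NMap.emb {Δ : List (List S)} (s : S) (d : List S) : NMap (d :: Δ) ((s :: d) :: Δ) :=
  NMap.ofPos fun _ x => .succ x

theorem NMap.emb_ne {Δ : List (List S)} {s : S} {d : List S} (b : Nm (d :: Δ) s) :
    NMap.emb s d s b ≠ .var (.here .zero) := by
  rcases b with n | x | x <;> intro h <;> cases h

/-- The factorization of a context with trigger name `s`, as an interpretation. -/
@[reducible] def Interp.fac (k : Kind S τX τm) {s : S} (hs : ob s = τm) (A : Closed ob τX) :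
    Interp ob τX where
  top E := .nu s (.par ((E.wkN [s]).fill (k.trig hs (.var (.here .zero))))
    (k.hand hs (.var (.here .zero)) A))
  blk d := s :: d
  map d := NMap.emb s d
  agent _ := k.trig hs (.var (.here .zero))
  rest _ := k.hand hs (.var (.here .zero)) A
  fixes _ := NMap.ofPos_wk _
  eq {E d T} h := by
    have h1 : cl (.par ((E.wkN [s]).fill (k.trig hs (.var (.here .zero))))
        (k.hand hs (.var (.here .zero)) A)) = cl (nuB d (.par
          ((T.ren ((NMap.wk [s]).up d) (fun _ x => x)).sub
            ((Sub.inst (one (k.trig hs (.var (.here .zero))))).upN d))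
          ((k.hand hs (.var (.here .zero)) A).wkN d))) := by
      rw [cl_nuB_par, ← nuB_sub, cl_par]
      congr 1
      rw [Tm.wkN, cl_fill (cl_ren h _ _) rfl, nuB_ren]
      rfl
    rw [cl_nu, h1, ← cl_nu, nu_nuB]
    refine nuB_eq ?_
    simp only [Tm.ren, cl_par, Tm.wkN]
    congr 1
    · rw [Tm.sub_ren, Tm.ren_comp, Tm.fill]
      have h2 : ((NMap.wk [s]).up d).comp (NMap.merge s d) = NMap.emb (Δ := []) s d := by
        apply NMap.block_ext
        · intro r a
          rw [NMap.comp_apply, NMap.up_wk, NMap.merge_wk]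
          exact (NMap.ofPos_wk _ r a).symm
        · intro r x; rfl
      rw [h2]
      congr 2
      funext τ x
      rcases x with x | x
      · rcases x with _ | x
        · simp only [Sub.upN, Sub.inst, one, Tm.wkN, Kind.trig_ren]
          rfl
        · cases x
      · cases x
    · rw [Kind.hand_ren _ _ _ _ _ _ (fun _ _ => rfl), Kind.hand_ren _ _ _ _ _ _ (fun _ _ => rfl)]
      rfl

end Interp

/-! ### The factorization bisimulation -/

section Factorization

variable {τX τm : Ty S} (k : Kind S τX τm) {s : S} (hs : ob s = τm) (A : Closed ob τX)

theorem Interp.app_callX (I : Interp ob τX) {d : List S} (e : k.Arg ob [d] [[τX]]) :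
    I.app d (k.callX e)
      = k.call (I.agent d) ((e.ren (I.map d) (fun _ x => x)).sub (I.sub d)) := by
  rw [Interp.app, Kind.callX_ren, Kind.callX, Kind.call_sub]; rfl

theorem Interp.app_call_lift (I : Interp ob τX) {d : List S} (e : k.Arg ob [d] [[τX]]) :
    I.app d (k.call (A.lift _ _) e)
      = k.call (A.lift _ _) ((e.ren (I.map d) (fun _ x => x)).sub (I.sub d)) := by
  rw [Interp.app, Kind.call_ren, Kind.call_sub, Tm.lift_ren _ _ _ (fun _ _ => I.map_const d _ _),
    Tm.lift_sub]

/-- Unfolding a call of the variable does not change the result of filling. -/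
theorem cl_fill_unfold {E : Ctx ob τX .proc} {d : List S} {e : k.Arg ob [d] [[τX]]}
    {R : Tm ob [d] [[τX]] .proc} (hE : cl E = cl (nuB d (.par (k.callX e) R))) :
    cl (E.fill A) = cl ((nuB d (.par (k.call (A.lift _ _) e) R)).fill A) := by
  refine ((Interp.fill A).cl_top hE).trans (((Interp.fill A).cl_top rfl).trans ?_).symm
  simp only [Interp.app_par, Interp.app_callX, Interp.app_call_lift]

/-- The argument of a call, in the factorization. -/
def Kind.facArg {d : List S} (e : k.Arg ob [d] [[τX]]) : k.Arg ob [s :: d] [] :=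
  (e.ren (NMap.emb s d) (fun _ x => x)).sub (Sub.inst (one (k.trig hs (.var (.here .zero)))))

theorem Interp.fac_callX {d : List S} (e : k.Arg ob [d] [[τX]]) :
    cl ((Interp.fac k hs A).app d (k.callX e))
      = cl (.out hs (.var (.here .zero) : Nm [s :: d] s) (k.enc (k.facArg hs e)) .nil) :=
  (congrArg cl ((Interp.fac k hs A).app_callX k e)).trans (k.cl_call_trig _ _ _)

theorem Interp.fac_call_lift {d : List S} (e : k.Arg ob [d] [[τX]]) :
    (Interp.fac k hs A).app d (k.call (A.lift _ _) e) = k.call (A.lift _ _) (k.facArg hs e) :=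
  (Interp.fac k hs A).app_call_lift k A e

/-- The handler answers a request and remains available. -/
theorem Kind.cl_hand_fill {Δ : List (List S)} {Γ : List (List (Ty S))} (v : Nm Δ s)
    (e : k.Arg ob Δ Γ) :
    cl ((Tm.par (k.body A) ((k.hand hs v A).wkV [τm])).fill (k.enc e))
      = cl (k.call (A.lift _ _) e) + cl (k.hand hs v A) := by
  rw [Tm.fill, Tm.sub, cl_par, Tm.wkV_inst]
  exact congrArg (· + _) (k.cl_body_fill A e)

theorem Interp.cl_fac_top {E : Ctx ob τX .proc} {d : List S} {T : Tm ob [d] [[τX]] .proc}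
    (h : cl E = cl (nuB d T)) : cl ((Interp.fac k hs A).top E) = cl (nuB (s :: d)
      (.par (k.hand hs (.var (.here .zero)) A) ((Interp.fac k hs A).app d T))) :=
  ((Interp.fac k hs A).cl_top h).trans (nuB_eq (d := s :: d)
    (add_comm (cl ((Interp.fac k hs A).app d T)) (cl (k.hand hs (.var (.here .zero)) A))))

/-- Unfolding a call of the variable is an internal move of the factorization: the trigger
calls the handler. -/
theorem Interp.fac_unfold {E : Ctx ob τX .proc} {d : List S} {e : k.Arg ob [d] [[τX]]}
    {R : Tm ob [d] [[τX]] .proc} (hE : cl E = cl (nuB d (.par (k.callX e) R))) :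
    Step ((Interp.fac k hs A).top E) .tau
      ((Interp.fac k hs A).top (nuB d (.par (k.call (A.lift _ _) e) R))) := by
  refine (Step.tau_nuB (d := s :: d)
    (InG.rinp hs (.var (.here .zero)) (k.body A))
    (OutG.out hs (.var (.here .zero)) (k.enc (k.facArg hs e)) .nil)
    ((Interp.fac k hs A).app d R)).congr ?_ ?_
  · rw [Interp.cl_fac_top k hs A hE]
    refine nuB_eq ?_
    rw [Interp.app_par, cl_par, cl_par, cl_par, Interp.fac_callX]
    rfl
  · rw [Interp.cl_fac_top k hs A rfl]
    refine nuB_eq ?_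
    rw [Interp.app_par, cl_par, cl_par, cl_par, Interp.fac_call_lift]
    rw [cl_par, cl_nil]
    refine Eq.trans ?_ (congrArg (· + _) (k.cl_hand_fill hs A _ _)).symm
    rw [zero_add]
    exact (add_assoc _ _ _).symm.trans (congrArg (· + _) (add_comm _ _))

/-- Contexts filled with the agent paired with their factorizations, in both orders, up to
structural congruence. -/
def FacRel (P Q : Proc ob) : Prop :=
  (∃ E : Ctx ob τX .proc, cl P = cl (E.fill A) ∧ cl Q = cl ((Interp.fac k hs A).top E)) ∨
  (∃ E : Ctx ob τX .proc, cl Q = cl (E.fill A) ∧ cl P = cl ((Interp.fac k hs A).top E))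

variable {k hs A}

theorem FacRel.symm {P Q : Proc ob} (h : FacRel k hs A P Q) : FacRel k hs A Q P := h.elim .inr .inl

theorem FacRel.congr_right {P Q Q' : Proc ob} (h : FacRel k hs A P Q) (hQ : cl Q' = cl Q) :
    FacRel k hs A P Q' := by
  rcases h with ⟨E, h1, h2⟩ | ⟨E, h1, h2⟩
  · exact .inl ⟨E, h1, hQ.trans h2⟩
  · exact .inr ⟨E, hQ.trans h1, h2⟩

theorem Simulates.facRel_congr {P P' Q Q' : Proc ob} (h : Simulates (FacRel k hs A) P Q)
    (hP : cl P' = cl P) (hQ : cl Q' = cl Q) : Simulates (FacRel k hs A) P' Q' :=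
  Simulates.congr (R := FacRel k hs A) (fun _ _ _ => FacRel.congr_right) h hP hQ

theorem map_eq_cons' {α β : Type*} {f : α → β} {M : Multiset α} {b : β} {N : Multiset β}
    (h : M.map f = b ::ₘ N) : ∃ a M', M = a ::ₘ M' ∧ f a = b ∧ M'.map f = N := by
  classical
  obtain ⟨a, ha, h1, h2⟩ := (Multiset.map_eq_cons f M N b).2 h
  exact ⟨a, M.erase a, (Multiset.cons_erase ha).symm, h1, h2⟩

/-- If all active components of a context are prefixed processes then the agent put in for the
variable takes part in no move. -/
theorem simulates_of_guards {E : Ctx ob τX .proc} {d : List S}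
    {M : Multiset (Tm ob [d] [[τX]] .proc)} (hM : ∀ g ∈ M, Guard g)
    (hE : cl E = cl (nuB d (bigPar M))) :
    Simulates (FacRel k hs A) (E.fill A) ((Interp.fac k hs A).top E) := by
  set I := Interp.fill A
  have hA : cl (E.fill A) = cl (nuB d (bigPar (M.map (I.app d)))) := by
    rw [show E.fill A = I.top E from rfl, I.cl_top hE]
    refine nuB_eq ?_
    rw [cl_par, I.cl_app_bigPar]
    exact add_zero _
  have hG : ∀ g ∈ M.map (I.app d), Guard g := by
    intro g hg
    obtain ⟨q, hq, rfl⟩ := Multiset.mem_map.1 hg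
    exact ((hM q hq).ren _ _).sub _
  have rest : ∀ T, cl (nuB d (.par (I.app d T) (I.rest d))) = cl (nuB d (I.app d T)) := fun T =>
    nuB_eq (d := d) (add_zero (cl (I.app d T)))
  refine ⟨fun P' h => ?_, fun P' a τ B h => ?_, fun P' cs a τ B h => ?_⟩
  · obtain ⟨r, τ, a, g, g', T, B, V, M', h1, hg, hg', h2⟩ := h.tau_canon hG hA
    obtain ⟨q, M1, rfl, rfl, h3⟩ := map_eq_cons' h1
    obtain ⟨q', M2, rfl, rfl, rfl⟩ := map_eq_cons' h3
    obtain ⟨b, T0, hq, rfl, rfl⟩ := InG.of_sub (hM q (by simp)) hg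
    obtain ⟨b', B0, V0, hq', rfl, rfl, rfl⟩ := OutG.of_sub (hM q' (by simp)) hg'
    have hE' : cl E = cl (nuB d (.par q (.par q' (bigPar M2)))) := by
      rw [hE]; exact nuB_eq (by simp only [cl_bigPar_cons, cl_par])
    refine ⟨_, .single ((Interp.fac k hs A).tau hE' hq hq'), .inl ⟨_, ?_, rfl⟩⟩
    rw [h2]
    refine Eq.trans ?_ (I.cl_top rfl).symm
    refine Eq.trans ?_ (rest _).symm
    refine nuB_eq ?_
    simp only [Interp.app_par, Interp.app_fill, cl_par, Interp.cl_app_bigPar]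
    rfl
  · obtain ⟨g, T, M', h1, hg, h2⟩ := h.inp_canon hG hA
    obtain ⟨q, M1, rfl, rfl, rfl⟩ := map_eq_cons' h1
    obtain ⟨b, T0, hq, hb, rfl⟩ := InG.of_sub (hM q (by simp)) hg
    obtain rfl : b = .const a.idx := hb.symm
    have hE' : cl E = cl (nuB d (.par q (bigPar M1))) := by
      rw [hE]; exact nuB_eq (by simp only [cl_bigPar_cons, cl_par])
    refine ⟨_, .of_step ((Interp.fac k hs A).inp hE' hq B), .inl ⟨_, ?_, rfl⟩⟩
    rw [h2]
    refine Eq.trans ?_ (I.cl_top rfl).symm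
    refine Eq.trans ?_ (rest _).symm
    refine nuB_eq ?_
    simp only [Interp.app_par, Interp.app_fill, Interp.app_lift, cl_par, Interp.cl_app_bigPar]
    rfl
  · obtain ⟨g, B', V, M', h1, hg, h2⟩ := h.out_canon hG hA
    obtain ⟨q, M1, rfl, rfl, rfl⟩ := map_eq_cons' h1
    obtain ⟨b, B0, V0, hq, hb, rfl, rfl⟩ := OutG.of_sub (hM q (by simp)) hg
    obtain rfl : b = .const a.idx := hb.symm
    have hE' : cl E = cl (nuB d (.par q (bigPar M1))) := by
      rw [hE]; exact nuB_eq (by simp only [cl_bigPar_cons, cl_par])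
    obtain ⟨ds, D, Q', hst, h3⟩ := (Interp.fac k hs A).out hE' hq
    refine ⟨ds, D, Q', .of_step hst, fun C hC => .inl ⟨_, ?_, h3 C (hC.mono_left (by simp))⟩⟩
    rw [h2 C (hC.mono_left (by simp))]
    refine Eq.trans ?_ (I.cl_top rfl).symm
    refine Eq.trans ?_ (rest _).symm
    refine nuB_eq ?_
    simp only [Interp.app_par, Interp.app_fill, Interp.app_under, cl_par, Interp.cl_app_bigPar]
    rfl

/-- A context filled with the agent is simulated by its factorization: first, the calls of the
variable that are active are unfolded. -/
theorem simulates_fac (E : Ctx ob τX .proc) :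
    Simulates (FacRel k hs A) (E.fill A) ((Interp.fac k hs A).top E) := by
  -- the context of bound names is generalized because it is an index of `Ready`
  have key : ∀ {Δ : List (List S)} {T : Tm ob Δ [[τX]] .proc}, k.Ready A T →
      ∀ (hΔ : Δ = []) (E : Ctx ob τX .proc), HEq T E →
      Simulates (FacRel k hs A) (E.fill A) ((Interp.fac k hs A).top E) := by
    intro Δ T hT
    induction hT with
    | guards d M hM h =>
      rintro rfl E ⟨⟩
      exact simulates_of_guards hM h
    | unfold d e R h _ ih =>
      rintro rfl E ⟨⟩
      refine Simulates.tau_right (Interp.fac_unfold k hs A h) ?_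
      exact (ih rfl _ .rfl).facRel_congr (cl_fill_unfold k A h) rfl
  exact key (k.ready A E) rfl E .rfl

/-- The effect of the factorization on an active component. -/
def Kind.Atom.fac (hs : ob s = τm) (A : Closed ob τX) {d : List S} :
    k.Atom ob [d] → Tm ob [s :: d] [] .proc
  | .pre T _ => (Interp.fac k hs A).app d T
  | .call e => .out hs (.var (.here .zero)) (k.enc (k.facArg hs e)) .nil

theorem Kind.Atom.cl_fac {d : List S} (a : k.Atom ob [d]) :
    cl (a.fac hs A) = cl ((Interp.fac k hs A).app d a.tm) := by
  cases a with
  | pre T h => rfl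
  | call e => exact (Interp.fac_callX k hs A e).symm

theorem Kind.Atom.guard_fac {d : List S} (a : k.Atom ob [d]) : Guard (a.fac hs A) := by
  cases a with
  | pre T h => exact (h.ren _ _).sub _
  | call e => exact .out _ _ _ _

theorem cl_bigPar_fac {d : List S} (M : Multiset (k.Atom ob [d])) :
    cl (bigPar (M.map (Kind.Atom.fac hs A)))
      = cl ((Interp.fac k hs A).app d (bigPar (M.map Kind.Atom.tm))) := by
  rw [Interp.cl_app_bigPar]
  simp only [cl_bigPar, Multiset.map_map, Function.comp_def, Kind.Atom.cl_fac]

/-- The handler inputs on the trigger name. -/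
theorem Kind.hand_inG {d : List S} {r : S} {τ : Ty S} {a : Nm [s :: d] r}
    {T : Tm ob [s :: d] [[τ]] .proc}
    (h : InG (k.hand hs (.var (.here .zero) : Nm [s :: d] s) A) a T) (b : Nm [d] r) :
    a ≠ NMap.emb s d r b := by
  rw [Kind.hand] at h
  cases h
  exact fun h => NMap.emb_ne _ h.symm

theorem NMap.emb_injective {Δ : List (List S)} {d : List S} {r : S} {b b' : Nm (d :: Δ) r}
    (h : NMap.emb s d r b = NMap.emb s d r b') : b = b' := by
  rcases b with n | x | x <;> rcases b' with n' | y | y <;> cases h <;> rfl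

theorem add_rotate_left {M : Type*} [AddCommMonoid M] (a b c d : M) :
    a + (b + (c + d)) = c + (a + (b + d)) := by abel

theorem out_outG {d : List S} {r : S} {τ : Ty S} {a : Nm [s :: d] r} {D : Tm ob [s :: d] [] τm}
    {B : Tm ob [s :: d] [] τ} {V : Tm ob [s :: d] [] .proc}
    (h : OutG (.out hs (.var (.here .zero) : Nm [s :: d] s) D .nil) a B V) (b : Nm [d] r) :
    a ≠ NMap.emb s d r b := by
  cases h
  exact fun h => NMap.emb_ne _ h.symm

/-- The factorization of a context is simulated by the context filled with the agent. -/
theorem fac_simulates (E : Ctx ob τX .proc) :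
    Simulates (FacRel k hs A) ((Interp.fac k hs A).top E) (E.fill A) := by
  obtain ⟨d, M, hE⟩ := k.exists_canon E
  set I := Interp.fac k hs A with hI
  have emb_const : ∀ (a : NameConst S), (.const a.idx : Nm [s :: d] a.sort)
      = NMap.emb s d a.sort (.const a.idx) := fun a => rfl
  have hA : cl (I.top E) = cl (nuB (s :: d) (bigPar (k.hand hs (.var (.here .zero)) A
      ::ₘ M.map (Kind.Atom.fac hs A)))) := by
    rw [I.cl_top hE]
    refine nuB_eq ?_
    rw [cl_par, cl_bigPar_cons, cl_bigPar_fac, add_comm]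
  have hG : ∀ g ∈ k.hand hs (.var (.here .zero)) A ::ₘ M.map (Kind.Atom.fac hs A), Guard g := by
    intro g hg
    rcases Multiset.mem_cons.1 hg with rfl | hg
    · exact .rinp _ _ _
    · obtain ⟨q, hq, rfl⟩ := Multiset.mem_map.1 hg
      exact q.guard_fac
  refine ⟨fun P' h => ?_, fun P' a τ B h => ?_, fun P' cs a τ B h => ?_⟩
  · obtain ⟨r, τ, a, g, g', T, B, V, M', h1, hg, hg', h2⟩ := h.tau_canon hG hA
    rcases Multiset.cons_eq_cons.1 h1 with ⟨rfl, h3⟩ | ⟨-, N, h3, h1⟩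
    · obtain ⟨q, M2, rfl, rfl, rfl⟩ := map_eq_cons' h3
      cases q with
      | pre q hq =>
        -- a prefixed process of the context does not know the trigger name
        obtain ⟨b, B0, V0, hq', rfl, rfl, rfl⟩ := OutG.of_sub hq hg'
        exact absurd rfl (Kind.hand_inG hg b)
      | call e =>
        -- a trigger calls the handler: the filled context does not move
        have hE' : cl E = cl (nuB d (.par (k.callX e) (bigPar (M2.map Kind.Atom.tm)))) := by
          rw [hE]
          exact nuB_eq (by rw [Multiset.map_cons, cl_bigPar_cons, cl_par]; rfl)
        refine ⟨_, .refl, .inr ⟨_, cl_fill_unfold k A hE', ?_⟩⟩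
        rw [Kind.hand] at hg
        cases hg
        cases hg'
        rw [h2, Interp.cl_fac_top k hs A rfl]
        refine nuB_eq ?_
        rw [Interp.app_par, cl_par, cl_par, cl_par, cl_par, Interp.fac_call_lift, ← cl_bigPar_fac]
        refine (congrArg (· + _) (k.cl_hand_fill hs A _ _)).trans ?_
        rw [cl_nil]
        abel
    · rcases Multiset.cons_eq_cons.1 h1 with ⟨rfl, -⟩ | ⟨-, N', rfl, rfl⟩
      · cases hg'
      · obtain ⟨x, M1, rfl, rfl, h4⟩ := map_eq_cons' h3
        obtain ⟨y, M2, rfl, rfl, rfl⟩ := map_eq_cons' h4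
        cases x with
        | call e => cases hg
        | pre q hq =>
          obtain ⟨b, T0, hq1, rfl, rfl⟩ := InG.of_sub hq hg
          cases y with
          | call e => exact absurd rfl (out_outG hg' b)
          | pre q' hq' =>
            obtain ⟨b', B0, V0, hq1', hb, rfl, rfl⟩ := OutG.of_sub hq' hg'
            obtain rfl := NMap.emb_injective hb
            have hE' : cl E = cl (nuB d (.par q (.par q' (bigPar (M2.map Kind.Atom.tm))))) := by
              rw [hE]
              exact nuB_eq (by simp only [Multiset.map_cons, cl_bigPar_cons, cl_par]; rfl)
            refine ⟨_, .single ((Interp.fill A).tau hE' hq1 hq1'), .inr ⟨_, rfl, ?_⟩⟩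
            rw [h2, Interp.cl_fac_top k hs A rfl]
            refine nuB_eq ?_
            simp only [Interp.app_par, Interp.app_fill, cl_par, cl_bigPar_cons, cl_bigPar_fac]
            exact add_rotate_left _ _ _ _
  · obtain ⟨g, T, M', h1, hg, h2⟩ := h.inp_canon hG hA
    rcases Multiset.cons_eq_cons.1 h1 with ⟨rfl, -⟩ | ⟨-, N, h3, rfl⟩
    · exact absurd (emb_const a) (Kind.hand_inG hg _)
    · obtain ⟨x, M1, rfl, rfl, rfl⟩ := map_eq_cons' h3
      cases x with
      | call e => cases hg
      | pre q hq =>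
        obtain ⟨b, T0, hq1, hb, rfl⟩ := InG.of_sub hq hg
        obtain rfl := NMap.emb_injective ((emb_const a).symm.trans hb)
        have hE' : cl E = cl (nuB d (.par q (bigPar (M1.map Kind.Atom.tm)))) := by
          rw [hE]
          exact nuB_eq (by simp only [Multiset.map_cons, cl_bigPar_cons, cl_par]; rfl)
        refine ⟨_, .of_step ((Interp.fill A).inp hE' hq1 B), .inr ⟨_, rfl, ?_⟩⟩
        rw [h2, Interp.cl_fac_top k hs A rfl]
        refine nuB_eq ?_
        simp only [Interp.app_par, Interp.app_fill, Interp.app_lift, cl_par, cl_bigPar_cons,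
          cl_bigPar_fac]
        exact add_left_comm _ _ _
  · obtain ⟨g, B', V, M', h1, hg, h2⟩ := h.out_canon hG hA
    rcases Multiset.cons_eq_cons.1 h1 with ⟨rfl, -⟩ | ⟨-, N, h3, rfl⟩
    · cases hg
    · obtain ⟨x, M1, rfl, rfl, rfl⟩ := map_eq_cons' h3
      cases x with
      | call e => exact absurd (emb_const a) (out_outG hg _)
      | pre q hq =>
        obtain ⟨b, B0, V0, hq1, hb, rfl, rfl⟩ := OutG.of_sub hq hg
        obtain rfl := NMap.emb_injective ((emb_const a).symm.trans hb)
        have hE' : cl E = cl (nuB d (.par q (bigPar (M1.map Kind.Atom.tm)))) := by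
          rw [hE]
          exact nuB_eq (by simp only [Multiset.map_cons, cl_bigPar_cons, cl_par]; rfl)
        obtain ⟨ds, D, Q', hst, h3⟩ := (Interp.fill A).out hE' hq1
        refine ⟨ds, D, Q', .of_step hst,
          fun C hC => .inr ⟨_, h3 C (hC.mono_left (by simp)), ?_⟩⟩
        rw [h2 C (hC.mono_left (by simp)), Interp.cl_fac_top k hs A rfl]
        refine nuB_eq ?_
        simp only [Interp.app_par, Interp.app_fill, Interp.app_under, cl_par, cl_bigPar_cons,
          cl_bigPar_fac]
        exact add_rotate_left _ _ _ _

/-- The factorization theorem for contexts that are processes. -/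
theorem CtBisim.factorization (E : Ctx ob τX .proc) {P Q : Proc ob} (hP : cl P = cl (E.fill A))
    (hQ : cl Q = cl ((Interp.fac k hs A).top E)) : CtBisim .proc P Q := by
  refine ⟨FacRel k hs A, .of_simulates (fun _ _ => FacRel.symm) ?_, .inl ⟨E, hP, hQ⟩⟩
  rintro P Q (⟨E, h1, h2⟩ | ⟨E, h1, h2⟩)
  · exact (simulates_fac E).facRel_congr h1 h2
  · exact (fac_simulates E).facRel_congr h2 h1

end Factorization

/-! ### Processes below abstractions -/

section Under

variable {Δ Δ' : List (List S)} {Γ Γ' Γ'' : List (List (Ty S))} {τX τm : Ty S}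

/-- Apply both sides to the variables which the abstraction binds. -/
theorem Cong.of_pabs {d : Ty S} {ds : List (Ty S)} {ρ : Ty S}
    {T T' : Tm ob Δ ((d :: ds) :: Γ) ρ} (h : Cong (.pabs T) (.pabs T')) : Cong T T' := by
  have key : ∀ T : Tm ob Δ ((d :: ds) :: Γ) ρ,
      Cong (.papp ((Tm.pabs T).wkV (d :: ds)) (fun _ x => .var (.here x))) T := by
    intro T
    have h1 := Cong.pbeta (T.ren (NMap.id Δ) (VMap.up (fun _ x => .there x) (d :: ds)))
      (fun _ x => Tm.var (ob := ob) (Δ := Δ) (Γ := (d :: ds) :: Γ) (.here x))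
    have h2 : (T.ren (NMap.id Δ) (VMap.up (fun _ x => .there x) (d :: ds))).sub
        (Sub.inst fun _ x => Tm.var (ob := ob) (Δ := Δ) (Γ := (d :: ds) :: Γ) (.here x)) = T := by
      rw [Tm.ren_sub, Tm.ren_id]
      refine Eq.trans ?_ T.sub_var
      congr 1
      funext τ x; cases x <;> rfl
    rw [h2] at h1
    exact h1
  exact (key T).symm.trans ((Cong.papp (h.ren _ _) fun _ _ => .refl _).trans (key T'))

/-- Apply both sides to the names which the abstraction binds. -/
theorem Cong.of_nabs {t : S} {ts : List S} {ρ : Ty S}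
    {T T' : Tm ob ((t :: ts) :: Δ) Γ ρ} (h : Cong (.nabs T) (.nabs T')) : Cong T T' := by
  have key : ∀ T : Tm ob ((t :: ts) :: Δ) Γ ρ,
      Cong (.napp ((Tm.nabs T).wkN (t :: ts)) (fun _ x => .var (.here x))) T := by
    intro T
    have h1 := Cong.nbeta (T.ren ((NMap.wk (t :: ts)).up (t :: ts)) (fun _ x => x))
      (fun _ x => Nm.var (Δ := (t :: ts) :: Δ) (.here x))
    have h2 : (T.ren ((NMap.wk (t :: ts)).up (t :: ts)) (fun _ x => x)).ren
        (NMap.inst fun _ x => Nm.var (Δ := (t :: ts) :: Δ) (.here x)) (fun _ x => x) = T := by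
      rw [Tm.ren_comp]
      refine Eq.trans ?_ T.ren_id
      congr 1
      apply NMap.ext_cases
      · intros; rfl
      · intro s x; cases x <;> rfl
    rw [h2] at h1
    exact h1
  exact (key T).symm.trans ((Cong.napp _ (h.ren _ _)).trans (key T'))

theorem Cong.absAll : ∀ (σ : Ty S) {Δ : List (List S)} {Γ : List (List (Ty S))}
    {T T' : Tm ob (underN σ Δ) (underV σ Γ) .proc},
    Cong T T' → Cong (HO.absAll σ T) (HO.absAll σ T')
  | .proc, _, _, _, _, h => h
  | .pabs _ _ ρ, _, _, _, _, h => .pabs (Cong.absAll ρ h)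
  | .nabs _ _ ρ, _, _, _, _, h => .nabs (Cong.absAll ρ h)

/-- An abstraction can be applied to the variables and names it binds, so the process below all the
abstractions is determined up to structural congruence. -/
theorem Cong.of_absAll : ∀ (σ : Ty S) {Δ : List (List S)} {Γ : List (List (Ty S))}
    {T T' : Tm ob (underN σ Δ) (underV σ Γ) .proc},
    Cong (HO.absAll σ T) (HO.absAll σ T') → Cong T T'
  | .proc, _, _, _, _, h => h
  | .pabs _ _ ρ, _, _, _, _, h => Cong.of_absAll ρ h.of_pabs
  | .nabs _ _ ρ, _, _, _, _, h => Cong.of_absAll ρ h.of_nabs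

/-- Lifting of a map on names below all the abstractions of a term of type `σ`. -/
def NMap.under : ∀ (σ : Ty S) {Δ Δ' : List (List S)},
    NMap Δ Δ' → NMap (underN σ Δ) (underN σ Δ')
  | .proc, _, _, f => f
  | .pabs _ _ ρ, _, _, f => NMap.under ρ f
  | .nabs t ts ρ, _, _, f => NMap.under ρ (f.up (t :: ts))

/-- Lifting of a substitution below all the abstractions on agents of a term of type `σ`, the names
in scope being already those below the abstractions on names. -/
def Sub.underV : ∀ (σ : Ty S) {Δ : List (List S)} {Γ Γ' : List (List (Ty S))},
    Sub ob Δ Γ Γ' → Sub ob Δ (HO.underV σ Γ) (HO.underV σ Γ')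
  | .proc, _, _, _, f => f
  | .pabs d ds ρ, _, _, _, f => Sub.underV ρ (f.upV (d :: ds))
  | .nabs _ _ ρ, _, _, _, f => Sub.underV ρ f

theorem NMap.under_const : ∀ (σ : Ty S) {Δ Δ' : List (List S)} (f : NMap Δ Δ')
    (_ : ∀ s n, f s (.const n) = .const n) (s : S) (n : ℕ), f.under σ s (.const n) = .const n
  | .proc, _, _, _, hf, s, n => hf s n
  | .pabs _ _ ρ, _, _, f, hf, s, n => NMap.under_const ρ f hf s n
  | .nabs t ts ρ, _, _, f, hf, s, n =>
      NMap.under_const ρ (f.up (t :: ts)) (fun s n => by rw [NMap.up_const, hf]; rfl) s n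

theorem absAll_ren : ∀ (σ : Ty S) {Δ Δ' : List (List S)} {Γ : List (List (Ty S))}
    (T : Tm ob (underN σ Δ) (underV σ Γ) .proc) (f : NMap Δ Δ'),
    (absAll σ T).ren f (fun _ x => x) = absAll σ (T.ren (f.under σ) (fun _ x => x))
  | .proc, _, _, _, _, _ => rfl
  | .pabs d ds ρ, _, _, _, T, f => by
      simp only [absAll, Tm.ren, VMap.up_id']
      exact congrArg Tm.pabs (absAll_ren ρ T f)
  | .nabs t ts ρ, _, _, _, T, f => congrArg Tm.nabs (absAll_ren ρ T (f.up (t :: ts)))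

theorem absAll_sub : ∀ (σ : Ty S) {Δ : List (List S)} {Γ Γ' : List (List (Ty S))}
    (T : Tm ob (underN σ Δ) (underV σ Γ) .proc) (f : Sub ob Δ Γ Γ'),
    (absAll σ T).sub f = absAll σ (T.sub (f.under σ))
  | .proc, _, _, _, _, _ => rfl
  | .pabs d ds ρ, _, _, _, T, f => congrArg Tm.pabs (absAll_sub ρ T (f.upV (d :: ds)))
  | .nabs t ts ρ, _, _, _, T, f => congrArg Tm.nabs (absAll_sub ρ T (f.upN (t :: ts)))

theorem Sub.underV_ren : ∀ (σ : Ty S) {Δ Δ' : List (List S)} {Γ Γ' : List (List (Ty S))}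
    (f : Sub ob Δ Γ Γ') (g : NMap Δ Δ'),
    (fun τ x => (f.underV σ τ x).ren g (fun _ x => x)) =
      Sub.underV σ (fun τ x => (f τ x).ren g (fun _ x => x))
  | .proc, _, _, _, _, _, _ => rfl
  | .pabs d ds ρ, _, _, _, _, f, g => by
      refine (Sub.underV_ren ρ _ g).trans (congrArg (Sub.underV ρ) ?_)
      have := f.upV_ren g (fun _ x => x) (d :: ds)
      rwa [VMap.up_id'] at this
  | .nabs _ _ ρ, _, _, _, _, f, g => Sub.underV_ren ρ f g

theorem Sub.underV_sub : ∀ (σ : Ty S) {Δ : List (List S)} {Γ Γ' Γ'' : List (List (Ty S))}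
    (f : Sub ob Δ Γ Γ') (g : Sub ob Δ Γ' Γ''),
    (fun τ x => (f.underV σ τ x).sub (g.underV σ)) = Sub.underV σ (fun τ x => (f τ x).sub g)
  | .proc, _, _, _, _, _, _ => rfl
  | .pabs d ds ρ, _, _, _, _, f, g =>
      (Sub.underV_sub ρ _ _).trans (congrArg (Sub.underV ρ) (f.upV_sub g (d :: ds)))
  | .nabs _ _ ρ, _, _, _, _, f, g => Sub.underV_sub ρ f g

/-- A family of substitutions, one for each context of bound names, that is stable under weakening
is lifted below the abstractions on names by moving along the family. -/
theorem Sub.under_eq_underV : ∀ (σ : Ty S) {Γ Γ' : List (List (Ty S))}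
    (f : ∀ Δ : List (List S), Sub ob Δ Γ Γ') (_ : ∀ Δ d, (f Δ).upN d = f (d :: Δ))
    (Δ : List (List S)), (f Δ).under σ = (f (underN σ Δ)).underV σ
  | .proc, _, _, _, _, _ => rfl
  | .pabs d ds ρ, _, _, f, hf, Δ => by
      refine Sub.under_eq_underV ρ (fun Δ => (f Δ).upV (d :: ds)) (fun Δ e => ?_) Δ
      have := (f Δ).upV_ren (NMap.wk e) (fun _ x => x) (d :: ds)
      rw [VMap.up_id'] at this
      exact this.trans (congrArg (fun g => Sub.upV g (d :: ds)) (hf Δ e))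
  | .nabs t ts ρ, _, _, f, hf, Δ => by
      rw [Sub.under, hf]
      exact Sub.under_eq_underV ρ f hf _

theorem Sub.inst_one_trig_ren (k : Kind S τX τm) {s : S} (h : ob s = τm) (v : Nm Δ s)
    (f : NMap Δ Δ') :
    (fun τ x => (Sub.inst (Γ := Γ) (one (k.trig h v)) τ x).ren f (fun _ x => x)) =
      Sub.inst (one (k.trig h (f s v))) := by
  funext τ x
  rcases x with (_ | x) | x
  · exact k.trig_ren h v f _
  · cases x
  · rfl

/-! ### Restricting a fresh constant -/

open Classical in
/-- Replacement of the constant `c` by another constant of the same sort. -/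
def NMap.avoid (c : NameConst S) (Δ : List (List S)) : NMap Δ Δ
  | s, .const n => .const (if (⟨s, n⟩ : NameConst S) = c then n + 1 else n)
  | _, .var x => .var x

theorem NMap.avoid_up (c : NameConst S) (Δ : List (List S)) (d : List S) :
    (NMap.avoid c Δ).up d = NMap.avoid c (d :: Δ) := by
  apply NMap.ext_cases
  · intros; rfl
  · intro s x; cases x <;> rfl

theorem NMap.avoid_under (c : NameConst S) : ∀ (σ : Ty S) (Δ : List (List S)),
    (NMap.avoid c Δ).under σ = NMap.avoid c (underN σ Δ)
  | .proc, _ => rfl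
  | .pabs _ _ ρ, Δ => NMap.avoid_under c ρ Δ
  | .nabs t ts ρ, Δ => by
      rw [NMap.under, NMap.avoid_up]
      exact NMap.avoid_under c ρ _

/-- Binding the constant `c` has no effect where `c` has been replaced. -/
theorem NMap.avoid_bind (c : NameConst S) (Δ : List (List S)) :
    (NMap.avoid c Δ).comp (NMap.bind c) = (NMap.avoid c Δ).comp (NMap.wk [c.sort]) := by
  apply NMap.ext_cases
  · intro s n
    refine NMap.bind_ne fun h => ?_
    split_ifs at h with hn
    · have h1 := congrArg NameConst.idx (h.trans hn.symm)
      exact absurd h1 (Nat.succ_ne_self n)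
    · exact hn h
  · intros; rfl

/-- Congruent terms need not have the same free names.  Still, if a constant is not free in one of
them, binding it has no effect, up to congruence, on the other. -/
theorem cl_bind_of_notMem {c : NameConst S} {σ : Ty S} {E : Tm ob Δ Γ σ}
    {E' : Tm ob (underN σ Δ) (underV σ Γ) .proc} (h : Cong E (absAll σ E')) (hc : c ∉ E.fn) :
    cl (E'.ren (NMap.bind c) (fun _ x => x)) = cl (E'.wkN [c.sort]) := by
  have h1 : E.ren (NMap.avoid c Δ) (fun _ x => x) = E := by
    refine (E.ren_congr_fn (NMap.avoid c Δ) (NMap.id Δ) _ (fun s n hn => ?_)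
      fun _ _ => rfl).trans E.ren_id
    simp only [NMap.avoid]
    rw [if_neg fun hs => hc (by rwa [hs] at hn)]
  have h2 := h.ren (NMap.avoid c Δ) (fun _ x => x)
  rw [h1, absAll_ren, NMap.avoid_under] at h2
  have h3 := cl_eq.2 (Cong.of_absAll σ (h.symm.trans h2))
  calc cl (E'.ren (NMap.bind c) (fun _ x => x))
      = cl (E'.ren ((NMap.avoid c _).comp (NMap.bind c)) (fun _ x => x)) := by
        rw [← Tm.ren_comp]; exact cl_ren h3 _ _
    _ = cl (E'.ren ((NMap.avoid c _).comp (NMap.wk [c.sort])) (fun _ x => x)) := by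
        rw [NMap.avoid_bind]
    _ = cl (E'.wkN [c.sort]) := by
        rw [← Tm.ren_comp]; exact (cl_ren h3 _ _).symm

/-- The process `(v)(E f | h)` where `f` is a substitution that may use the restricted name `v`
and `h` is the handler at `v`. -/
def Kind.facSub (k : Kind S τX τm) {s : S} (hs : ob s = τm) (A : Closed ob τX)
    (E : Tm ob Δ Γ .proc) (f : Sub ob ([s] :: Δ) Γ Γ') : Tm ob Δ Γ' .proc :=
  .nu s (.par ((E.wkN [s]).sub f) (k.hand hs (.var (.here .zero)) A))

/-- The substitution of the trigger at the innermost bound name for the innermost variable. -/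
def Kind.trigSub (k : Kind S τX τm) {s : S} (hs : ob s = τm) (Δ : List (List S))
    (Γ : List (List (Ty S))) : Sub ob ([s] :: Δ) ([τX] :: Γ) Γ :=
  Sub.inst (one (k.trig hs (.var (.here .zero))))

/-- The factored process `(v)(E'[trigger at v] | handler at v)` below the abstractions of a term of
type `σ`. -/
def Kind.facUnder (k : Kind S τX τm) {s : S} (hs : ob s = τm) (A : Closed ob τX) (σ : Ty S)
    (E' : Tm ob (underN σ []) (underV σ [[τX]]) .proc) :
    Tm ob (underN σ []) (underV σ []) .proc :=
  k.facSub hs A E' (Sub.underV σ (k.trigSub hs _ []))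

/-- The factored process with a constant `m` as trigger name, which is bound by the restriction
afterwards, is the one with a bound trigger name. -/
theorem Kind.cl_res_eq_facUnder (k : Kind S τX τm) (m : NameConst S) (hm : ob m.sort = τm)
    (A : Closed ob τX) {σ : Ty S} {E : Ctx ob τX σ}
    {E' : Tm ob (underN σ []) (underV σ [[τX]]) .proc} (h : Cong E (absAll σ E'))
    (hE : m ∉ E.fn) (hA : m ∉ A.fn) :
    cl (res m (.par (fillUnder σ E' (k.trig hm (.const m.idx)))
      ((k.hand hm (.const m.idx) A : Proc ob).lift _ _))) = cl (k.facUnder hm A σ E') := by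
  have h1 : (fillUnder σ E' (k.trig hm (.const m.idx))).ren (NMap.bind m) (fun _ x => x) =
      (E'.ren (NMap.bind m) (fun _ x => x)).sub
        (Sub.underV σ (k.trigSub hm _ [])) := by
    rw [Kind.trigSub, fillUnder, Sub.under_eq_underV σ
      (fun Δ => Sub.inst (one (k.trig hm (.const m.idx) : Tm ob Δ [] τX)))
      (fun Δ d => Sub.inst_one_trig_ren k hm _ _), Tm.sub_ren, Sub.underV_ren,
      Sub.inst_one_trig_ren, NMap.bind_self]
  have h2 : ((k.hand hm (.const m.idx) A : Proc ob).lift (underN σ []) (underV σ [])).ren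
      (NMap.bind m) (fun _ x => x) = k.hand hm (.var (.here .zero)) A := by
    rw [Tm.lift, k.hand_ren hm _ A _ _ fun _ _ => rfl, k.hand_ren hm _ A _ _ fun c hc =>
      NMap.bind_ne (c := m) (s := c.sort) (n := c.idx) fun h => hA (h ▸ hc)]
    exact congrArg (fun v => k.hand hm v A) (NMap.bind_self m)
  rw [res, Tm.ren, h1, h2, Kind.facUnder, Kind.facSub, cl_nu, cl_par,
    cl_sub (cl_bind_of_notMem h hE), ← cl_par, ← cl_nu]

/-! ### Instantiating the abstractions -/

/-- Instantiating an abstraction on agents commutes with factorization. -/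
theorem Kind.facSub_sub (k : Kind S τX τm) {s : S} (hs : ob s = τm) (A : Closed ob τX)
    {d : List (Ty S)} {ρ : Ty S} (E : Tm ob (underN ρ []) (underV ρ [d, [τX]]) .proc)
    (K : ∀ τ, Pos d τ → Closed ob τ) :
    (k.facSub hs A E (Sub.underV ρ ((k.trigSub hs _ []).upV d))).sub (Sub.under ρ (Sub.inst K)) =
      k.facUnder hs A ρ (E.sub (Sub.under ρ (Sub.inst fun τ x => (K τ x).lift [] [[τX]]))) := by
  -- substitutions of closed agents do not depend on the bound names
  have key : ∀ Γ : List (List (Ty S)),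
      (Sub.under ρ (Sub.inst fun τ x => (K τ x).lift [] Γ)).upN [s] =
        Sub.underV ρ (Sub.inst fun τ x => (K τ x).lift ([s] :: underN ρ []) Γ) := by
    intro Γ
    have hn : ∀ Δ e, Sub.upN (Sub.inst fun τ x => (K τ x).lift Δ Γ) e =
        Sub.inst fun τ x => (K τ x).lift (e :: Δ) Γ := by
      intro Δ e
      funext τ x
      cases x with
      | here x => exact (K τ x).lift_ren _ _ fun _ _ => rfl
      | there x => rfl
    rw [Sub.under_eq_underV ρ (fun Δ => Sub.inst fun τ x => (K τ x).lift Δ Γ) hn]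
    refine (Sub.underV_ren ρ _ _).trans (congrArg (Sub.underV ρ) (hn _ _))
  have k0 := key []
  simp only [Tm.lift_self] at k0
  have h1 : (E.sub (Sub.under ρ (Sub.inst fun τ x => (K τ x).lift [] [[τX]]))).wkN [s] =
      (E.wkN [s]).sub ((Sub.under ρ (Sub.inst fun τ x => (K τ x).lift [] [[τX]])).upN [s]) :=
    Tm.sub_ren _ _ _ _
  simp only [Kind.facUnder, Kind.facSub, Tm.sub, k.hand_sub]
  rw [h1, key, k0, Tm.sub_sub, Tm.sub_sub, Sub.underV_sub, Sub.underV_sub]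
  congr 4
  funext τ x
  rcases x with x | (_ | x) | x
  · exact ((K τ x).lift_sub _).symm
  · exact (congrArg (fun T => Tm.sub T _) (k.trig_ren hs _ _ _)).trans (k.trig_sub hs _ _)
  · cases x
  · cases x

/-- Instantiating an abstraction on names commutes with factorization. -/
theorem Kind.facSub_ren (k : Kind S τX τm) {s : S} (hs : ob s = τm) (A : Closed ob τX)
    {d : List S} {ρ : Ty S} (E : Tm ob (underN ρ [d]) (underV ρ [[τX]]) .proc)
    (K : ∀ s, Pos d s → Nm [] s) :
    (k.facSub hs A E (Sub.underV ρ (k.trigSub hs _ []))).ren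
        (NMap.under ρ (NMap.inst K)) (fun _ x => x) =
      k.facUnder hs A ρ (E.ren (NMap.under ρ (NMap.inst K)) (fun _ x => x)) := by
  have hc := NMap.under_const ρ (NMap.inst K) fun _ _ => rfl
  simp only [Kind.facUnder, Kind.facSub, Tm.ren]
  rw [k.hand_ren hs _ A _ _ fun c _ => by rw [NMap.up_const, hc]; rfl, Tm.sub_ren,
    Sub.underV_ren, Kind.trigSub, Sub.inst_one_trig_ren, Kind.trigSub]
  have h : (E.wkN [s]).ren ((NMap.under ρ (NMap.inst K)).up [s]) (fun _ x => x) =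
      (E.ren (NMap.under ρ (NMap.inst K)) (fun _ x => x)).wkN [s] := by
    rw [Tm.wkN, Tm.wkN, Tm.ren_comp, Tm.ren_comp]
    congr 1
    funext r a
    exact NMap.up_wk _ _ _ _
  rw [h]
  rfl

/-- Factorization below abstractions: instantiating the abstractions on both sides turns the claim
into factorization for the instance of the context. -/
theorem factorization_absAll (k : Kind S τX τm) {s : S} (hs : ob s = τm) (A : Closed ob τX) :
    ∀ (σ : Ty S) (E' : Tm ob (underN σ []) (underV σ [[τX]]) .proc) (F G : Closed ob σ),
      cl F = cl ((absAll σ E' : Ctx ob τX σ).fill A) →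
      cl G = cl (absAll σ (k.facUnder hs A σ E')) → CtBisim σ F G
  | .proc, E', F, G, hF, hG => CtBisim.factorization E' hF hG
  | .pabs d ds ρ, E', F, G, hF, hG => fun K => by
      refine factorization_absAll k hs A ρ
        (E'.sub (Sub.under ρ (Sub.inst fun τ x => (K τ x).lift [] [[τX]]))) _ _ ?_ ?_
      · refine (cl_eq.2 (.papp (cl_eq.1 hF) fun _ _ => .refl _)).trans
          ((cl_eq.2 (.pbeta _ _)).trans (congrArg cl ?_))
        have h := Sub.inst_sub (fun τ x => (K τ x).lift [] [[τX]]) (Sub.inst (one A)) ρ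
          (absAll ρ (Γ := [d :: ds, [τX]]) E')
        simp only [Tm.lift_sub, Tm.lift_self] at h
        exact h.symm.trans (congrArg (fun T => Tm.fill T A) (absAll_sub ρ _ _))
      · refine (cl_eq.2 (.papp (cl_eq.1 hG) fun _ _ => .refl _)).trans
          ((cl_eq.2 (.pbeta _ _)).trans (congrArg cl ?_))
        exact (absAll_sub ρ _ _).trans (congrArg (absAll ρ) (k.facSub_sub (ρ := ρ) hs A E' K))
  | .nabs t ts ρ, E', F, G, hF, hG => fun K => by
      refine factorization_absAll k hs A ρ
        (Tm.ren (Δ := underN ρ [t :: ts]) E' (NMap.under ρ (NMap.inst K)) (fun _ x => x)) _ _ ?_ ?_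
      · refine (cl_eq.2 (.napp K (cl_eq.1 hF))).trans
          ((cl_eq.2 (.nbeta _ _)).trans (congrArg cl ?_))
        exact (NMap.inst_sub K (Sub.inst (one A)) ρ (absAll ρ (Δ := [t :: ts]) E')).symm.trans
          (congrArg (fun T => Tm.fill T A) (absAll_ren ρ _ _))
      · refine (cl_eq.2 (.napp K (cl_eq.1 hG))).trans
          ((cl_eq.2 (.nbeta _ _)).trans (congrArg cl ?_))
        exact (absAll_ren ρ _ _).trans (congrArg (absAll ρ) (k.facSub_ren (ρ := ρ) hs A E' K))

/-- Factorization for a context that is congruent to an abstraction, with a constant as trigger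
name. -/
theorem factorization_res (k : Kind S τX τm) (σ : Ty S) (E : Ctx ob τX σ)
    (E' : Tm ob (underN σ []) (underV σ [[τX]]) .proc) (A : Closed ob τX) (m : NameConst S)
    (hm : ob m.sort = τm) (h : Cong E (absAll σ E')) (hE : m ∉ E.fn) (hA : m ∉ A.fn) :
    CtBisim σ (E.fill A) (absAll σ (res m (.par (fillUnder σ E' (k.trig hm (.const m.idx)))
      ((k.hand hm (.const m.idx) A : Proc ob).lift _ _)))) :=
  factorization_absAll k hm A σ E' _ _ (cl_sub (cl_eq.2 h) _)
    (cl_eq.2 (.absAll σ (cl_eq.1 (k.cl_res_eq_facUnder m hm A h hE hA))))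

theorem factorization_res_proc (k : Kind S τX τm) (E : Ctx ob τX .proc) (A : Closed ob τX)
    (m : NameConst S) (hm : ob m.sort = τm) (hE : m ∉ E.fn) (hA : m ∉ A.fn) :
    CtBisim .proc (E.fill A) (res m (.par (E.fill (k.trig hm (.const m.idx)))
      (k.hand hm (.const m.idx) A))) := by
  have h := factorization_res k .proc E E A m hm (.refl _) hE hA
  have e : (k.hand hm (.const m.idx) A : Proc ob).lift (underN .proc []) (underV .proc []) =
      k.hand hm (.const m.idx) A := Tm.lift_self _
  rwa [e] at h

end Under

end HO

end

theorem mainTheorem2 {S : Type*} (ob : S → HO.Ty S) :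
    -- `E[X]` is a process
    ((∀ (E : HO.Ctx ob .proc .proc) (A : HO.Proc ob)
        (m : HO.NameConst S) (hm : ob m.sort = .proc), m ∉ E.fn → m ∉ A.fn →
        HO.CtBisim .proc (E.fill A)
          (HO.res m (.par (E.fill (HO.trigger m hm)) (HO.handler m hm A)))) ∧
      (∀ (τ : HO.Ty S) (E : HO.Ctx ob (.pabs τ [] .proc) .proc)
        (A : HO.Closed ob (.pabs τ [] .proc))
        (m : HO.NameConst S) (hm : ob m.sort = τ), m ∉ E.fn → m ∉ A.fn →
        HO.CtBisim .proc (E.fill A)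
          (HO.res m (.par (E.fill (HO.triggerP m hm)) (HO.handlerP m hm A)))) ∧
      (∀ (t : S) (E : HO.Ctx ob (.nabs t [] .proc) .proc)
        (A : HO.Closed ob (.nabs t [] .proc))
        (m : HO.NameConst S) (hm : ob m.sort = .pabs (.nabs t [] .proc) [] .proc),
        m ∉ E.fn → m ∉ A.fn →
        HO.CtBisim .proc (E.fill A)
          (HO.res m (.par (E.fill (HO.triggerN m hm)) (HO.handlerN m hm A))))) ∧
    -- `E[X]` is an abstraction `⟨Ũ₁⟩⋯⟨Ũₖ⟩E'` of type `σ`, up to structural congruence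
    ((∀ (σ : HO.Ty S) (E : HO.Ctx ob .proc σ)
        (E' : HO.Tm ob (HO.underN σ []) (HO.underV σ [[.proc]]) .proc)
        (A : HO.Proc ob)
        (m : HO.NameConst S) (hm : ob m.sort = .proc), HO.Cong E (HO.absAll σ E') →
        m ∉ E.fn → m ∉ A.fn →
        HO.CtBisim σ (E.fill A)
          (HO.absAll σ (HO.res m (.par (HO.fillUnder σ E' (HO.trigger m hm))
            ((HO.handler m hm A).lift _ _))))) ∧
      (∀ (σ τ : HO.Ty S) (E : HO.Ctx ob (.pabs τ [] .proc) σ)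
        (E' : HO.Tm ob (HO.underN σ []) (HO.underV σ [[.pabs τ [] .proc]]) .proc)
        (A : HO.Closed ob (.pabs τ [] .proc))
        (m : HO.NameConst S) (hm : ob m.sort = τ), HO.Cong E (HO.absAll σ E') →
        m ∉ E.fn → m ∉ A.fn →
        HO.CtBisim σ (E.fill A)
          (HO.absAll σ (HO.res m (.par (HO.fillUnder σ E' (HO.triggerP m hm))
            ((HO.handlerP m hm A).lift _ _))))) ∧
      (∀ (σ : HO.Ty S) (t : S) (E : HO.Ctx ob (.nabs t [] .proc) σ)
        (E' : HO.Tm ob (HO.underN σ []) (HO.underV σ [[.nabs t [] .proc]]) .proc)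
        (A : HO.Closed ob (.nabs t [] .proc))
        (m : HO.NameConst S) (hm : ob m.sort = .pabs (.nabs t [] .proc) [] .proc),
        HO.Cong E (HO.absAll σ E') → m ∉ E.fn → m ∉ A.fn →
        HO.CtBisim σ (E.fill A)
          (HO.absAll σ (HO.res m (.par (HO.fillUnder σ E' (HO.triggerN m hm))
            ((HO.handlerN m hm A).lift _ _)))))) := by
  exact ⟨⟨HO.factorization_res_proc .proc, fun τ => HO.factorization_res_proc (.agent τ),
    fun t => HO.factorization_res_proc (.name t)⟩,
    HO.factorization_res .proc, fun σ τ => HO.factorization_res (.agent τ) σ,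
    fun σ t => HO.factorization_res (.name t) σ⟩
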